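/- Let $\mathbb{K}=\mathbb{R}$ or $\mathbb{K}=\mathbb{C}$ and let $\lambda,\mu\in\mathbb{K}$. Let $S^1=\mathbb{R}/\mathbb{Z}$ with coordinate $x$, and let $\mathrm{Diff}_+(S^1)$ be the group of orientation-preserving $C^\infty$-diffeomorphisms of $S^1$. Let $\mathcal{F}_\lambda$ be the space $C^\infty(S^1,\mathbb{K})$, whose elements are written $\phi(x)(dx)^\lambda$, with the action of $\mathrm{Diff}_+(S^1)$ given by $$\rho^\lambda_{f^{-1}}\big(\phi(x)(dx)^\lambda\big)=(f'(x))^\lambda\,\phi(f(x))\,(dx)^\lambda .$$ Let $\mathcal{D}^2_{\lambda,\mu}(S^1)$ be the space of linear differential operators $A=a_2(x)\frac{d^2}{dx^2}+a_1(x)\frac{d}{dx}+a_0(x)$, $a_i\in C^\infty(S^1,\mathbb{K})$, from $\mathcal{F}_\lambda$ to $\mathcal{F}_\mu$, with the action $A\mapsto\rho^\mu_f\circ A\circ\rho^\lambda_{f^{-1}}$ of $\mathrm{Diff}_+(S^1)$, and let $\mathcal{I}^2_{\lambda,\mu}(S^1)$ be the associative algebra, under composition, of all $\mathbb{K}$-linear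 maps $\mathcal{D}^2_{\lambda,\mu}(S^1)\to\mathcal{D}^2_{\lambda,\mu}(S^1)$ commuting with this action (no locality or continuity is required). Let $\mathbb{K}^n$ be the direct sum of $n$ copies of the algebra $\mathbb{K}$, let $\mathfrak{t}_2$ be the algebra of lower triangular $2\times2$ matrices over $\mathbb{K}$, and let $$\mathfrak{a}=\left\{\begin{pmatrix}a&0\\ b&a\end{pmatrix}: a,b\in\mathbb{K}\right\},\qquad \mathfrak{b}=\left\{\begin{pmatrix}a&0&0&d\\0&a&0&0\\0&c&b&0\\0&0&0&b\end{pmatrix}: a,b,c,d\in\mathbb{K}\right\}.$$ Then, as associative $\mathbb{K}$-algebras, $\mathcal{I}^2_{\lambda,\mu}(S^1)\cong\mathbb{K}^2$ for all $(\lambda,\mu)\in\mathbb{K}^2$, except in the following cases: 1. $\mathcal{I}^2_{\lambda,\mu}(S^1)\cong\mathfrak{a}$ if $\mu-\lambda=1$ and $\lambda\neq0$, or if $\mu-\lambda=2$ and $\lambda\neq0,-\tfrac12,-1$; 2. $\mathcal{I}^2_{\lambda,\mu}(S^1)\cong\mathbb{K}^3$ if $\lambda=0$ and $\mu\neq2,1$,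 or if $\mu=1$ and $\lambda\neq0,-1$; 3. $\mathcal{I}^2_{-\frac12,\frac32}(S^1)\cong\mathfrak{t}_2$; 4. $\mathcal{I}^2_{0,2}(S^1)\cong\mathcal{I}^2_{-1,1}(S^1)\cong\mathfrak{a}\oplus\mathbb{K}$; 5. $\mathcal{I}^2_{0,1}(S^1)\cong\mathfrak{b}\oplus\mathbb{K}$. -/

import Mathlib

open scoped ContDiff

namespace CircleDensities

/-! ### Smooth functions and orientation-preserving diffeomorphisms of the circle

The circle is `S¹ = ℝ/ℤ` with its global coordinate `x`. -/

/-- The algebra `C^∞(S¹)` of smooth `𝕜`-valued functions on `S¹ = ℝ/ℤ`,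
i.e. smooth functions on `ℝ` of period `1`. -/
def SmoothFun (𝕜 : Type*) [RCLike 𝕜] : Subalgebra 𝕜 (ℝ → 𝕜) where
  carrier := {φ | ContDiff ℝ ∞ φ ∧ Function.Periodic φ 1}
  mul_mem' := fun ha hb => ⟨ha.1.mul hb.1, ha.2.mul hb.2⟩
  add_mem' := fun ha hb => ⟨ha.1.add hb.1, ha.2.add hb.2⟩
  algebraMap_mem' := fun _ => ⟨contDiff_const, fun _ => rfl⟩

/-- The group of lifts to `ℝ` of orientation-preserving diffeomorphisms of `S¹ = ℝ/ℤ`: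
the increasing diffeomorphisms `f` of `ℝ` with `f (x + 1) = f x + 1`. -/
def LiftDiff : Subgroup (Equiv.Perm ℝ) where
  carrier := {f | ContDiff ℝ ∞ f ∧ ContDiff ℝ ∞ f.symm ∧ StrictMono f ∧
    ∀ x, f (x + 1) = f x + 1}
  one_mem' := ⟨contDiff_id, contDiff_id, strictMono_id, fun _ => rfl⟩
  mul_mem' := by
    rintro f g ⟨hf, hf', hfm, hf1⟩ ⟨hg, hg', hgm, hg1⟩
    refine ⟨hf.comp hg, hg'.comp hf', hfm.comp hgm, fun x => ?_⟩
    simp [Equiv.Perm.mul_apply, hg1, hf1]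
  inv_mem' := by
    rintro f ⟨hf, hf', hfm, hf1⟩
    refine ⟨hf', hf, fun x y h => ?_, fun x => ?_⟩
    · have := (hfm.lt_iff_lt (a := f.symm x) (b := f.symm y)).1 (by simpa using h)
      exact this
    · change f.symm (x + 1) = f.symm x + 1
      rw [Equiv.symm_apply_eq, hf1, Equiv.apply_symm_apply]

lemma LiftDiff.contDiff (f : LiftDiff) : ContDiff ℝ ∞ (f : Equiv.Perm ℝ) := f.2.1

lemma LiftDiff.apply_add_one (f : LiftDiff) (x : ℝ) :
    (f : Equiv.Perm ℝ) (x + 1) = (f : Equiv.Perm ℝ) x + 1 := f.2.2.2.2 x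

lemma LiftDiff.differentiable (f : LiftDiff) : Differentiable ℝ (f : Equiv.Perm ℝ) :=
  (LiftDiff.contDiff f).differentiable (by simp)

lemma LiftDiff.contDiff_deriv (f : LiftDiff) :
    ContDiff ℝ ∞ (deriv (f : Equiv.Perm ℝ)) :=
  (contDiff_infty_iff_deriv.1 (LiftDiff.contDiff f)).2

lemma LiftDiff.deriv_pos (f : LiftDiff) (x : ℝ) : 0 < deriv (f : Equiv.Perm ℝ) x := by
  have h0 : 0 ≤ deriv (f : Equiv.Perm ℝ) x := f.2.2.2.1.monotone.deriv_nonneg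
  refine lt_of_le_of_ne h0 fun h => ?_
  have hs : DifferentiableAt ℝ (f : Equiv.Perm ℝ).symm ((f : Equiv.Perm ℝ) x) :=
    (f.2.2.1.differentiable (by simp)) _
  have h1 := deriv_comp x hs ((LiftDiff.differentiable f) x)
  have h2 : ((f : Equiv.Perm ℝ).symm ∘ (f : Equiv.Perm ℝ)) = id := by
    ext y; simp
  rw [h2, ← h] at h1
  simp at h1

lemma LiftDiff.deriv_periodic (f : LiftDiff) :
    Function.Periodic (deriv (f : Equiv.Perm ℝ)) 1 := by
  intro x
  rw [← deriv_comp_add_const]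
  have : (fun y => (f : Equiv.Perm ℝ) (y + 1)) = fun y => (f : Equiv.Perm ℝ) y + 1 :=
    funext (LiftDiff.apply_add_one f)
  rw [this]
  simp

lemma LiftDiff.deriv_mul (f g : LiftDiff) (x : ℝ) :
    deriv ((f * g : LiftDiff) : Equiv.Perm ℝ) x =
      deriv (f : Equiv.Perm ℝ) ((g : Equiv.Perm ℝ) x) * deriv (g : Equiv.Perm ℝ) x :=
  deriv_comp x ((LiftDiff.differentiable f) _) ((LiftDiff.differentiable g) x)

/-- The unit translation `x ↦ x + 1`, the generator of the group of deck transformations of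
`ℝ → S¹`. -/
def unitShift : LiftDiff :=
  ⟨Equiv.addRight 1, by
    refine ⟨contDiff_id.add contDiff_const, ?_, fun x y h => by simpa using h, fun x => rfl⟩
    rw [Equiv.addRight_symm]
    exact contDiff_id.add contDiff_const⟩

lemma unitShift_commute (f : LiftDiff) : unitShift * f = f * unitShift := by
  apply Subtype.ext
  ext x
  exact ((LiftDiff.apply_add_one f) x).symm

instance : (Subgroup.zpowers unitShift).Normal where
  conj_mem := by
    intro n hn g
    have h : Commute g n := by
      obtain ⟨k, rfl⟩ := Subgroup.mem_zpowers_iff.1 hn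
      exact (show Commute g unitShift from (unitShift_commute g).symm).zpow_right k
    rwa [h.eq, mul_inv_cancel_right]

/-- The group `Diff₊(S¹)` of orientation-preserving diffeomorphisms of `S¹ = ℝ/ℤ`. Every such
diffeomorphism has a lift to `ℝ`, and two lifts differ by an integer translation. -/
abbrev DiffCircle : Type := LiftDiff ⧸ Subgroup.zpowers unitShift

/-! ### Densities -/

variable {𝕜 : Type*} [RCLike 𝕜]

/-- The power `r ^ s = exp (s log r)` for `r > 0` and `s` in `𝕜 = ℝ` or `ℂ`. -/
noncomputable def posPow (r : ℝ) (s : 𝕜) : 𝕜 :=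
  NormedSpace.exp (s * ((Real.log r : ℝ) : 𝕜))

lemma posPow_one (s : 𝕜) : posPow 1 s = 1 := by simp [posPow]

lemma posPow_mul {r t : ℝ} (hr : 0 < r) (ht : 0 < t) (s : 𝕜) :
    posPow (r * t) s = posPow r s * posPow t s := by
  rw [posPow, posPow, posPow, Real.log_mul hr.ne' ht.ne', RCLike.ofReal_add, mul_add]
  exact NormedSpace.exp_add

lemma posPow_add (r : ℝ) (s s' : 𝕜) : posPow r (s + s') = posPow r s * posPow r s' := by
  rw [posPow, posPow, posPow, add_mul]
  exact NormedSpace.exp_add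

lemma contDiff_ofReal : ContDiff ℝ ∞ (fun r : ℝ => (r : 𝕜)) :=
  (RCLike.ofRealCLM (K := 𝕜)).contDiff

lemma contDiff_posPow (f : LiftDiff) (s : 𝕜) :
    ContDiff ℝ ∞ (fun x => posPow (deriv (f : Equiv.Perm ℝ) x) s) := by
  have h1 : ContDiff ℝ ∞ (NormedSpace.exp : 𝕜 → 𝕜) := by
    rw [contDiff_iff_contDiffAt]
    intro x
    exact (NormedSpace.exp_analytic (𝕂 := ℝ) x).contDiffAt
  have h2 : ContDiff ℝ ∞ (fun x => Real.log (deriv (f : Equiv.Perm ℝ) x)) :=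
    (LiftDiff.contDiff_deriv f).log fun x => ((LiftDiff.deriv_pos f) x).ne'
  exact h1.comp (contDiff_const.mul (contDiff_ofReal.comp h2))

/-- The pullback `φ (dx)^s ↦ (f')^s φ(f(x)) (dx)^s` of `s`-densities on the circle. -/
noncomputable def pullback (s : 𝕜) (f : LiftDiff) : SmoothFun 𝕜 →ₗ[𝕜] SmoothFun 𝕜 where
  toFun φ := ⟨fun x => posPow (deriv (f : Equiv.Perm ℝ) x) s *
      (φ : ℝ → 𝕜) ((f : Equiv.Perm ℝ) x),
    (contDiff_posPow f s).mul (φ.2.1.comp (LiftDiff.contDiff f)), fun x => by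
      simp only [(LiftDiff.deriv_periodic f) x, (LiftDiff.apply_add_one f) x, φ.2.2 _]⟩
  map_add' φ ψ := by ext x; simp [mul_add]
  map_smul' c φ := by ext x; simp [mul_left_comm]

lemma pullback_apply (s : 𝕜) (f : LiftDiff) (φ : SmoothFun 𝕜) (x : ℝ) :
    (pullback s f φ : ℝ → 𝕜) x =
      posPow (deriv (f : Equiv.Perm ℝ) x) s * (φ : ℝ → 𝕜) ((f : Equiv.Perm ℝ) x) := rfl

lemma pullback_one (s : 𝕜) : pullback s (1 : LiftDiff) = 1 := by
  ext φ x
  rw [pullback_apply]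
  have : deriv ((1 : LiftDiff) : Equiv.Perm ℝ) x = 1 := deriv_id x
  rw [this, posPow_one, one_mul]
  rfl

lemma pullback_mul (s : 𝕜) (f g : LiftDiff) :
    pullback s (f * g) = pullback s g * pullback s f := by
  ext φ x
  rw [Module.End.mul_apply, pullback_apply, pullback_apply, pullback_apply, LiftDiff.deriv_mul,
    posPow_mul ((LiftDiff.deriv_pos f) _) ((LiftDiff.deriv_pos g) _)]
  simp only [Subgroup.coe_mul, Equiv.Perm.mul_apply]
  ring

lemma pullback_unitShift (s : 𝕜) : pullback s unitShift = 1 := by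
  ext φ x
  rw [pullback_apply]
  have : deriv (unitShift : Equiv.Perm ℝ) x = 1 := by
    change deriv (fun y : ℝ => y + 1) x = 1
    simp
  rw [this, posPow_one, one_mul]
  exact φ.2.2 x

/-- The action of lifts of diffeomorphisms on `s`-densities: `f` acts by pullback by `f⁻¹`. -/
noncomputable def liftDensityRep (s : 𝕜) : Representation 𝕜 LiftDiff (SmoothFun 𝕜) where
  toFun f := pullback s f⁻¹
  map_one' := by rw [inv_one, pullback_one]
  map_mul' f g := by rw [mul_inv_rev, pullback_mul]

/-- The `Diff₊(S¹)`-module `𝓕_s` of `s`-densities `φ(x) (dx)^s`. As a vector space it is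
`C^∞(S¹)`, and the class of `f⁻¹` acts by `φ ↦ (f')^s φ ∘ f`. -/
noncomputable def densityRep (s : 𝕜) : Representation 𝕜 DiffCircle (SmoothFun 𝕜) :=
  QuotientGroup.lift (Subgroup.zpowers unitShift) (liftDensityRep s) (by
    rw [← Subgroup.zpowers_inv, Subgroup.zpowers_le, MonoidHom.mem_ker]
    change pullback s unitShift⁻¹⁻¹ = 1
    rw [inv_inv, pullback_unitShift])

/-! ### Differential operators -/

/-- The derivative `d/dx` on `C^∞(S¹)`. -/
noncomputable def ddx : SmoothFun 𝕜 →ₗ[𝕜] SmoothFun 𝕜 where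
  toFun φ := ⟨deriv (φ : ℝ → 𝕜), (contDiff_infty_iff_deriv.1 φ.2.1).2, fun x => by
    rw [← deriv_comp_add_const]
    exact congrArg (fun h => deriv h x) (funext φ.2.2)⟩
  map_add' φ ψ := by
    ext x
    exact deriv_add (φ.2.1.differentiable (by simp) x) (ψ.2.1.differentiable (by simp) x)
  map_smul' c φ := by
    ext x
    exact deriv_const_smul c (φ.2.1.differentiable (by simp) x)

/-- The space of linear differential operators of order at most `k` on the circle:
`A = a_k (d/dx)^k + ⋯ + a_1 d/dx + a_0` with smooth coefficients. -/
def DiffOp (𝕜 : Type*) [RCLike 𝕜] (k : ℕ) : Submodule 𝕜 (SmoothFun 𝕜 →ₗ[𝕜] SmoothFun 𝕜) where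
  carrier := {A | ∃ a : ℕ → SmoothFun 𝕜, ∀ φ,
    A φ = ∑ i ∈ Finset.range (k + 1), a i * (ddx ^ i) φ}
  zero_mem' := ⟨0, fun φ => by simp⟩
  add_mem' := by
    rintro A B ⟨a, ha⟩ ⟨b, hb⟩
    exact ⟨a + b, fun φ => by simp [ha, hb, add_mul, Finset.sum_add_distrib]⟩
  smul_mem' := by
    rintro c A ⟨a, ha⟩
    exact ⟨c • a, fun φ => by simp [ha, Finset.smul_sum]⟩

lemma ddx_mul (φ ψ : SmoothFun 𝕜) : ddx (φ * ψ) = ddx φ * ψ + φ * ddx ψ := by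
  ext x
  exact deriv_mul (φ.2.1.differentiable (by simp) x) (ψ.2.1.differentiable (by simp) x)

lemma monomial_mem_diffOp {i k : ℕ} (h : i ≤ k) (a : SmoothFun 𝕜) :
    LinearMap.mulLeft 𝕜 a ∘ₗ ddx ^ i ∈ DiffOp 𝕜 k := by
  refine ⟨fun j => if j = i then a else 0, fun φ => ?_⟩
  rw [Finset.sum_eq_single i]
  · simp
  · intro j _ hj; simp [hj]
  · intro hi; exact absurd (Finset.mem_range.2 (Nat.lt_succ_of_le h)) hi

lemma eq_sum_monomial {k : ℕ} {A : SmoothFun 𝕜 →ₗ[𝕜] SmoothFun 𝕜} {a : ℕ → SmoothFun 𝕜}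
    (ha : ∀ φ, A φ = ∑ i ∈ Finset.range (k + 1), a i * (ddx ^ i) φ) :
    A = ∑ i ∈ Finset.range (k + 1), LinearMap.mulLeft 𝕜 (a i) ∘ₗ ddx ^ i := by
  ext1 φ
  simp [ha, LinearMap.sum_apply]

lemma diffOp_mono {j k : ℕ} (h : j ≤ k) : DiffOp 𝕜 j ≤ DiffOp 𝕜 k := by
  rintro A ⟨a, ha⟩
  rw [eq_sum_monomial ha]
  exact Submodule.sum_mem _ fun i hi => monomial_mem_diffOp
    ((Nat.lt_succ_iff.1 (Finset.mem_range.1 hi)).trans h) _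

lemma mulLeft_comp_mem_diffOp {k : ℕ} {A : SmoothFun 𝕜 →ₗ[𝕜] SmoothFun 𝕜}
    (hA : A ∈ DiffOp 𝕜 k) (b : SmoothFun 𝕜) : LinearMap.mulLeft 𝕜 b ∘ₗ A ∈ DiffOp 𝕜 k := by
  obtain ⟨a, ha⟩ := hA
  exact ⟨fun i => b * a i, fun φ => by simp [ha, mul_assoc]⟩

lemma ddx_comp_mem_diffOp {k : ℕ} {A : SmoothFun 𝕜 →ₗ[𝕜] SmoothFun 𝕜}
    (hA : A ∈ DiffOp 𝕜 k) : ddx ∘ₗ A ∈ DiffOp 𝕜 (k + 1) := by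
  obtain ⟨a, ha⟩ := hA
  have h : ddx ∘ₗ A = ∑ i ∈ Finset.range (k + 1), (LinearMap.mulLeft 𝕜 (ddx (a i)) ∘ₗ ddx ^ i +
      LinearMap.mulLeft 𝕜 (a i) ∘ₗ ddx ^ (i + 1)) := by
    ext1 φ
    simp [ha, LinearMap.sum_apply, ddx_mul, pow_succ']
  rw [h]
  refine Submodule.sum_mem _ fun i hi => ?_
  have hi' := Finset.mem_range.1 hi
  exact Submodule.add_mem _ (monomial_mem_diffOp (by omega) _) (monomial_mem_diffOp (by omega) _)

lemma pullback_mul_fun (s : 𝕜) (f : LiftDiff) (a φ : SmoothFun 𝕜) :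
    pullback s f (a * φ) = pullback 0 f a * pullback s f φ := by
  ext x
  have h0 : ∀ r, posPow r (0 : 𝕜) = 1 := fun r => by simp [posPow]
  simp only [pullback_apply, MulMemClass.coe_mul, Pi.mul_apply, h0]
  ring

lemma exists_pullback_weight (s t : 𝕜) (f : LiftDiff) :
    ∃ m : SmoothFun 𝕜, ∀ φ, pullback t f φ = m * pullback s f φ := by
  refine ⟨⟨fun x => posPow (deriv (f : Equiv.Perm ℝ) x) (t - s), contDiff_posPow f _, fun x => by
    simp only [(LiftDiff.deriv_periodic f) x]⟩, fun φ => ?_⟩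
  ext x
  simp only [pullback_apply, MulMemClass.coe_mul, Pi.mul_apply]
  rw [← mul_assoc, ← posPow_add, sub_add_cancel]

lemma exists_pullback_ddx (s : 𝕜) (f : LiftDiff) :
    ∃ b c : SmoothFun 𝕜, ∀ φ,
      pullback s f (ddx φ) = b * ddx (pullback s f φ) + c * pullback s f φ := by
  have hne : ∀ x, ((deriv (f : Equiv.Perm ℝ) x : ℝ) : 𝕜) ≠ 0 := fun x =>
    RCLike.ofReal_ne_zero.2 ((LiftDiff.deriv_pos f) x).ne'
  let p : SmoothFun 𝕜 := ⟨fun x => posPow (deriv (f : Equiv.Perm ℝ) x) s, contDiff_posPow f s,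
    fun x => by simp only [(LiftDiff.deriv_periodic f) x]⟩
  let q : SmoothFun 𝕜 := ⟨fun x => posPow (deriv (f : Equiv.Perm ℝ) x) (-s),
    contDiff_posPow f (-s), fun x => by simp only [(LiftDiff.deriv_periodic f) x]⟩
  let b : SmoothFun 𝕜 := ⟨fun x => ((deriv (f : Equiv.Perm ℝ) x : ℝ) : 𝕜)⁻¹,
    (contDiff_ofReal.comp (LiftDiff.contDiff_deriv f)).inv hne,
    fun x => by simp only [(LiftDiff.deriv_periodic f) x]⟩
  have hpq : q * p = 1 := by
    ext x
    change posPow _ (-s) * posPow _ s = 1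
    rw [← posPow_add, neg_add_cancel]
    simp [posPow]
  have h0 : ∀ r, posPow r (0 : 𝕜) = 1 := fun r => by simp [posPow]
  have key : ∀ φ, b * ddx (pullback 0 f φ) = pullback 0 f (ddx φ) := by
    intro φ
    ext x
    change (_ : 𝕜)⁻¹ * deriv (pullback 0 f φ : ℝ → 𝕜) x = posPow _ 0 * deriv (φ : ℝ → 𝕜) _
    have e : (pullback 0 f φ : ℝ → 𝕜) = (φ : ℝ → 𝕜) ∘ (f : Equiv.Perm ℝ) := by
      ext y; rw [pullback_apply, h0, one_mul]; rfl
    have hd := HasDerivAt.scomp x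
      (φ.2.1.differentiable (by simp) ((f : Equiv.Perm ℝ) x)).hasDerivAt
      ((LiftDiff.differentiable f) x).hasDerivAt
    rw [e, hd.deriv, h0, one_mul, RCLike.real_smul_eq_coe_mul, inv_mul_cancel_left₀ (hne x)]
  have hp : ∀ φ, pullback s f φ = p * pullback 0 f φ := by
    intro φ
    ext x
    change posPow _ s * _ = posPow _ s * (posPow _ 0 * _)
    rw [h0, one_mul]
  refine ⟨b, -(b * q * ddx p), fun φ => ?_⟩
  rw [hp, hp, ddx_mul, ← key]
  linear_combination ((b * ddx p * pullback 0 f φ)) * hpq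

lemma conj_mem_diffOp (s t : 𝕜) (f g : LiftDiff) (hfg : g * f = 1) {k : ℕ}
    {A : SmoothFun 𝕜 →ₗ[𝕜] SmoothFun 𝕜} (hA : A ∈ DiffOp 𝕜 k) :
    pullback t f ∘ₗ A ∘ₗ pullback s g ∈ DiffOp 𝕜 k := by
  obtain ⟨m, hm⟩ := exists_pullback_weight s t f
  obtain ⟨b, c, hbc⟩ := exists_pullback_ddx s f
  have hpow : ∀ i : ℕ, pullback s f ∘ₗ (ddx ^ i) ∘ₗ pullback s g ∈ DiffOp 𝕜 i := by
    intro i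
    induction i with
    | zero =>
      have h1 : pullback s f ∘ₗ pullback s g = 1 := by
        rw [← pullback_one s, ← hfg, pullback_mul]; rfl
      have h2 : pullback s f ∘ₗ (ddx ^ 0) ∘ₗ pullback s g =
          LinearMap.mulLeft 𝕜 1 ∘ₗ ddx ^ 0 := by
        ext1 φ
        simpa using LinearMap.congr_fun h1 φ
      rw [h2]
      exact monomial_mem_diffOp le_rfl _
    | succ i ih =>
      have h2 : pullback s f ∘ₗ (ddx ^ (i + 1)) ∘ₗ pullback s g =
          LinearMap.mulLeft 𝕜 b ∘ₗ ddx ∘ₗ (pullback s f ∘ₗ (ddx ^ i) ∘ₗ pullback s g) +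
          LinearMap.mulLeft 𝕜 c ∘ₗ (pullback s f ∘ₗ (ddx ^ i) ∘ₗ pullback s g) := by
        ext1 φ
        simp [pow_succ', hbc]
      rw [h2]
      exact Submodule.add_mem _ (mulLeft_comp_mem_diffOp (ddx_comp_mem_diffOp ih) _)
        (mulLeft_comp_mem_diffOp (diffOp_mono (Nat.le_succ i) ih) _)
  obtain ⟨a, ha⟩ := hA
  have h : pullback t f ∘ₗ A ∘ₗ pullback s g = ∑ i ∈ Finset.range (k + 1),
      LinearMap.mulLeft 𝕜 (m * pullback 0 f (a i)) ∘ₗ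
        (pullback s f ∘ₗ (ddx ^ i) ∘ₗ pullback s g) := by
    ext1 φ
    simp [ha, LinearMap.sum_apply, hm, pullback_mul_fun, Finset.mul_sum]
  rw [h]
  exact Submodule.sum_mem _ fun i hi => mulLeft_comp_mem_diffOp
    (diffOp_mono (Nat.lt_succ_iff.1 (Finset.mem_range.1 hi)) (hpow i)) _

/-- The `Diff₊(S¹)`-module `𝓓^k_{lam,mu}(S¹)` of differential operators `A : 𝓕_lam → 𝓕_mu` of
order at most `k`, with the action `A ↦ ρ^mu_f ∘ A ∘ ρ^lam_{f⁻¹}`. -/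
noncomputable def diffOpRep (k : ℕ) (lam mu : 𝕜) :
    Representation 𝕜 DiffCircle (DiffOp 𝕜 k) :=
  ((Representation.linHom (densityRep lam) (densityRep mu)).subrepresentation (DiffOp 𝕜 k) (by
    intro g
    obtain ⟨f, rfl⟩ := QuotientGroup.mk_surjective g
    intro A hA
    exact conj_mem_diffOp lam mu f⁻¹ f⁻¹⁻¹ (by simp) hA))

/-- The algebra of symmetries `𝓘^k_{lam,mu}(S¹)`: all `𝕜`-linear maps of
`𝓓^k_{lam,mu}(S¹)` to itself that commute with the `Diff₊(S¹)`-action. -/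
noncomputable def symmetryAlgebra (k : ℕ) (lam mu : 𝕜) :
    Subalgebra 𝕜 (Module.End 𝕜 (DiffOp 𝕜 k)) :=
  Subalgebra.centralizer 𝕜 (Set.range (diffOpRep k lam mu))

/-! ### The matrix algebras -/

/-- The algebra `𝔱_n` of lower triangular `n × n` matrices. -/
def algT (𝕜 : Type*) [RCLike 𝕜] (n : ℕ) : Subalgebra 𝕜 (Matrix (Fin n) (Fin n) 𝕜) where
  carrier := {M | ∀ i j, i < j → M i j = 0}
  mul_mem' := by
    intro M N hM hN i j hij
    rw [Matrix.mul_apply]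
    refine Finset.sum_eq_zero fun l _ => ?_
    rcases lt_or_ge i l with h | h
    · rw [hM i l h, zero_mul]
    · rw [hN l j (h.trans_lt hij), mul_zero]
  add_mem' := by
    intro M N hM hN i j hij
    rw [Matrix.add_apply, hM i j hij, hN i j hij, add_zero]
  algebraMap_mem' := by
    intro r i j hij
    rw [Matrix.algebraMap_matrix_apply, if_neg hij.ne]

/-- The algebra `𝔞` of `2 × 2` matrices with rows `(a, 0)`, `(b, a)`. -/
def algA (𝕜 : Type*) [RCLike 𝕜] : Subalgebra 𝕜 (Matrix (Fin 2) (Fin 2) 𝕜) where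
  carrier := {M | ∃ a b : 𝕜, M = !![a, 0; b, a]}
  mul_mem' := by
    rintro _ _ ⟨a, b, rfl⟩ ⟨a', b', rfl⟩
    refine ⟨a * a', b * a' + a * b', ?_⟩
    ext i j; fin_cases i <;> fin_cases j <;> simp
  add_mem' := by
    rintro _ _ ⟨a, b, rfl⟩ ⟨a', b', rfl⟩
    refine ⟨a + a', b + b', ?_⟩
    ext i j; fin_cases i <;> fin_cases j <;> simp
  algebraMap_mem' := by
    intro r
    refine ⟨r, 0, ?_⟩
    ext i j; fin_cases i <;> fin_cases j <;> simp [Matrix.algebraMap_matrix_apply]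

/-- The algebra `𝔟` of `4 × 4` matrices with rows
`(a, 0, 0, d)`, `(0, a, 0, 0)`, `(0, c, b, 0)`, `(0, 0, 0, b)`. -/
def algB (𝕜 : Type*) [RCLike 𝕜] : Subalgebra 𝕜 (Matrix (Fin 4) (Fin 4) 𝕜) where
  carrier := {M | ∃ a b c d : 𝕜,
    M = !![a, 0, 0, d; 0, a, 0, 0; 0, c, b, 0; 0, 0, 0, b]}
  mul_mem' := by
    rintro _ _ ⟨a, b, c, d, rfl⟩ ⟨a', b', c', d', rfl⟩
    refine ⟨a * a', b * b', c * a' + b * c', a * d' + d * b', ?_⟩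
    ext i j; fin_cases i <;> fin_cases j <;>
      simp [Matrix.mul_apply, Fin.sum_univ_succ]
  add_mem' := by
    rintro _ _ ⟨a, b, c, d, rfl⟩ ⟨a', b', c', d', rfl⟩
    refine ⟨a + a', b + b', c + c', d + d', ?_⟩
    ext i j; fin_cases i <;> fin_cases j <;> simp
  algebraMap_mem' := by
    intro r
    refine ⟨r, r, 0, 0, ?_⟩
    ext i j; fin_cases i <;> fin_cases j <;> simp [Matrix.algebraMap_matrix_apply]

end CircleDensities

namespace CircleDensities

open scoped Topology
open Filter

variable {𝕜 : Type*} [RCLike 𝕜]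

/-! ### Bump functions, coordinates and diffeomorphisms of the circle -/

/-! An operator is the triple (a₀, a₁, a₂) of its coefficients. Write δ = mu - lam and ℓ = f''/f'. A
diffeomorphism f acts on triples by a triangular rule: a_k transforms as a density of weight δ - k,
up to terms in ℓ and ℓ' times the higher coefficients (`coeffOp_coeffPullback`). A symmetry is thus
a linear map T on triples that commutes with every `coeffPullback`.

No continuity is needed, because locality comes from the group. If a triple vanishes near 0, the
diffeomorphisms supported near ℤ that are close enough to it fix the triple, hence fix its image
under T. Invariance under scalings and under x + τx², x + τx³ then kills the value of the image at
0, except possibly for component 0 when δ = 0 and component 1 when lam = 0, δ = 1. So (T a)_j(0)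
depends on the germ of a only, and under a contraction it is homogeneous of degree i - j in a_i. A
homogeneous functional on germs is a multiple of a single derivative (`exists_eq_mul_ddxInt`), since
every germ with that derivative zero is a coboundary r⁻ⁿψ(rx) - ψ(x). Translations carry the formula
to all points with the same constants, so T is a constant upper triangular matrix with entry M j i
in front of the derivative of order i - j (`exists_eq_matrixOp`).

In the two exceptional cases T is such a matrix plus a ↦ k(a) times a constant in one component,
where k is an invariant functional (`functional_coeffPullback_eq`). For real σ ≠ 0 a positive
σ-density v is equivalent to a constant, so k(v) = (∫ v^(1/σ))^σ k(1). This contradicts linearity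
for σ < 0 unless k = 0, and gives the integral for σ = 1; for σ = 0 every function is a sum of
coboundaries and k = 0. Hence the only non-local symmetry is `integralOp`, at (lam, mu) = (0, 1).

Commutation with the action is a linear system for the six matrix entries (`IsSymmetryEntries`). The
corner entry is always determined by the others, and what remains is `EntryEquations`, with
coefficients 2 lam + 1, lam, mu - lam - 2, mu - lam - 1 and lam (mu - 1). Under composition the
diagonal entries p, q, s multiply and α, β, κ obey twisted Leibniz rules, so
`nonempty_algEquiv_of_entries` identifies the algebra once the system is solved. The special weights
are those at which some of its coefficients vanish. -/

/-- A smooth function of period `1` that is `1` where `A ≤ cos (2πx)` and `0` where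
`cos (2πx) ≤ B`. -/
noncomputable def cosBump (A B : ℝ) (x : ℝ) : ℝ :=
  Real.smoothTransition ((Real.cos (2 * Real.pi * x) - B) / (A - B))

lemma contDiff_cosBump (A B : ℝ) : ContDiff ℝ ∞ (cosBump A B) := by
  refine Real.smoothTransition.contDiff.comp ?_
  exact ((Real.contDiff_cos.comp (contDiff_const.mul contDiff_id)).sub contDiff_const).div_const _

lemma cos_two_pi_add_one (x : ℝ) :
    Real.cos (2 * Real.pi * (x + 1)) = Real.cos (2 * Real.pi * x) := by
  rw [mul_add, mul_one, Real.cos_add_two_pi]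

lemma cosBump_periodic (A B : ℝ) : Function.Periodic (cosBump A B) 1 := fun x => by
  simp only [cosBump, cos_two_pi_add_one]

lemma cosBump_eq_one {A B x : ℝ} (h : B < A) (hx : A ≤ Real.cos (2 * Real.pi * x)) :
    cosBump A B x = 1 := by
  apply Real.smoothTransition.one_of_one_le
  rw [le_div_iff₀ (by linarith)]; linarith

lemma cosBump_eq_zero {A B x : ℝ} (h : B < A) (hx : Real.cos (2 * Real.pi * x) ≤ B) :
    cosBump A B x = 0 := by
  apply Real.smoothTransition.zero_of_nonpos
  exact div_nonpos_of_nonpos_of_nonneg (by linarith) (by linarith)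

lemma continuous_cos_two_pi : Continuous fun x : ℝ => Real.cos (2 * Real.pi * x) := by
  fun_prop

lemma eventually_lt_cos_two_pi {B : ℝ} (hB : B < 1) :
    ∀ᶠ x in 𝓝 (0 : ℝ), B < Real.cos (2 * Real.pi * x) :=
  continuous_cos_two_pi.continuousAt.eventually (lt_mem_nhds (by simpa using hB))

lemma eventually_cosBump_eq_one {A B : ℝ} (h : B < A) (hA : A < 1) :
    ∀ᶠ x in 𝓝 (0 : ℝ), cosBump A B x = 1 := by
  filter_upwards [eventually_lt_cos_two_pi hA] with x hx using cosBump_eq_one h hx.le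

lemma cos_two_pi_sub_int (x : ℝ) (m : ℤ) :
    Real.cos (2 * Real.pi * (x - m)) = Real.cos (2 * Real.pi * x) := by
  rw [mul_sub, show 2 * Real.pi * (m : ℝ) = m * (2 * Real.pi) by ring, Real.cos_sub_int_mul_two_pi]

/-- If `cos (2πx) > cos (2πε)`, then `x` lies within `ε` of an integer. -/
lemma exists_int_abs_sub_lt {ε x : ℝ} (h0 : 0 ≤ ε)
    (h : Real.cos (2 * Real.pi * ε) < Real.cos (2 * Real.pi * x)) : ∃ m : ℤ, |x - m| < ε := by
  refine ⟨round x, ?_⟩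
  by_contra! hc
  have hr := abs_sub_round x
  have hpi := Real.pi_pos
  rw [← cos_two_pi_sub_int x (round x), ← Real.cos_abs (_ * (x - _))] at h
  rw [abs_mul, abs_of_pos (by positivity : 0 < 2 * Real.pi)] at h
  refine absurd h (not_lt.2 (Real.cos_le_cos_of_nonneg_of_le_pi (by positivity) ?_ ?_))
  · nlinarith
  · gcongr

/-- A smooth real function of period `1` that agrees with `x` near `0`. -/
noncomputable def circleCoord (x : ℝ) : ℝ :=
  cosBump (-1 / 2) (-3 / 4) x * (Real.arctan (Real.tan (Real.pi * x)) / Real.pi)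

lemma circleCoord_periodic : Function.Periodic circleCoord 1 := fun x => by
  simp only [circleCoord, cosBump_periodic _ _ x, mul_add, mul_one, Real.tan_add_pi]

lemma contDiff_circleCoord : ContDiff ℝ ∞ circleCoord := by
  rw [contDiff_iff_contDiffAt]
  intro x
  by_cases hx : Real.cos (2 * Real.pi * x) < -3 / 4
  · have : circleCoord =ᶠ[𝓝 x] fun _ => 0 := by
      filter_upwards [continuous_cos_two_pi.continuousAt.eventually (gt_mem_nhds hx)] with y hy
      rw [circleCoord, cosBump_eq_zero (by norm_num) (le_of_lt hy), zero_mul]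
    exact contDiffAt_const.congr_of_eventuallyEq this
  -- The poles of tan (πx) have cos (2πx) = -1, inside the region where the cutoff vanishes.
  · have hc : Real.cos (Real.pi * x) ≠ 0 := by
      intro h0
      rw [mul_assoc, Real.cos_two_mul, h0] at hx
      norm_num at hx
    have h1 : ContDiffAt ℝ ∞ (Real.tan ∘ fun y => Real.pi * y) x :=
      (Real.contDiffAt_tan.2 hc).comp x (contDiffAt_const.mul contDiffAt_id)
    exact (contDiff_cosBump _ _).contDiffAt.mul
      ((Real.contDiff_arctan.contDiffAt.comp x h1).div_const _)

/-- The radius 1/3 comes from cos (2π/3) = -1/2, the level above which the cutoff equals 1; there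
`arctan` inverts `tan`. -/
lemma circleCoord_eq_sub {x : ℝ} {m : ℤ} (hx : |x - m| ≤ 1 / 3) : circleCoord x = x - m := by
  have hpi := Real.pi_pos
  have h3 := abs_le.1 hx
  have h1 : cosBump (-1 / 2) (-3 / 4) x = 1 := by
    refine cosBump_eq_one (by norm_num) ?_
    rw [← cos_two_pi_sub_int x m, ← Real.cos_abs (_ * _), abs_mul,
      abs_of_pos (by positivity : 0 < 2 * Real.pi)]
    have : Real.cos (2 * Real.pi * (1 / 3)) = -1 / 2 := by
      rw [show 2 * Real.pi * (1 / 3) = Real.pi - Real.pi / 3 by ring, Real.cos_pi_sub,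
        Real.cos_pi_div_three]; norm_num
    rw [← this]
    refine Real.cos_le_cos_of_nonneg_of_le_pi (by positivity) (by nlinarith) ?_
    gcongr
  have h2 : Real.tan (Real.pi * x) = Real.tan (Real.pi * (x - m)) := by
    rw [mul_sub, mul_comm Real.pi (m : ℝ), Real.tan_sub_int_mul_pi]
  rw [circleCoord, h1, one_mul, h2, Real.arctan_tan (by nlinarith) (by nlinarith)]
  field_simp

lemma circleCoord_eventuallyEq : circleCoord =ᶠ[𝓝 0] id := by
  filter_upwards [Metric.ball_mem_nhds (0 : ℝ) (by norm_num : (0 : ℝ) < 1 / 3)] with x hx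
  have := circleCoord_eq_sub (x := x) (m := 0) (by
    have := (mem_ball_zero_iff.1 hx).le
    simpa using this)
  simpa using this

/-- Every smooth germ at `0` extends to a smooth function on the circle. -/
lemma exists_smoothFun_eventuallyEq {g : ℝ → 𝕜} (hg : ContDiff ℝ ∞ g) :
    ∃ φ : SmoothFun 𝕜, (φ : ℝ → 𝕜) =ᶠ[𝓝 0] g := by
  refine ⟨⟨g ∘ circleCoord, hg.comp contDiff_circleCoord, fun x => ?_⟩, ?_⟩
  · simp [circleCoord_periodic x]
  · filter_upwards [circleCoord_eventuallyEq] with x hx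
    simp [hx]

/-- A smooth map of degree one with positive derivative is an element of `LiftDiff`. -/
lemma exists_liftDiff_of_deriv_pos {f : ℝ → ℝ} (hf : ContDiff ℝ ∞ f) (hpos : ∀ x, 0 < deriv f x)
    (h1 : ∀ x, f (x + 1) = f x + 1) : ∃ F : LiftDiff, ((F : Equiv.Perm ℝ) : ℝ → ℝ) = f := by
  have hm : StrictMono f := strictMono_of_deriv_pos hpos
  -- Comparison with the values at floor and ceiling traps f between two translates of the identity,
  -- whence surjectivity.
  have hint : ∀ n : ℤ, f n = f 0 + n := by
    intro n
    induction n using Int.induction_on with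
    | zero => simp
    | succ i ih => push_cast at ih ⊢; rw [h1, ih]; ring
    | pred i ih =>
      have := h1 (-(i : ℝ) - 1)
      push_cast at ih ⊢
      rw [sub_add_cancel, ih] at this
      linarith
  have hs : Function.Surjective f := by
    refine hf.continuous.surjective ?_ ?_
    · refine tendsto_atTop_mono (f := fun x => x + (f 0 - 1)) (fun x => ?_)
        (tendsto_atTop_add_const_right _ _ tendsto_id)
      have h2 := hm.monotone (Int.floor_le x)
      rw [hint] at h2
      have := Int.lt_floor_add_one x
      linarith
    · refine tendsto_atBot_mono (f := fun x => x + (f 0 + 1)) (fun x => ?_)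
        (tendsto_atBot_add_const_right _ _ tendsto_id)
      have h2 := hm.monotone (Int.le_ceil x)
      rw [hint] at h2
      have := Int.ceil_lt_add_one x
      linarith
  let e := (hm.orderIsoOfSurjective f hs).toHomeomorph
  have he : ContDiff ℝ ∞ e.symm := e.contDiff_symm_deriv (f' := deriv f) (fun x => (hpos x).ne')
    (fun x => (hf.differentiable (by simp) x).hasDerivAt) hf
  exact ⟨⟨e.toEquiv, hf, he, hm, h1⟩, rfl⟩

lemma exists_liftDiff_add {h : ℝ → ℝ} (hh : ContDiff ℝ ∞ h) (hp : Function.Periodic h 1)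
    (hb : ∀ x, |deriv h x| < 1) : ∃ f : LiftDiff, ∀ x, (f : Equiv.Perm ℝ) x = x + h x := by
  obtain ⟨F, hF⟩ := exists_liftDiff_of_deriv_pos (f := fun x => x + h x) (contDiff_id.add hh)
    (fun x => by
      have : deriv (fun x => x + h x) x = 1 + deriv h x := by
        rw [deriv_fun_add differentiableAt_fun_id (hh.differentiable (by simp) x)]; simp
      rw [this]; linarith [(abs_lt.1 (hb x)).1])
    (fun x => by simp only [hp x]; ring)
  exact ⟨F, fun x => congrFun hF x⟩

lemma exists_bound_of_periodic {E : Type*} [NormedAddCommGroup E] {g : ℝ → E} (hg : Continuous g)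
    (hp : Function.Periodic g 1) : ∃ C, 0 < C ∧ ∀ x, ‖g x‖ ≤ C := by
  obtain ⟨C, hC⟩ := (hp.isBounded_of_continuous one_ne_zero hg).exists_norm_le
  exact ⟨max C 1, by positivity, fun x => (hC _ ⟨x, rfl⟩).trans (le_max_left _ _)⟩

lemma periodic_deriv {E : Type*} [NormedAddCommGroup E] [NormedSpace ℝ E] {g : ℝ → E}
    (hp : Function.Periodic g 1) : Function.Periodic (deriv g) 1 := fun x => by
  rw [← deriv_comp_add_const]
  exact congrArg (fun h => deriv h x) (funext hp)

/-- Diffeomorphisms `x ↦ x + τ x ^ n` near `0`, supported near `ℤ`. -/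
lemma exists_liftDiff_local {B : ℝ} (hB : B < 1) (n : ℕ) :
    ∃ t > (0 : ℝ), ∀ τ : ℝ, |τ| < t → ∃ f : LiftDiff,
      ((f : Equiv.Perm ℝ) =ᶠ[𝓝 0] fun x => x + τ * x ^ n) ∧
      (∀ x, Real.cos (2 * Real.pi * x) ≤ B → (f : Equiv.Perm ℝ) x = x) := by
  let h : ℝ → ℝ := fun x => cosBump ((1 + B) / 2) B x * circleCoord x ^ n
  have hh : ContDiff ℝ ∞ h := (contDiff_cosBump _ _).mul (contDiff_circleCoord.pow n)
  have hp : Function.Periodic h 1 := fun x => by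
    simp only [h, cosBump_periodic _ _ x, circleCoord_periodic x]
  obtain ⟨C, hC, hb⟩ := exists_bound_of_periodic (hh.continuous_deriv (by simp)) (periodic_deriv hp)
  -- With C a bound for |h'|, this threshold keeps |τ h'| < 1, so x + τ h x has positive derivative.
  refine ⟨1 / C, by positivity, fun τ hτ => ?_⟩
  obtain ⟨f, hf⟩ := exists_liftDiff_add (h := fun x => τ * h x) (contDiff_const.mul hh)
    (fun x => by simp only [hp x]) (fun x => by
      rw [deriv_const_mul _ (hh.differentiable (by simp) x), abs_mul]
      calc |τ| * |deriv h x| ≤ |τ| * C := by gcongr; exact hb x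
        _ < 1 / C * C := by gcongr
        _ = 1 := by field_simp)
  refine ⟨f, ?_, fun x hx => ?_⟩
  · filter_upwards [eventually_cosBump_eq_one (A := (1 + B) / 2) (B := B) (by linarith)
      (by linarith), circleCoord_eventuallyEq] with x h1 h2
    rw [hf, show h x = x ^ n by simp only [h, h1, h2, id, one_mul]]
  · rw [hf, show h x = 0 by simp only [h]; rw [cosBump_eq_zero (by linarith) hx, zero_mul]]
    simp

/-- The translation `x ↦ x + c`. -/
noncomputable def translation (c : ℝ) : LiftDiff :=
  ⟨Equiv.addRight c, contDiff_id.add contDiff_const, by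
    rw [Equiv.addRight_symm]; exact contDiff_id.add contDiff_const, fun x y h => by simpa using h,
    fun x => by simp only [Equiv.coe_addRight]; ring⟩

lemma translation_apply (c x : ℝ) : (translation c : Equiv.Perm ℝ) x = x + c := rfl

/-! ### The action on coefficients -/

lemma differentiable_smoothFun (φ : SmoothFun 𝕜) : Differentiable ℝ (φ : ℝ → 𝕜) :=
  φ.2.1.differentiable (by simp)

lemma ddx_apply (φ : SmoothFun 𝕜) (x : ℝ) : (ddx φ : ℝ → 𝕜) x = deriv (φ : ℝ → 𝕜) x := rfl

lemma ddx_one : ddx (1 : SmoothFun 𝕜) = 0 := by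
  ext x
  exact deriv_const x (1 : 𝕜)

/-- A real smooth function of period `1`, as an element of `C^∞(S¹, 𝕜)`. -/
noncomputable def ofRealFun (𝕜 : Type*) [RCLike 𝕜] (g : ℝ → ℝ) (hg : ContDiff ℝ ∞ g)
    (hp : Function.Periodic g 1) : SmoothFun 𝕜 :=
  ⟨fun x => ((g x : ℝ) : 𝕜), contDiff_ofReal.comp hg, fun x => by simp only [hp x]⟩

lemma ofRealFun_apply (g : ℝ → ℝ) (hg : ContDiff ℝ ∞ g) (hp : Function.Periodic g 1) (x : ℝ) :
    (ofRealFun 𝕜 g hg hp : ℝ → 𝕜) x = ((g x : ℝ) : 𝕜) := rfl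

/-- The logarithmic derivative `f'' / f'`. -/
noncomputable def logDerivFun (𝕜 : Type*) [RCLike 𝕜] (f : LiftDiff) : SmoothFun 𝕜 :=
  ofRealFun 𝕜
    (fun x => deriv (deriv (f : Equiv.Perm ℝ)) x / deriv (f : Equiv.Perm ℝ) x)
    ((contDiff_infty_iff_deriv.1 (LiftDiff.contDiff_deriv f)).2.div (LiftDiff.contDiff_deriv f)
      fun x => (LiftDiff.deriv_pos f x).ne')
    (fun x => by
      simp only [LiftDiff.deriv_periodic f x, periodic_deriv (LiftDiff.deriv_periodic f) x])

lemma logDerivFun_apply (f : LiftDiff) (x : ℝ) : (logDerivFun 𝕜 f : ℝ → 𝕜) x =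
    ((deriv (deriv (f : Equiv.Perm ℝ)) x / deriv (f : Equiv.Perm ℝ) x : ℝ) : 𝕜) := rfl

lemma posPow_zero_right (r : ℝ) : posPow r (0 : 𝕜) = 1 := by simp [posPow]

lemma posPow_ofReal {r : ℝ} (hr : 0 < r) (t : ℝ) : posPow r (t : 𝕜) = ((r ^ t : ℝ) : 𝕜) := by
  rw [posPow, ← RCLike.ofReal_mul, Real.rpow_def_of_pos hr, mul_comm, Real.exp_eq_exp_ℝ]
  -- The piped term is just `algebraMap ℝ 𝕜`, a continuous ring homomorphism, which therefore
  -- commutes with the exponential.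
  exact (NormedSpace.map_exp (RCLike.ofRealCLM (K := 𝕜) |>.toLinearMap |> fun _ =>
    (algebraMap ℝ 𝕜)) (RCLike.continuous_ofReal) _).symm

lemma posPow_intCast {r : ℝ} (hr : 0 < r) (n : ℤ) : posPow r (n : 𝕜) = (r : 𝕜) ^ n := by
  have := posPow_ofReal (𝕜 := 𝕜) hr n
  rw [Real.rpow_intCast] at this
  simpa using this

lemma posPow_one_right {r : ℝ} (hr : 0 < r) : posPow r (1 : 𝕜) = r := by
  simpa using posPow_intCast (𝕜 := 𝕜) hr 1

lemma posPow_ne_zero (r : ℝ) (s : 𝕜) : posPow r s ≠ 0 := by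
  intro h
  have := posPow_add r s (-s)
  rw [add_neg_cancel, posPow_zero_right, h, zero_mul] at this
  exact one_ne_zero this

/-- Differentiation raises the weight by one and fails to be equivariant only by the connection term
w ℓ. All correction terms in the action on coefficients come from this identity. -/
lemma ddx_pullback (w : 𝕜) (f : LiftDiff) (a : SmoothFun 𝕜) :
    ddx (pullback w f a) =
      w • (logDerivFun 𝕜 f * pullback w f a) + pullback (w + 1) f (ddx a) := by
  ext x
  have hpos := LiftDiff.deriv_pos f x
  have h1 : HasDerivAt (fun y => Real.log (deriv (f : Equiv.Perm ℝ) y))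
      (deriv (deriv (f : Equiv.Perm ℝ)) x / deriv (f : Equiv.Perm ℝ) x) x :=
    ((LiftDiff.contDiff_deriv f).differentiable (by simp) x).hasDerivAt.log hpos.ne'
  have h2 : HasDerivAt (fun y => w * ((Real.log (deriv (f : Equiv.Perm ℝ) y) : ℝ) : 𝕜))
      (w * ((deriv (deriv (f : Equiv.Perm ℝ)) x / deriv (f : Equiv.Perm ℝ) x : ℝ) : 𝕜)) x :=
    ((RCLike.ofRealCLM (K := 𝕜)).hasFDerivAt.comp_hasDerivAt x h1).const_mul w
  have h3 : HasDerivAt (fun y => posPow (deriv (f : Equiv.Perm ℝ) y) w)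
      (w * ((deriv (deriv (f : Equiv.Perm ℝ)) x / deriv (f : Equiv.Perm ℝ) x : ℝ) : 𝕜) *
        posPow (deriv (f : Equiv.Perm ℝ) x) w) x := by
    have := HasDerivAt.scomp x (hasDerivAt_exp (𝕂 := 𝕜)
      (x := w * ((Real.log (deriv (f : Equiv.Perm ℝ) x) : ℝ) : 𝕜))) h2
    exact this
  have h4 : HasDerivAt (fun y => (a : ℝ → 𝕜) ((f : Equiv.Perm ℝ) y))
      (((deriv (f : Equiv.Perm ℝ) x : ℝ) : 𝕜) * deriv (a : ℝ → 𝕜) ((f : Equiv.Perm ℝ) x)) x := by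
    have := HasDerivAt.scomp x (differentiable_smoothFun a ((f : Equiv.Perm ℝ) x)).hasDerivAt
      (LiftDiff.differentiable f x).hasDerivAt
    rwa [RCLike.real_smul_eq_coe_mul] at this
  refine (h3.mul h4).deriv.trans ?_
  change _ = w * (((deriv (deriv (f : Equiv.Perm ℝ)) x / deriv (f : Equiv.Perm ℝ) x : ℝ) : 𝕜) *
    (posPow (deriv (f : Equiv.Perm ℝ) x) w * (a : ℝ → 𝕜) ((f : Equiv.Perm ℝ) x))) +
    posPow (deriv (f : Equiv.Perm ℝ) x) (w + 1) * deriv (a : ℝ → 𝕜) ((f : Equiv.Perm ℝ) x)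
  rw [posPow_add, posPow_one_right hpos]
  ring

/-- The operator with coefficients `a 0, a 1, a 2`. -/
noncomputable def coeffOp : (Fin 3 → SmoothFun 𝕜) →ₗ[𝕜] (SmoothFun 𝕜 →ₗ[𝕜] SmoothFun 𝕜) where
  toFun a := ∑ i : Fin 3, LinearMap.mulLeft 𝕜 (a i) ∘ₗ ddx ^ (i : ℕ)
  map_add' a b := by
    ext1 φ
    simp [Fin.sum_univ_three]
    ring
  map_smul' c a := by
    ext1 φ
    simp [Fin.sum_univ_three]

lemma coeffOp_apply (a : Fin 3 → SmoothFun 𝕜) (φ : SmoothFun 𝕜) :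
    coeffOp a φ = a 0 * φ + a 1 * ddx φ + a 2 * ddx (ddx φ) := by
  simp [coeffOp, Fin.sum_univ_three, pow_two]

lemma coeffOp_mem (a : Fin 3 → SmoothFun 𝕜) : coeffOp a ∈ DiffOp 𝕜 2 :=
  Submodule.sum_mem _ fun i _ => monomial_mem_diffOp (by omega) _

lemma ddx_eventuallyEq {φ : SmoothFun 𝕜} {g : ℝ → 𝕜} {x : ℝ} (h : (φ : ℝ → 𝕜) =ᶠ[𝓝 x] g) :
    (ddx φ : ℝ → 𝕜) =ᶠ[𝓝 x] deriv g := h.deriv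

lemma pullback_translation (w : 𝕜) (c : ℝ) (φ : SmoothFun 𝕜) (x : ℝ) :
    (pullback w (translation c) φ : ℝ → 𝕜) x = (φ : ℝ → 𝕜) (x + c) := by
  have : deriv (translation c : Equiv.Perm ℝ) x = 1 := by
    change deriv (fun y : ℝ => y + c) x = 1
    simp
  rw [pullback_apply, this, posPow_one, one_mul, translation_apply]

lemma exists_smoothFun_eventuallyEq_at {g : ℝ → 𝕜} (hg : ContDiff ℝ ∞ g) (x₀ : ℝ) :
    ∃ φ : SmoothFun 𝕜, (φ : ℝ → 𝕜) =ᶠ[𝓝 x₀] fun x => g (x - x₀) := by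
  obtain ⟨φ, hφ⟩ := exists_smoothFun_eventuallyEq hg
  refine ⟨pullback 0 (translation (-x₀)) φ, ?_⟩
  have : Tendsto (fun x : ℝ => x - x₀) (𝓝 x₀) (𝓝 0) := by
    have : ContinuousAt (fun x : ℝ => x - x₀) x₀ := by fun_prop
    simpa [ContinuousAt] using this
  filter_upwards [this.eventually hφ] with x hx
  rw [pullback_translation, ← sub_eq_add_neg, hx]

/-- Functions with the germs 1, x - x₀ and (x - x₀)² at x₀ isolate the three coefficients one after
the other. -/
lemma coeffOp_injective : Function.Injective (coeffOp (𝕜 := 𝕜)) := by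
  rw [injective_iff_map_eq_zero]
  intro a ha
  have key : ∀ φ : SmoothFun 𝕜, ∀ x, (a 0 : ℝ → 𝕜) x * (φ : ℝ → 𝕜) x +
      (a 1 : ℝ → 𝕜) x * (ddx φ : ℝ → 𝕜) x + (a 2 : ℝ → 𝕜) x * (ddx (ddx φ) : ℝ → 𝕜) x = 0 := by
    intro φ x
    have := coeffOp_apply a φ
    rw [ha] at this
    exact (congrFun (congrArg Subtype.val this) x).symm
  have hc : ∀ c : 𝕜, deriv (fun _ : ℝ => c) = fun _ => 0 := fun c => by ext; simp
  have hd : ∀ x₀ x : ℝ, HasDerivAt (fun x : ℝ => ((x - x₀ : ℝ) : 𝕜)) 1 x := fun x₀ x => by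
    have := (RCLike.ofRealCLM (K := 𝕜)).hasFDerivAt.comp_hasDerivAt x
      ((hasDerivAt_id x).sub_const x₀)
    rwa [RCLike.ofRealCLM_apply, RCLike.ofReal_one] at this
  have hl : ∀ x₀ : ℝ, deriv (fun x : ℝ => ((x - x₀ : ℝ) : 𝕜)) = fun _ => 1 := fun x₀ =>
    funext fun x => (hd x₀ x).deriv
  have h0 : a 0 = 0 := by
    ext x
    have := key 1 x
    rw [ddx_one] at this
    simpa using this
  have h1 : a 1 = 0 := by
    ext x₀
    obtain ⟨φ, hφ⟩ := exists_smoothFun_eventuallyEq_at (contDiff_ofReal (𝕜 := 𝕜)) x₀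
    have e1 := ddx_eventuallyEq hφ
    rw [hl] at e1
    have e2 := ddx_eventuallyEq e1
    rw [hc] at e2
    have := key φ x₀
    rw [h0, e1.self_of_nhds, e2.self_of_nhds] at this
    simpa using this
  have h2 : a 2 = 0 := by
    ext x₀
    obtain ⟨φ, hφ⟩ := exists_smoothFun_eventuallyEq_at
      (g := fun x => ((x : ℝ) : 𝕜) * x) (contDiff_ofReal.mul contDiff_ofReal) x₀
    have e1 := ddx_eventuallyEq hφ
    have hdd : deriv (fun x : ℝ => ((x - x₀ : ℝ) : 𝕜) * ((x - x₀ : ℝ) : 𝕜)) =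
        fun x => ((x - x₀ : ℝ) : 𝕜) + ((x - x₀ : ℝ) : 𝕜) := by
      ext x
      refine ((hd x₀ x).mul (hd x₀ x)).deriv.trans ?_
      rw [one_mul, mul_one]
    rw [hdd] at e1
    have e2 := ddx_eventuallyEq e1
    have hdd' : deriv (fun x : ℝ => ((x - x₀ : ℝ) : 𝕜) + ((x - x₀ : ℝ) : 𝕜)) = fun _ => 1 + 1 := by
      ext x
      exact ((hd x₀ x).add (hd x₀ x)).deriv
    rw [hdd'] at e2
    have := key φ x₀
    rw [h0, h1, e2.self_of_nhds] at this
    simpa [one_add_one_eq_two] using this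
  ext i : 1
  fin_cases i
  exacts [h0, h1, h2]

/-- Differential operators of order at most two, in terms of their coefficients. -/
noncomputable def coeffEquiv (𝕜 : Type*) [RCLike 𝕜] :
    (Fin 3 → SmoothFun 𝕜) ≃ₗ[𝕜] DiffOp 𝕜 2 :=
  LinearEquiv.ofBijective (coeffOp.codRestrict (DiffOp 𝕜 2) coeffOp_mem) (by
    constructor
    · intro a b hab
      exact coeffOp_injective (congrArg Subtype.val hab)
    · rintro ⟨A, a, ha⟩
      refine ⟨fun i => a i, Subtype.ext ?_⟩
      ext1 φ
      refine (coeffOp_apply _ _).trans ?_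
      simp [ha, Finset.sum_range_succ, pow_two])

lemma coe_coeffEquiv (a : Fin 3 → SmoothFun 𝕜) :
    (coeffEquiv 𝕜 a : SmoothFun 𝕜 →ₗ[𝕜] SmoothFun 𝕜) = coeffOp a := rfl

/-- The pullback of differential operators `𝓕_lam → 𝓕_mu` in terms of their coefficients;
`δ = mu - lam`. -/
noncomputable def coeffPullback (lam δ : 𝕜) (f : LiftDiff) :
    Module.End 𝕜 (Fin 3 → SmoothFun 𝕜) where
  toFun a :=
    -- The entries solve the triangular system that matches the coefficients of φ'', φ', φ after
    -- expanding the derivatives of the pulled-back density by `ddx_pullback`. The parenthesis after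
    -- the first ℓ is entry 1 again.
    ![pullback δ f (a 0) - lam • (logDerivFun 𝕜 f * (pullback (δ - 1) f (a 1) -
          (2 * lam + 1) • (logDerivFun 𝕜 f * pullback (δ - 2) f (a 2)))) -
        lam • ((ddx (logDerivFun 𝕜 f) + lam • (logDerivFun 𝕜 f * logDerivFun 𝕜 f)) *
          pullback (δ - 2) f (a 2)),
      pullback (δ - 1) f (a 1) - (2 * lam + 1) • (logDerivFun 𝕜 f * pullback (δ - 2) f (a 2)),
      pullback (δ - 2) f (a 2)]
  map_add' a b := by
    ext i : 1
    fin_cases i <;> simp [Algebra.smul_def] <;> ring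
  map_smul' c a := by
    ext i : 1
    fin_cases i <;> simp <;> simp only [Algebra.smul_def] <;> ring

section
variable (lam δ : 𝕜) (f : LiftDiff) (a : Fin 3 → SmoothFun 𝕜)

lemma coeffPullback_two : coeffPullback lam δ f a 2 = pullback (δ - 2) f (a 2) := rfl

lemma coeffPullback_one : coeffPullback lam δ f a 1 = pullback (δ - 1) f (a 1) -
    (2 * lam + 1) • (logDerivFun 𝕜 f * pullback (δ - 2) f (a 2)) := rfl

lemma coeffPullback_zero : coeffPullback lam δ f a 0 =
    pullback δ f (a 0) - lam • (logDerivFun 𝕜 f * (pullback (δ - 1) f (a 1) -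
          (2 * lam + 1) • (logDerivFun 𝕜 f * pullback (δ - 2) f (a 2)))) -
        lam • ((ddx (logDerivFun 𝕜 f) + lam • (logDerivFun 𝕜 f * logDerivFun 𝕜 f)) *
          pullback (δ - 2) f (a 2)) := rfl

end

lemma pullback_mul_mul (s t : 𝕜) (f : LiftDiff) (a φ : SmoothFun 𝕜) :
    pullback s f a * pullback t f φ = pullback (s + t) f (a * φ) := by
  ext x
  simp only [pullback_apply, MulMemClass.coe_mul, Pi.mul_apply, posPow_add]
  ring

lemma coeffOp_coeffPullback (lam mu : 𝕜) (f : LiftDiff) (a : Fin 3 → SmoothFun 𝕜)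
    (φ : SmoothFun 𝕜) :
    coeffOp (coeffPullback lam (mu - lam) f a) (pullback lam f φ) =
      pullback mu f (coeffOp a φ) := by
  simp only [coeffOp_apply, coeffPullback_zero, coeffPullback_one, coeffPullback_two, map_add,
    ddx_pullback, map_smul, ddx_mul]
  have h0 : pullback mu f (a 0 * φ) = pullback (mu - lam) f (a 0) * pullback lam f φ := by
    rw [pullback_mul_mul]; congr 1; ring_nf
  have h1 : pullback mu f (a 1 * ddx φ) =
      pullback (mu - lam - 1) f (a 1) * pullback (lam + 1) f (ddx φ) := by
    rw [pullback_mul_mul]; congr 1; ring_nf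
  have h2 : pullback mu f (a 2 * ddx (ddx φ)) =
      pullback (mu - lam - 2) f (a 2) * pullback (lam + 1 + 1) f (ddx (ddx φ)) := by
    rw [pullback_mul_mul]; congr 1; ring_nf
  rw [h0, h1, h2]
  simp only [Algebra.smul_def, map_add, map_mul, map_one, map_ofNat]
  ring

/-! ### Reduction to symmetries of coefficient triples -/

/-- The algebra of linear maps on coefficient triples that commute with all pullbacks. -/
noncomputable def coeffSymmetryAlgebra (lam δ : 𝕜) :
    Subalgebra 𝕜 (Module.End 𝕜 (Fin 3 → SmoothFun 𝕜)) :=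
  Subalgebra.centralizer 𝕜 (Set.range (coeffPullback lam δ))

lemma mem_coeffSymmetryAlgebra {lam δ : 𝕜} {T : Module.End 𝕜 (Fin 3 → SmoothFun 𝕜)} :
    T ∈ coeffSymmetryAlgebra lam δ ↔
      ∀ f a, coeffPullback lam δ f (T a) = T (coeffPullback lam δ f a) := by
  simp only [coeffSymmetryAlgebra, Subalgebra.mem_centralizer_iff, Set.forall_mem_range,
    LinearMap.ext_iff, Module.End.mul_apply]

/-- The inverse appears because the representation is a pushforward. It does not matter for the
centralizer, where f runs over a group. -/
lemma diffOpRep_coeffEquiv (lam mu : 𝕜) (f : LiftDiff) (a : Fin 3 → SmoothFun 𝕜) :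
    diffOpRep 2 lam mu (QuotientGroup.mk f⁻¹) (coeffEquiv 𝕜 a) =
      coeffEquiv 𝕜 (coeffPullback lam (mu - lam) f a) := by
  apply Subtype.ext
  ext1 φ
  rw [coe_coeffEquiv]
  change pullback mu f⁻¹⁻¹ (coeffOp a (pullback lam f⁻¹⁻¹⁻¹ φ)) = _
  rw [inv_inv, ← coeffOp_coeffPullback, ← Module.End.mul_apply (pullback lam f), ← pullback_mul,
    inv_mul_cancel, pullback_one]
  rfl

/-- Symmetries of the module of operators are symmetries of the module of coefficients. -/
noncomputable def symmetryAlgebraEquiv (lam mu : 𝕜) :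
    coeffSymmetryAlgebra lam (mu - lam) ≃ₐ[𝕜] symmetryAlgebra 2 lam mu :=
  ((coeffEquiv 𝕜).conjAlgEquiv 𝕜).subalgebraMap _ |>.trans (Subalgebra.equivOfEq _ _ (by
    ext T
    simp only [Subalgebra.mem_map, symmetryAlgebra, Subalgebra.mem_centralizer_iff,
      Set.forall_mem_range]
    constructor
    · rintro ⟨S, hS, rfl⟩ g
      obtain ⟨f, rfl⟩ := QuotientGroup.mk_surjective g
      rw [mem_coeffSymmetryAlgebra] at hS
      ext1 A
      obtain ⟨a, rfl⟩ := (coeffEquiv 𝕜).surjective A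
      have h := diffOpRep_coeffEquiv lam mu f⁻¹
      rw [inv_inv] at h
      change diffOpRep 2 lam mu f (coeffEquiv 𝕜 (S ((coeffEquiv 𝕜).symm (coeffEquiv 𝕜 a)))) =
        coeffEquiv 𝕜 (S ((coeffEquiv 𝕜).symm (diffOpRep 2 lam mu f (coeffEquiv 𝕜 a))))
      rw [LinearEquiv.symm_apply_apply, h, h, LinearEquiv.symm_apply_apply, hS]
    · intro hT
      refine ⟨(coeffEquiv 𝕜).symm.conjAlgEquiv 𝕜 T, ?_, ?_⟩
      · rw [mem_coeffSymmetryAlgebra]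
        intro f a
        apply (coeffEquiv 𝕜).injective
        have h := LinearMap.congr_fun (hT (QuotientGroup.mk f⁻¹)) (coeffEquiv 𝕜 a)
        rw [← diffOpRep_coeffEquiv]
        change diffOpRep 2 lam mu _ (coeffEquiv 𝕜 ((coeffEquiv 𝕜).symm (T (coeffEquiv 𝕜 a)))) =
          coeffEquiv 𝕜 ((coeffEquiv 𝕜).symm (T (coeffEquiv 𝕜 _)))
        rw [LinearEquiv.apply_symm_apply, LinearEquiv.apply_symm_apply, ← diffOpRep_coeffEquiv]
        exact h
      · ext1 A
        simp [LinearEquiv.conjAlgEquiv_apply]))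

/-! ### The linearized equation at a hyperbolic fixed point -/

/-- The solution is the Neumann series ψ(x) = -∑ r^(kj) G(r^j x). Periodicity bounds each derivative
of G on the whole line, and differentiating the j-th term m times only brings out the factor r^(jm)
≤ 1, so all derivatives converge uniformly. -/
lemma exists_contraction_solution_of_pos {r : ℝ} (h0 : 0 < r) (h1 : r < 1) {k : ℕ} (hk : k ≠ 0)
    (G : SmoothFun 𝕜) :
    ∃ ψ : ℝ → 𝕜, ContDiff ℝ ∞ ψ ∧ ∀ x, (r : 𝕜) ^ k * ψ (r * x) - ψ x = (G : ℝ → 𝕜) x := by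
  have hG := G.2.1
  have hper : ∀ m, Function.Periodic (iteratedDeriv m (G : ℝ → 𝕜)) 1 := by
    intro m
    induction m with
    | zero => simpa using G.2.2
    | succ m ih => rw [iteratedDeriv_succ]; exact periodic_deriv ih
  have hbd : ∀ m : ℕ, ∃ C, 0 < C ∧ ∀ x, ‖iteratedDeriv m (G : ℝ → 𝕜) x‖ ≤ C := fun m =>
    exists_bound_of_periodic (hG.continuous_iteratedDeriv m (by exact_mod_cast le_top)) (hper m)
  choose C hC hCb using hbd
  have hrk : r ^ k < 1 := pow_lt_one₀ h0.le h1 hk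
  let F : ℕ → ℝ → 𝕜 := fun j x => (r ^ k) ^ j • (G : ℝ → 𝕜) (r ^ j * x)
  have hF : ∀ j, ContDiff ℝ ∞ (F j) := fun j =>
    (hG.comp (contDiff_const.mul contDiff_id)).const_smul ((r ^ k) ^ j)
  have hFb : ∀ (m j : ℕ) (x : ℝ), ‖iteratedFDeriv ℝ m (F j) x‖ ≤ C m * (r ^ k) ^ j := by
    intro m j x
    rw [norm_iteratedFDeriv_eq_norm_iteratedDeriv]
    have hGm : ContDiff ℝ m (G : ℝ → 𝕜) := hG.of_le (by exact_mod_cast le_top)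
    have e : iteratedDeriv m (F j) x =
        (r ^ k) ^ j • (r ^ j) ^ m • iteratedDeriv m (G : ℝ → 𝕜) (r ^ j * x) := by
      have := congrFun (iteratedDeriv_comp_const_smul hGm (r ^ j)) x
      rw [← this]
      exact iteratedDeriv_fun_const_smul (n := m) (x := x)
        ((hGm.comp (contDiff_const.mul contDiff_id)).contDiffAt) ((r ^ k) ^ j)
    rw [e, norm_smul, norm_smul, Real.norm_of_nonneg (by positivity),
      Real.norm_of_nonneg (by positivity), mul_comm]
    have h2 : (r ^ j) ^ m ≤ 1 := pow_le_one₀ (by positivity) (pow_le_one₀ h0.le h1.le)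
    gcongr
    calc (r ^ j) ^ m * ‖iteratedDeriv m (G : ℝ → 𝕜) (r ^ j * x)‖ ≤ 1 * C m := by
          gcongr; exact hCb m _
      _ = C m := one_mul _
  have hsum : ∀ m : ℕ, Summable fun j => C m * (r ^ k) ^ j := fun m =>
    (summable_geometric_of_lt_one (by positivity) hrk).mul_left _
  have hFs : ∀ x, Summable fun j => F j x := fun x => by
    refine Summable.of_norm_bounded (hsum 0) fun j => ?_
    simpa using hFb 0 j x
  refine ⟨fun x => -∑' j, F j x, (contDiff_tsum (v := fun m j => C m * (r ^ k) ^ j) hF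
    (fun m _ => hsum m) (fun m j x _ => hFb m j x)).neg, fun x => ?_⟩
  have e1 : ∑' j, F j x = (G : ℝ → 𝕜) x + (r : 𝕜) ^ k * ∑' j, F j (r * x) := by
    rw [(hFs x).tsum_eq_zero_add, ← tsum_mul_left]
    congr 1
    · simp [F]
    · refine tsum_congr fun j => ?_
      simp only [F]
      rw [RCLike.real_smul_eq_coe_mul, RCLike.real_smul_eq_coe_mul, ← mul_assoc, pow_succ,
        pow_succ, mul_assoc (r ^ j) r x]
      push_cast
      ring
  dsimp only
  rw [e1]
  ring

/-- Differentiating the equation lowers n by one, so a primitive of the solution for G' works up to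
a constant. The constant is fixed by the equation at x = 0, which is solvable if r⁻ⁿ ≠ 1 or G(0) =
0. -/
lemma exists_contraction_solution_of_deriv {r : ℝ} (h0 : 0 < r) (h1 : r < 1) (n : ℤ)
    (G : SmoothFun 𝕜) (hG : n = 0 → (G : ℝ → 𝕜) 0 = 0)
    (h : ∃ ψ : ℝ → 𝕜, ContDiff ℝ ∞ ψ ∧
      ∀ x, (r : 𝕜) ^ (-(n - 1)) * ψ (r * x) - ψ x = (ddx G : ℝ → 𝕜) x) :
    ∃ ψ : ℝ → 𝕜, ContDiff ℝ ∞ ψ ∧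
      ∀ x, (r : 𝕜) ^ (-n) * ψ (r * x) - ψ x = (G : ℝ → 𝕜) x := by
  obtain ⟨Ψ, hΨ, hΨe⟩ := h
  have hr : (r : 𝕜) ≠ 0 := RCLike.ofReal_ne_zero.2 h0.ne'
  -- For n = 0 the denominator is 0 and division gives c = 0; this is harmless, since then G(0) = 0
  -- by `hG`.
  let c : 𝕜 := (G : ℝ → 𝕜) 0 / ((r : 𝕜) ^ (-n) - 1)
  let ψ : ℝ → 𝕜 := fun x => c + ∫ t in (0 : ℝ)..x, Ψ t
  have hd : ∀ x, HasDerivAt ψ (Ψ x) x := fun x =>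
    (intervalIntegral.integral_hasDerivAt_right (hΨ.continuous.intervalIntegrable _ _)
      (hΨ.continuous.stronglyMeasurableAtFilter _ _) hΨ.continuous.continuousAt).const_add c
  have hψ : ContDiff ℝ ∞ ψ := by
    rw [contDiff_infty_iff_deriv]
    refine ⟨fun x => (hd x).differentiableAt, ?_⟩
    rwa [show deriv ψ = Ψ from funext fun x => (hd x).deriv]
  have hD : ∀ x, HasDerivAt (fun x => (r : 𝕜) ^ (-n) * ψ (r * x) - ψ x - (G : ℝ → 𝕜) x) 0 x := by
    intro x
    have e1 : HasDerivAt (fun x => ψ (r * x)) (r • Ψ (r * x)) x := by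
      have := HasDerivAt.scomp x (hd (r * x)) ((hasDerivAt_id x).const_mul r)
      simpa [Function.comp_def] using this
    have e2 := ((e1.const_mul ((r : 𝕜) ^ (-n))).sub (hd x)).sub
      (differentiable_smoothFun G x).hasDerivAt
    convert! e2 using 1
    have := hΨe x
    rw [ddx_apply] at this
    rw [← this, RCLike.real_smul_eq_coe_mul, show -(n - 1) = -n + 1 by ring, zpow_add₀ hr, zpow_one]
    ring
  have hconst := is_const_of_deriv_eq_zero (fun x => (hD x).differentiableAt)
    (fun x => (hD x).deriv)
  refine ⟨ψ, hψ, fun x => ?_⟩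
  have h2 := hconst x 0
  have h3 : ψ 0 = c := by simp [ψ]
  simp only [mul_zero, h3] at h2
  have h4 : (r : 𝕜) ^ (-n) * c - c - (G : ℝ → 𝕜) 0 = 0 := by
    by_cases hn : n = 0
    · simp [hn, hG hn]
    · have h5 : (r : 𝕜) ^ (-n) - 1 ≠ 0 := by
        rw [sub_ne_zero]
        intro h6
        have h7 : r ^ (-n) = 1 := by exact_mod_cast h6
        rw [zpow_eq_one_iff_right₀ h0.le h1.ne] at h7
        omega
      have h6 : ((r : 𝕜) ^ (-n) - 1) * c = (G : ℝ → 𝕜) 0 := mul_div_cancel₀ _ h5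
      linear_combination h6
  rw [h4] at h2
  linear_combination h2

/-- The derivative of order `n`, understood as `0` if `n < 0`. -/
noncomputable def ddxInt (n : ℤ) : SmoothFun 𝕜 →ₗ[𝕜] SmoothFun 𝕜 :=
  if 0 ≤ n then ddx ^ n.toNat else 0

lemma ddxInt_natCast (n : ℕ) : ddxInt (𝕜 := 𝕜) n = ddx ^ n := by simp [ddxInt]

lemma ddxInt_of_neg {n : ℤ} (hn : n < 0) : ddxInt (𝕜 := 𝕜) n = 0 := by
  simp [ddxInt, hn.not_ge]

/-- Only the Taylor coefficient of order n is resonant. Differentiating n + 1 times leads to the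
contracting case, and the hypothesis enters at the one stage where the exponent is 0; for n < 0
there is no obstruction. -/
lemma exists_contraction_solution {r : ℝ} (h0 : 0 < r) (h1 : r < 1) (n : ℤ) (G : SmoothFun 𝕜)
    (hG : (ddxInt n G : ℝ → 𝕜) 0 = 0) :
    ∃ ψ : ℝ → 𝕜, ContDiff ℝ ∞ ψ ∧
      ∀ x, (r : 𝕜) ^ (-n) * ψ (r * x) - ψ x = (G : ℝ → 𝕜) x := by
  rcases lt_or_ge n 0 with hn | hn
  · obtain ⟨k, hk⟩ := Int.eq_ofNat_of_zero_le (show 0 ≤ -n by omega)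
    rw [hk]
    exact_mod_cast exists_contraction_solution_of_pos h0 h1 (k := k) (by omega) G
  · lift n to ℕ using hn
    rw [ddxInt_natCast] at hG
    induction n generalizing G with
    | zero =>
      refine exists_contraction_solution_of_deriv h0 h1 _ G (fun _ => hG) ?_
      have := exists_contraction_solution_of_pos h0 h1 one_ne_zero (ddx G)
      simpa using this
    | succ n ih =>
      refine exists_contraction_solution_of_deriv h0 h1 _ G (fun h => ?_) ?_
      · omega
      · have := ih (ddx G) (by rwa [pow_succ, Module.End.mul_apply] at hG)
        simpa using this

/-- A linear functional on germs at `0` that is homogeneous under a contraction is a multiple of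
a derivative at `0`. -/
lemma exists_eq_mul_ddxInt (L : SmoothFun 𝕜 →ₗ[𝕜] 𝕜) (n : ℤ)
    (hloc : ∀ φ : SmoothFun 𝕜, (φ : ℝ → 𝕜) =ᶠ[𝓝 0] 0 → L φ = 0) {r : ℝ} (h0 : 0 < r) (h1 : r < 1)
    {f : LiftDiff} (hf : (f : Equiv.Perm ℝ) =ᶠ[𝓝 0] fun x => r * x)
    (hL : ∀ φ, L (pullback 0 f φ) = (r : 𝕜) ^ n * L φ) :
    ∃ c : 𝕜, ∀ φ, L φ = c * (ddxInt n φ : ℝ → 𝕜) 0 := by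
  -- Such a φ agrees near 0 with the coboundary r⁻ⁿ f^*ψ - ψ, which L annihilates by homogeneity. So
  -- L factors through a one-dimensional quotient.
  have hker : ∀ φ, (ddxInt n φ : ℝ → 𝕜) 0 = 0 → L φ = 0 := by
    intro φ hφ
    obtain ⟨ψ, hψ, hψe⟩ := exists_contraction_solution h0 h1 n φ hφ
    obtain ⟨ψ', hψ'⟩ := exists_smoothFun_eventuallyEq hψ
    have hloc' := hloc (φ - ((r : 𝕜) ^ (-n) • pullback 0 f ψ' - ψ')) (by
      have ht : Tendsto (fun x : ℝ => r * x) (𝓝 0) (𝓝 0) := by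
        have : ContinuousAt (fun x : ℝ => r * x) 0 := by fun_prop
        simpa [ContinuousAt] using this
      filter_upwards [hf, hψ', ht.eventually hψ'] with x h2 h3 h4
      change (φ : ℝ → 𝕜) x - ((r : 𝕜) ^ (-n) * (posPow _ 0 * (ψ' : ℝ → 𝕜) _) - (ψ' : ℝ → 𝕜) x) = 0
      rw [posPow_zero_right, one_mul, h2, h4, h3, hψe, sub_self])
    rw [map_sub, map_sub, map_smul, hL, smul_eq_mul, ← mul_assoc, ← zpow_add₀
      (RCLike.ofReal_ne_zero.2 h0.ne'), neg_add_cancel, zpow_zero, one_mul, sub_self,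
      sub_zero] at hloc'
    exact hloc'
  by_cases h : ∀ φ : SmoothFun 𝕜, (ddxInt n φ : ℝ → 𝕜) 0 = 0
  · exact ⟨0, fun φ => by rw [hker φ (h φ), zero_mul]⟩
  · push Not at h
    obtain ⟨φ₀, hφ₀⟩ := h
    refine ⟨L φ₀ / (ddxInt n φ₀ : ℝ → 𝕜) 0, fun φ => ?_⟩
    have := hker (φ - ((ddxInt n φ : ℝ → 𝕜) 0 / (ddxInt n φ₀ : ℝ → 𝕜) 0) • φ₀) (by
      rw [map_sub, map_smul]
      change (ddxInt n φ : ℝ → 𝕜) 0 - (ddxInt n φ : ℝ → 𝕜) 0 / (ddxInt n φ₀ : ℝ → 𝕜) 0 *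
        (ddxInt n φ₀ : ℝ → 𝕜) 0 = 0
      rw [div_mul_cancel₀ _ hφ₀, sub_self])
    rw [map_sub, map_smul, smul_eq_mul, sub_eq_zero] at this
    rw [this]
    ring

/-! ### Local form of the action -/

lemma pullback_eventuallyEq_zero (w : 𝕜) (f : LiftDiff) {φ : SmoothFun 𝕜} {x : ℝ}
    (h : (φ : ℝ → 𝕜) =ᶠ[𝓝 ((f : Equiv.Perm ℝ) x)] 0) : (pullback w f φ : ℝ → 𝕜) =ᶠ[𝓝 x] 0 := by
  filter_upwards [(LiftDiff.differentiable f).continuous.continuousAt.eventually h] with y hy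
  simp [pullback_apply, hy]

lemma coeffPullback_apply_zero (lam δ : 𝕜) (f : LiftDiff) (a : Fin 3 → SmoothFun 𝕜) (x : ℝ) :
    (coeffPullback lam δ f a 0 : ℝ → 𝕜) x = (pullback δ f (a 0) : ℝ → 𝕜) x -
      lam * ((logDerivFun 𝕜 f : ℝ → 𝕜) x * (coeffPullback lam δ f a 1 : ℝ → 𝕜) x) -
      lam * (((ddx (logDerivFun 𝕜 f) : ℝ → 𝕜) x + lam * ((logDerivFun 𝕜 f : ℝ → 𝕜) x *
        (logDerivFun 𝕜 f : ℝ → 𝕜) x)) * (coeffPullback lam δ f a 2 : ℝ → 𝕜) x) := rfl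

lemma coeffPullback_apply_one (lam δ : 𝕜) (f : LiftDiff) (a : Fin 3 → SmoothFun 𝕜) (x : ℝ) :
    (coeffPullback lam δ f a 1 : ℝ → 𝕜) x = (pullback (δ - 1) f (a 1) : ℝ → 𝕜) x -
      (2 * lam + 1) * ((logDerivFun 𝕜 f : ℝ → 𝕜) x * (coeffPullback lam δ f a 2 : ℝ → 𝕜) x) := rfl

lemma coeffPullback_apply_two (lam δ : 𝕜) (f : LiftDiff) (a : Fin 3 → SmoothFun 𝕜) (x : ℝ) :
    (coeffPullback lam δ f a 2 : ℝ → 𝕜) x = (pullback (δ - 2) f (a 2) : ℝ → 𝕜) x := rfl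

/-- Where `f` is affine, the action on coefficients is diagonal. -/
lemma coeffPullback_apply_of_logDerivFun_eq_zero (lam δ : 𝕜) {f : LiftDiff} {x : ℝ}
    (h0 : (logDerivFun 𝕜 f : ℝ → 𝕜) x = 0) (h1 : (ddx (logDerivFun 𝕜 f) : ℝ → 𝕜) x = 0)
    (a : Fin 3 → SmoothFun 𝕜) (k : Fin 3) :
    (coeffPullback lam δ f a k : ℝ → 𝕜) x =
      (pullback (δ - (k : ℕ)) f (a k) : ℝ → 𝕜) x := by
  fin_cases k
  · simp [coeffPullback_apply_zero, h0, h1]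
  · simp [coeffPullback_apply_one, h0]
  · simp [coeffPullback_apply_two]

lemma logDerivFun_eventuallyEq {f : LiftDiff} {F : ℝ → ℝ} {x : ℝ}
    (hf : (f : Equiv.Perm ℝ) =ᶠ[𝓝 x] F) :
    (logDerivFun 𝕜 f : ℝ → 𝕜) =ᶠ[𝓝 x] fun y => ((deriv (deriv F) y / deriv F y : ℝ) : 𝕜) := by
  filter_upwards [hf.deriv, hf.deriv.deriv] with y h1 h2
  rw [logDerivFun_apply, h1, h2]

lemma deriv_const_mul_id (r : ℝ) : deriv (fun x : ℝ => r * x) = fun _ => r := by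
  ext x; simp

lemma logDerivFun_eventuallyEq_zero {f : LiftDiff} {r x : ℝ}
    (hf : (f : Equiv.Perm ℝ) =ᶠ[𝓝 x] fun y => r * y) :
    (logDerivFun 𝕜 f : ℝ → 𝕜) =ᶠ[𝓝 x] 0 := by
  have := logDerivFun_eventuallyEq (𝕜 := 𝕜) hf
  rw [deriv_const_mul_id] at this
  filter_upwards [this] with y hy using by simp [hy]

lemma ddx_logDerivFun_eventuallyEq_zero {f : LiftDiff} {r x : ℝ}
    (hf : (f : Equiv.Perm ℝ) =ᶠ[𝓝 x] fun y => r * y) :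
    (ddx (logDerivFun 𝕜 f) : ℝ → 𝕜) =ᶠ[𝓝 x] 0 := by
  have := ddx_eventuallyEq (logDerivFun_eventuallyEq_zero (𝕜 := 𝕜) hf)
  rwa [show deriv (0 : ℝ → 𝕜) = 0 from funext fun x => deriv_const x 0] at this

lemma coeffPullback_eventuallyEq_of_linear (lam δ : 𝕜) {f : LiftDiff} {r x : ℝ}
    (hf : (f : Equiv.Perm ℝ) =ᶠ[𝓝 x] fun y => r * y) (a : Fin 3 → SmoothFun 𝕜) (k : Fin 3) :
    (coeffPullback lam δ f a k : ℝ → 𝕜) =ᶠ[𝓝 x]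
      (posPow r (δ - (k : ℕ)) • pullback 0 f (a k) : SmoothFun 𝕜) := by
  filter_upwards [logDerivFun_eventuallyEq_zero (𝕜 := 𝕜) hf, ddx_logDerivFun_eventuallyEq_zero
    (𝕜 := 𝕜) hf, hf.deriv] with y h0 h1 h2
  rw [coeffPullback_apply_of_logDerivFun_eq_zero lam δ h0 h1, pullback_apply, h2,
    deriv_const_mul_id]
  change _ = posPow r (δ - (k : ℕ)) * (pullback 0 f (a k) : ℝ → 𝕜) y
  rw [pullback_apply, posPow_zero_right, one_mul]

lemma coeffPullback_apply_of_id (lam δ : 𝕜) {f : LiftDiff} {x : ℝ}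
    (hf : (f : Equiv.Perm ℝ) =ᶠ[𝓝 x] id) (a : Fin 3 → SmoothFun 𝕜) (k : Fin 3) :
    (coeffPullback lam δ f a k : ℝ → 𝕜) x = (a k : ℝ → 𝕜) x := by
  have hf' : (f : Equiv.Perm ℝ) =ᶠ[𝓝 x] fun y => 1 * y := by
    filter_upwards [hf] with y hy using by simp [hy]
  refine (coeffPullback_eventuallyEq_of_linear lam δ hf' a k).self_of_nhds.trans ?_
  change posPow 1 _ * (pullback 0 f (a k) : ℝ → 𝕜) x = _
  rw [posPow_one, one_mul, pullback_apply, posPow_zero_right, one_mul, hf.self_of_nhds, id]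

lemma coeffPullback_translation (lam δ : 𝕜) (t : ℝ) (a : Fin 3 → SmoothFun 𝕜) (k : Fin 3) :
    coeffPullback lam δ (translation t) a k = pullback 0 (translation t) (a k) := by
  ext x
  have h : deriv (translation t : Equiv.Perm ℝ) = fun _ => 1 := by
    ext y
    change deriv (fun y : ℝ => y + t) y = 1
    simp
  have h0 : logDerivFun 𝕜 (translation t) = 0 := by
    ext y
    rw [logDerivFun_apply, h]
    simp
  rw [coeffPullback_apply_of_logDerivFun_eq_zero lam δ (by rw [h0]; rfl) (by
    rw [h0, map_zero]; rfl), pullback_translation, pullback_translation]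

/-- If all `a k` vanish near `f x`, then so do the coefficients of the pullback near `x`. -/
lemma coeffPullback_eventuallyEq_zero (lam δ : 𝕜) (f : LiftDiff) {a : Fin 3 → SmoothFun 𝕜} {x : ℝ}
    (h : ∀ k, (a k : ℝ → 𝕜) =ᶠ[𝓝 ((f : Equiv.Perm ℝ) x)] 0) (k : Fin 3) :
    (coeffPullback lam δ f a k : ℝ → 𝕜) =ᶠ[𝓝 x] 0 := by
  filter_upwards [pullback_eventuallyEq_zero δ f (h 0), pullback_eventuallyEq_zero (δ - 1) f (h 1),
    pullback_eventuallyEq_zero (δ - 2) f (h 2)] with y h0 h1 h2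
  have e2 := coeffPullback_apply_two lam δ f a y
  have e1 := coeffPullback_apply_one lam δ f a y
  have e0 := coeffPullback_apply_zero lam δ f a y
  rw [h2] at e2
  rw [e2, h1] at e1
  rw [e2, e1, h0] at e0
  fin_cases k
  · simpa using e0
  · simpa using e1
  · simpa using e2

/-- Coefficients that vanish near `0` are fixed by the diffeomorphisms supported near `ℤ`. -/
lemma exists_coeffPullback_eq_self (lam δ : 𝕜) {a : Fin 3 → SmoothFun 𝕜}
    (ha : ∀ k, (a k : ℝ → 𝕜) =ᶠ[𝓝 0] 0) :
    ∃ B < (1 : ℝ), ∀ f : LiftDiff, (∀ x, Real.cos (2 * Real.pi * x) ≤ B →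
      (f : Equiv.Perm ℝ) x = x) → coeffPullback lam δ f a = a := by
  obtain ⟨ε, hε, hεa⟩ := Metric.eventually_nhds_iff.1 (eventually_all.2 ha)
  have hpi := Real.pi_pos
  set ε' := min ε (1 / 2) with hε'
  have hε0 : 0 < ε' := lt_min hε (by norm_num)
  set B₀ := Real.cos (2 * Real.pi * ε')
  have hB₀ : B₀ < 1 := by
    rw [← Real.cos_zero]
    refine Real.cos_lt_cos_of_nonneg_of_le_pi le_rfl ?_ (by positivity)
    nlinarith [min_le_right ε (1 / 2)]
  have hvan : ∀ k x, B₀ < Real.cos (2 * Real.pi * x) → (a k : ℝ → 𝕜) =ᶠ[𝓝 x] 0 := by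
    intro k x hx
    filter_upwards [continuous_cos_two_pi.continuousAt.eventually (lt_mem_nhds hx)] with y hy
    obtain ⟨m, hm⟩ := exists_int_abs_sub_lt hε0.le hy
    have h1 := hεa (y := y - m) (by
      rw [Real.dist_eq, sub_zero]; exact hm.trans_le (min_le_left _ _)) k
    have h2 := (a k).2.2.sub_int_mul_eq (x := y) m
    rw [mul_one] at h2
    rw [← h2]
    exact h1
  -- The level lies strictly above B₀, so that f is the identity on a neighbourhood of each point
  -- with cos (2πx) ≤ B₀; the action involves derivatives of f.
  refine ⟨(1 + B₀) / 2, by linarith, fun f hf => ?_⟩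
  ext k x
  by_cases hx : B₀ < Real.cos (2 * Real.pi * x)
  · have hfx : B₀ < Real.cos (2 * Real.pi * (f : Equiv.Perm ℝ) x) := by
      -- If f x lay outside, f would fix f x, and injectivity would give f x = x.
      by_contra! hc
      have := (f : Equiv.Perm ℝ).injective (hf ((f : Equiv.Perm ℝ) x) (by linarith))
      rw [this] at hc
      linarith
    rw [(coeffPullback_eventuallyEq_zero lam δ f (fun k => hvan k _ hfx) k).self_of_nhds,
      (hvan k x hx).self_of_nhds]
  · refine coeffPullback_apply_of_id lam δ ?_ a k
    filter_upwards [continuous_cos_two_pi.continuousAt.eventually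
      (gt_mem_nhds (show _ < (1 + B₀) / 2 by linarith))] with y hy using hf y (le_of_lt hy)

/-- The derivative of (1 + τ)^w at τ = 0 is w ≠ 0. For complex w particular values of τ may give 1,
so τ cannot be prescribed. -/
lemma exists_posPow_ne_one {w : 𝕜} (hw : w ≠ 0) {t : ℝ} (ht : 0 < t) :
    ∃ τ, -t < τ ∧ τ < 0 ∧ -1 < τ ∧ posPow (1 + τ) w ≠ 1 := by
  have h1 : HasDerivAt (fun τ : ℝ => Real.log (1 + τ)) 1 0 := by
    have := ((hasDerivAt_id (0 : ℝ)).const_add 1).log (by simp)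
    simpa using this
  have h2 : HasDerivAt (fun τ : ℝ => w * ((Real.log (1 + τ) : ℝ) : 𝕜)) w 0 := by
    have := ((RCLike.ofRealCLM (K := 𝕜)).hasFDerivAt.comp_hasDerivAt 0 h1).const_mul w
    rwa [RCLike.ofRealCLM_apply, RCLike.ofReal_one, mul_one] at this
  have h3 : HasDerivAt (fun τ : ℝ => posPow (1 + τ) w) w 0 := by
    have := HasDerivAt.scomp 0 (hasDerivAt_exp (𝕂 := 𝕜)
      (x := w * ((Real.log (1 + (0 : ℝ)) : ℝ) : 𝕜))) h2
    simpa [Function.comp_def, posPow] using this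
  have h4 : ∀ᶠ τ in 𝓝[<] (0 : ℝ), posPow (1 + τ) w ≠ 1 :=
    (h3.eventually_ne hw).filter_mono (nhdsWithin_mono _ fun x hx => ne_of_lt hx)
  have h5 : ∀ᶠ τ in 𝓝[<] (0 : ℝ), τ ∈ Set.Ioo (max (-t) (-1)) 0 :=
    Ioo_mem_nhdsLT (by simp [ht])
  obtain ⟨τ, hτ, hτ'⟩ := (h4.and h5).exists
  exact ⟨τ, (le_max_left _ _).trans_lt hτ'.1, hτ'.2, (le_max_right _ _).trans_lt hτ'.1, hτ⟩

/-! ### Jets at 0 of the diffeomorphisms x + τ xⁿ -/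

section jets

variable {f : LiftDiff} {τ : ℝ}

lemma apply_zero_of_eventuallyEq {n : ℕ} (hn : n ≠ 0)
    (hf : (f : Equiv.Perm ℝ) =ᶠ[𝓝 0] fun x => x + τ * x ^ n) : (f : Equiv.Perm ℝ) 0 = 0 := by
  rw [hf.self_of_nhds]; simp [hn]

lemma deriv_add_const_mul_pow (τ : ℝ) (n : ℕ) :
    deriv (fun x : ℝ => x + τ * x ^ n) = fun x => 1 + τ * (n * x ^ (n - 1)) := by
  ext x
  exact ((hasDerivAt_id x).add ((hasDerivAt_pow n x).const_mul τ)).deriv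

lemma deriv_one_add_const_mul_pow (τ c : ℝ) (n : ℕ) :
    deriv (fun x : ℝ => 1 + τ * (c * x ^ n)) = fun x => τ * (c * (n * x ^ (n - 1))) := by
  ext x
  exact ((((hasDerivAt_pow n x).const_mul c).const_mul τ).const_add 1).deriv

lemma pullback_apply_zero_of_eventuallyEq {n : ℕ} (hn : 2 ≤ n)
    (hf : (f : Equiv.Perm ℝ) =ᶠ[𝓝 0] fun x => x + τ * x ^ n) (w : 𝕜) (φ : SmoothFun 𝕜) :
    (pullback w f φ : ℝ → 𝕜) 0 = (φ : ℝ → 𝕜) 0 := by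
  rw [pullback_apply, apply_zero_of_eventuallyEq (by omega) hf, hf.deriv.self_of_nhds,
    deriv_add_const_mul_pow]
  have : n - 1 ≠ 0 := by omega
  simp [this, posPow_one]

lemma logDerivFun_zero_of_quadratic (hf : (f : Equiv.Perm ℝ) =ᶠ[𝓝 0] fun x => x + τ * x ^ 2) :
    (logDerivFun 𝕜 f : ℝ → 𝕜) 0 = 2 * τ := by
  rw [(logDerivFun_eventuallyEq hf).self_of_nhds, deriv_add_const_mul_pow,
    deriv_one_add_const_mul_pow]
  simp [mul_comm, RCLike.algebraMap_eq_ofReal, RCLike.ofReal_ofNat]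

lemma logDerivFun_zero_of_cubic (hf : (f : Equiv.Perm ℝ) =ᶠ[𝓝 0] fun x => x + τ * x ^ 3) :
    (logDerivFun 𝕜 f : ℝ → 𝕜) 0 = 0 := by
  rw [(logDerivFun_eventuallyEq hf).self_of_nhds, deriv_add_const_mul_pow,
    deriv_one_add_const_mul_pow]
  simp

lemma ddx_logDerivFun_zero_of_cubic
    (hf : (f : Equiv.Perm ℝ) =ᶠ[𝓝 0] fun x => x + τ * x ^ 3) :
    (ddx (logDerivFun 𝕜 f) : ℝ → 𝕜) 0 = 6 * τ := by
  rw [(ddx_eventuallyEq (logDerivFun_eventuallyEq hf)).self_of_nhds, deriv_add_const_mul_pow,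
    deriv_one_add_const_mul_pow]
  have h1 : HasDerivAt (fun x : ℝ => τ * (((3 : ℕ) : ℝ) * (((3 - 1 : ℕ) : ℝ) * x ^ (3 - 1 - 1))) /
      (1 + τ * (((3 : ℕ) : ℝ) * x ^ (3 - 1)))) (6 * τ) 0 := by
    have e1 := (((hasDerivAt_pow (3 - 1 - 1) (0 : ℝ)).const_mul
      (((3 - 1 : ℕ) : ℝ))).const_mul ((3 : ℕ) : ℝ)).const_mul τ
    have e2 := (((hasDerivAt_pow (3 - 1) (0 : ℝ)).const_mul ((3 : ℕ) : ℝ)).const_mul τ).const_add 1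
    convert! e1.div e2 (by norm_num) using 1
    norm_num
    ring
  have h2 := ((RCLike.ofRealCLM (K := 𝕜)).hasFDerivAt.comp_hasDerivAt 0 h1).deriv
  refine h2.trans ?_
  rw [RCLike.ofRealCLM_apply]
  push_cast
  rfl

end jets

/-! ### Values at 0 forced by local invariance -/

section invariants

variable {lam δ : 𝕜} {b : Fin 3 → SmoothFun 𝕜}

/-- Invariance under all diffeomorphisms supported in a neighbourhood of `ℤ`. -/
def LocallyInvariant (lam δ : 𝕜) (b : Fin 3 → SmoothFun 𝕜) : Prop :=
  ∃ B < (1 : ℝ), ∀ f : LiftDiff, (∀ x, Real.cos (2 * Real.pi * x) ≤ B →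
    (f : Equiv.Perm ℝ) x = x) → coeffPullback lam δ f b = b

lemma LocallyInvariant.exists_local (hb : LocallyInvariant lam δ b) (n : ℕ) :
    ∃ t > (0 : ℝ), ∀ τ : ℝ, |τ| < t → ∃ f : LiftDiff,
      ((f : Equiv.Perm ℝ) =ᶠ[𝓝 0] fun x => x + τ * x ^ n) ∧ coeffPullback lam δ f b = b := by
  obtain ⟨B, hB, h⟩ := hb
  obtain ⟨t, ht, htf⟩ := exists_liftDiff_local hB n
  refine ⟨t, ht, fun τ hτ => ?_⟩
  obtain ⟨f, hf, hf'⟩ := htf τ hτ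
  exact ⟨f, hf, h f hf'⟩

lemma LocallyInvariant.exists_ne_zero (hb : LocallyInvariant lam δ b) (n : ℕ) :
    ∃ τ : ℝ, τ ≠ 0 ∧ ∃ f : LiftDiff,
      ((f : Equiv.Perm ℝ) =ᶠ[𝓝 0] fun x => x + τ * x ^ n) ∧ coeffPullback lam δ f b = b := by
  obtain ⟨t, ht, h⟩ := hb.exists_local n
  exact ⟨t / 2, by positivity, h _ (by rw [abs_of_pos (by positivity)]; linarith)⟩

/-- A diffeomorphism equal to (1 + τ)x near 0 multiplies the value of coefficient k at 0 by (1 +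
τ)^(δ - k). -/
lemma LocallyInvariant.apply_zero_eq_zero_of_weight (hb : LocallyInvariant lam δ b) {k : Fin 3}
    (hk : δ ≠ (k : ℕ)) : (b k : ℝ → 𝕜) 0 = 0 := by
  obtain ⟨t, ht, h⟩ := hb.exists_local 1
  obtain ⟨τ, h1, h2, h3, h4⟩ := exists_posPow_ne_one (sub_ne_zero.2 hk) ht
  obtain ⟨f, hf, hfb⟩ := h τ (by rw [abs_lt]; exact ⟨h1, by linarith⟩)
  have hf' : (f : Equiv.Perm ℝ) =ᶠ[𝓝 0] fun x => (1 + τ) * x := by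
    filter_upwards [hf] with x hx using by rw [hx]; ring
  have := (coeffPullback_eventuallyEq_of_linear lam δ hf' b k).self_of_nhds
  change _ = posPow (1 + τ) _ * (pullback 0 f (b k) : ℝ → 𝕜) 0 at this
  rw [hfb, pullback_apply, posPow_zero_right, one_mul,
    apply_zero_of_eventuallyEq one_ne_zero hf] at this
  have h5 : (posPow (1 + τ) (δ - (k : ℕ)) - 1) * (b k : ℝ → 𝕜) 0 = 0 := by
    linear_combination -this
  exact (mul_eq_zero.1 h5).resolve_left (sub_ne_zero.2 h4)

/-- In weight 0 constants are invariant under scalings and the value may survive. The derivative has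
weight 1 and is multiplied by 1 + τ, so it still vanishes. -/
lemma LocallyInvariant.ddx_apply_zero (hb : LocallyInvariant lam δ b) {k : Fin 3}
    (hk : δ = (k : ℕ)) : (ddx (b k) : ℝ → 𝕜) 0 = 0 := by
  obtain ⟨τ, hτ, f, hf, hfb⟩ := hb.exists_ne_zero 1
  have hf' : (f : Equiv.Perm ℝ) =ᶠ[𝓝 0] fun x => (1 + τ) * x := by
    filter_upwards [hf] with x hx using by rw [hx]; ring
  have h1 := coeffPullback_eventuallyEq_of_linear lam δ hf' b k
  rw [hfb, ← hk, sub_self, posPow_zero_right, one_smul] at h1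
  have h2 := (ddx_eventuallyEq h1).self_of_nhds
  change _ = (ddx (pullback 0 f (b k)) : ℝ → 𝕜) 0 at h2
  rw [ddx_pullback, zero_smul, zero_add, zero_add] at h2
  rw [pullback_apply, apply_zero_of_eventuallyEq one_ne_zero hf,
    posPow_one_right (LiftDiff.deriv_pos f 0), hf'.deriv.self_of_nhds, deriv_const_mul_id] at h2
  push_cast at h2
  have h3 : (τ : 𝕜) * (ddx (b k) : ℝ → 𝕜) 0 = 0 := by linear_combination -h2
  exact (mul_eq_zero.1 h3).resolve_left (RCLike.ofReal_ne_zero.2 hτ)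

/-- The quadratic jet shifts b₁(0) by a multiple of (2 lam + 1) b₂(0), the cubic jet shifts b₀(0) by
a multiple of lam b₂(0), and lam and 2 lam + 1 are not both zero. No condition on δ is needed. -/
lemma LocallyInvariant.apply_two_zero (hb : LocallyInvariant lam δ b) :
    (b 2 : ℝ → 𝕜) 0 = 0 := by
  obtain ⟨τ, hτ, f, hf, hfb⟩ := hb.exists_ne_zero 2
  have h1 := coeffPullback_apply_one lam δ f b 0
  rw [hfb, pullback_apply_zero_of_eventuallyEq le_rfl hf, logDerivFun_zero_of_quadratic hf] at h1
  obtain ⟨σ, hσ, g, hg, hgb⟩ := hb.exists_ne_zero 3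
  have h0 := coeffPullback_apply_zero lam δ g b 0
  rw [hgb, pullback_apply_zero_of_eventuallyEq (by norm_num) hg, logDerivFun_zero_of_cubic hg,
    ddx_logDerivFun_zero_of_cubic hg] at h0
  have h1' : (2 * lam + 1) * (b 2 : ℝ → 𝕜) 0 = 0 := by
    have : (2 * (τ : 𝕜)) * ((2 * lam + 1) * (b 2 : ℝ → 𝕜) 0) = 0 := by linear_combination h1
    exact (mul_eq_zero.1 this).resolve_left (by simp [hτ])
  have h0' : lam * (b 2 : ℝ → 𝕜) 0 = 0 := by
    have : (6 * (σ : 𝕜)) * (lam * (b 2 : ℝ → 𝕜) 0) = 0 := by linear_combination h0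
    exact (mul_eq_zero.1 this).resolve_left (by simp [hσ])
  linear_combination h1' - 2 * h0'

/-- Once b₂(0) = 0, the quadratic jet shifts b₀(0) by -2τ lam b₁(0). -/
lemma LocallyInvariant.apply_one_zero (hb : LocallyInvariant lam δ b) (hlam : lam ≠ 0) :
    (b 1 : ℝ → 𝕜) 0 = 0 := by
  obtain ⟨τ, hτ, f, hf, hfb⟩ := hb.exists_ne_zero 2
  have h0 := coeffPullback_apply_zero lam δ f b 0
  rw [hfb, hb.apply_two_zero, pullback_apply_zero_of_eventuallyEq le_rfl hf,
    logDerivFun_zero_of_quadratic hf] at h0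
  have : (2 * (τ : 𝕜) * lam) * (b 1 : ℝ → 𝕜) 0 = 0 := by linear_combination h0
  exact (mul_eq_zero.1 this).resolve_left (by simp [hτ, hlam])

end invariants

/-! ### Symmetries are differential operators -/

/-- Evaluation at a point. -/
noncomputable def evalAt (x : ℝ) : SmoothFun 𝕜 →ₗ[𝕜] 𝕜 where
  toFun φ := (φ : ℝ → 𝕜) x
  map_add' _ _ := rfl
  map_smul' _ _ := rfl

lemma evalAt_apply (x : ℝ) (φ : SmoothFun 𝕜) : evalAt x φ = (φ : ℝ → 𝕜) x := rfl

lemma exists_liftDiff_contraction : ∃ r : ℝ, 0 < r ∧ r < 1 ∧ ∃ f : LiftDiff,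
    (f : Equiv.Perm ℝ) =ᶠ[𝓝 0] fun x => r * x := by
  obtain ⟨t, ht, h⟩ := exists_liftDiff_local (B := 0) one_pos 1
  have h1 : 0 < min (t / 2) (1 / 2) := lt_min (by positivity) (by norm_num)
  obtain ⟨f, hf, -⟩ := h (-min (t / 2) (1 / 2)) (by
    rw [abs_neg, abs_of_pos h1]; linarith [min_le_left (t / 2) (1 / 2)])
  refine ⟨1 - min (t / 2) (1 / 2), by linarith [min_le_right (t / 2) (1 / 2)], by linarith, f, ?_⟩
  filter_upwards [hf] with x hx using by rw [hx]; ring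

section structureTheorem

variable {lam δ : 𝕜} {T : Module.End 𝕜 (Fin 3 → SmoothFun 𝕜)}

/-- The source of locality: T commutes with the diffeomorphisms that fix a, so these fix T a as
well. -/
lemma locallyInvariant_apply (hT : T ∈ coeffSymmetryAlgebra lam δ) {a : Fin 3 → SmoothFun 𝕜}
    (ha : ∀ k, (a k : ℝ → 𝕜) =ᶠ[𝓝 0] 0) : LocallyInvariant lam δ (T a) := by
  obtain ⟨B, hB, h⟩ := exists_coeffPullback_eq_self lam δ ha
  refine ⟨B, hB, fun f hf => ?_⟩
  rw [mem_coeffSymmetryAlgebra.1 hT, h f hf]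

/-- E stands for a jet coordinate at 0 of degree e. A contraction by r scales output component j by
r^(δ-j) and input component i by r^(δ-i), so a_i ↦ E (T a)_j is homogeneous of degree i - j + e and
`exists_eq_mul_ddxInt` applies. -/
lemma exists_functional_eq_sum (hT : T ∈ coeffSymmetryAlgebra lam δ) (E : SmoothFun 𝕜 →ₗ[𝕜] 𝕜)
    (e : ℤ) (hEloc : ∀ φ : SmoothFun 𝕜, (φ : ℝ → 𝕜) =ᶠ[𝓝 0] 0 → E φ = 0)
    (hE : ∀ (r : ℝ) (f : LiftDiff), ((f : Equiv.Perm ℝ) =ᶠ[𝓝 0] fun x => r * x) →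
      ∀ φ, E (pullback 0 f φ) = (r : 𝕜) ^ e * E φ) (j : Fin 3)
    (hloc : ∀ a : Fin 3 → SmoothFun 𝕜, (∀ k, (a k : ℝ → 𝕜) =ᶠ[𝓝 0] 0) → E (T a j) = 0) :
    ∃ c : Fin 3 → 𝕜, ∀ a, E (T a j) =
      ∑ i, c i * (ddxInt ((i : ℕ) - (j : ℕ) + e) (a i) : ℝ → 𝕜) 0 := by
  obtain ⟨r, hr0, hr1, f, hf⟩ := exists_liftDiff_contraction
  have hr : (r : 𝕜) ≠ 0 := RCLike.ofReal_ne_zero.2 hr0.ne'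
  let L : Fin 3 → SmoothFun 𝕜 →ₗ[𝕜] 𝕜 := fun i =>
    E ∘ₗ LinearMap.proj j ∘ₗ T ∘ₗ LinearMap.single 𝕜 (fun _ => SmoothFun 𝕜) i
  have hL : ∀ i φ, L i φ = E (T (Pi.single i φ) j) := fun i φ => rfl
  have hEcongr : ∀ φ ψ : SmoothFun 𝕜, (φ : ℝ → 𝕜) =ᶠ[𝓝 0] ψ → E φ = E ψ := by
    intro φ ψ h
    rw [← sub_eq_zero, ← map_sub]
    exact hEloc _ (by filter_upwards [h] with x hx; simp [hx])
  have hTcongr : ∀ a b : Fin 3 → SmoothFun 𝕜, (∀ k, (a k : ℝ → 𝕜) =ᶠ[𝓝 0] b k) →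
      E (T a j) = E (T b j) := by
    intro a b h
    rw [← sub_eq_zero, ← map_sub, ← Pi.sub_apply, ← map_sub]
    exact hloc _ fun k => by filter_upwards [h k] with x hx; simp [hx]
  have hex : ∀ i : Fin 3, ∃ c : 𝕜, ∀ φ, L i φ =
      c * (ddxInt ((i : ℕ) - (j : ℕ) + e) φ : ℝ → 𝕜) 0 := by
    intro i
    refine exists_eq_mul_ddxInt (L i) _ (fun φ hφ => ?_) hr0 hr1 hf fun φ => ?_
    · rw [hL]
      refine hloc _ fun k => ?_
      by_cases hk : k = i
      · subst hk; simpa using hφ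
      · rw [Pi.single_eq_of_ne hk]; rfl
    · have h1 := coeffPullback_eventuallyEq_of_linear lam δ hf (T (Pi.single i φ)) j
      have h2 := hEcongr _ _ h1
      rw [map_smul, hE r f hf, mem_coeffSymmetryAlgebra.1 hT] at h2
      have h3 := hTcongr (coeffPullback lam δ f (Pi.single i φ))
        (posPow r (δ - (i : ℕ)) • Pi.single i (pullback 0 f φ)) (fun k => by
          have := coeffPullback_eventuallyEq_of_linear lam δ hf (Pi.single i φ) k
          refine this.trans (Eventually.of_forall fun x => ?_)
          by_cases hk : k = i
          · subst hk; simp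
          · simp [Pi.single_eq_of_ne hk])
      rw [h2, map_smul, Pi.smul_apply, map_smul, ← hL, ← hL, smul_eq_mul, smul_eq_mul] at h3
      -- The weights differ by an integer, so the possibly complex power r^δ cancels.
      have h4 : posPow r (δ - (j : ℕ)) =
          posPow r (δ - (i : ℕ)) * (r : 𝕜) ^ (((i : ℕ) : ℤ) - (j : ℕ)) := by
        rw [← posPow_intCast hr0, ← posPow_add]
        congr 1
        push_cast
        ring
      rw [h4] at h3
      apply mul_left_cancel₀ (posPow_ne_zero r (δ - (i : ℕ)))
      rw [← h3, zpow_add₀ hr]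
      ring
  choose c hc using hex
  refine ⟨c, fun a => ?_⟩
  have ha : a = ∑ i, Pi.single i (a i) := (Finset.univ_sum_single a).symm
  conv_lhs => rw [ha]
  rw [map_sum, Finset.sum_apply, map_sum]
  exact Finset.sum_congr rfl fun i _ => (hL i _).symm.trans (hc i _)

lemma ddx_pullback_translation (t : ℝ) (φ : SmoothFun 𝕜) :
    ddx (pullback 0 (translation t) φ) = pullback 0 (translation t) (ddx φ) := by
  rw [ddx_pullback, zero_smul, zero_add]
  ext x
  rw [pullback_translation, pullback_translation]

lemma ddxInt_pullback_translation (n : ℤ) (t : ℝ) (φ : SmoothFun 𝕜) :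
    ddxInt n (pullback 0 (translation t) φ) = pullback 0 (translation t) (ddxInt n φ) := by
  rcases lt_or_ge n 0 with hn | hn
  · simp [ddxInt_of_neg hn]
  · lift n to ℕ using hn
    rw [ddxInt_natCast]
    induction n with
    | zero => rfl
    | succ n ih => rw [pow_succ', Module.End.mul_apply, ih, ddx_pullback_translation]; rfl

lemma apply_translate (hT : T ∈ coeffSymmetryAlgebra lam δ) (a : Fin 3 → SmoothFun 𝕜) (t : ℝ)
    (j : Fin 3) : T (fun k => pullback 0 (translation t) (a k)) j =
      pullback 0 (translation t) (T a j) := by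
  have h : (fun k => pullback 0 (translation t) (a k)) = coeffPullback lam δ (translation t) a :=
    funext fun k => (coeffPullback_translation lam δ t a k).symm
  rw [h, ← mem_coeffSymmetryAlgebra.1 hT, coeffPullback_translation]

/-- Translations act on coefficients by mere substitution, so the formula at 0 holds at every point
with the same constants. -/
lemma exists_row_eq_sum (hT : T ∈ coeffSymmetryAlgebra lam δ) (j : Fin 3)
    (hloc : ∀ b : Fin 3 → SmoothFun 𝕜, LocallyInvariant lam δ b → (b j : ℝ → 𝕜) 0 = 0) :
    ∃ c : Fin 3 → 𝕜, ∀ a, T a j = ∑ i, c i • ddxInt ((i : ℕ) - (j : ℕ)) (a i) := by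
  obtain ⟨c, hc⟩ := exists_functional_eq_sum hT (evalAt 0) 0
    (fun φ hφ => hφ.self_of_nhds) (fun r f hf φ => by
      rw [evalAt_apply, evalAt_apply, pullback_apply, posPow_zero_right, hf.self_of_nhds]
      simp) j (fun a ha => hloc _ (locallyInvariant_apply hT ha))
  refine ⟨c, fun a => ?_⟩
  ext x
  have h := hc fun k => pullback 0 (translation x) (a k)
  rw [apply_translate hT, evalAt_apply, pullback_translation, zero_add] at h
  rw [h, ← evalAt_apply x, map_sum]
  refine Finset.sum_congr rfl fun i _ => ?_
  rw [ddxInt_pullback_translation, pullback_translation, map_smul, add_zero, zero_add]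
  rfl

/-- Substitute for `exists_row_eq_sum` when component j has weight 0 and only its derivative is
local. -/
lemma exists_ddx_row_eq_sum (hT : T ∈ coeffSymmetryAlgebra lam δ) (j : Fin 3)
    (hloc : ∀ b : Fin 3 → SmoothFun 𝕜, LocallyInvariant lam δ b → (ddx (b j) : ℝ → 𝕜) 0 = 0) :
    ∃ c : Fin 3 → 𝕜, ∀ a, ddx (T a j) = ∑ i, c i • ddxInt ((i : ℕ) - (j : ℕ) + 1) (a i) := by
  have hconst : deriv (0 : ℝ → 𝕜) = 0 := funext fun x => deriv_const x 0
  obtain ⟨c, hc⟩ := exists_functional_eq_sum hT (evalAt 0 ∘ₗ ddx) 1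
    (fun φ hφ => by
      have := (ddx_eventuallyEq hφ).self_of_nhds
      rw [hconst] at this
      exact this) (fun r f hf φ => by
      rw [LinearMap.comp_apply, LinearMap.comp_apply, evalAt_apply, evalAt_apply, ddx_pullback,
        zero_smul, zero_add, zero_add, pullback_apply, posPow_one_right (LiftDiff.deriv_pos f 0),
        hf.self_of_nhds, hf.deriv.self_of_nhds, deriv_const_mul_id]
      simp) j (fun a ha => hloc _ (locallyInvariant_apply hT ha))
  refine ⟨c, fun a => ?_⟩
  ext x
  have h := hc fun k => pullback 0 (translation x) (a k)
  rw [apply_translate hT, LinearMap.comp_apply, ddx_pullback_translation, evalAt_apply,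
    pullback_translation, zero_add] at h
  rw [h, ← evalAt_apply x, map_sum]
  refine Finset.sum_congr rfl fun i _ => ?_
  rw [ddxInt_pullback_translation, pullback_translation, map_smul, zero_add]
  rfl

/-- The operator on coefficients attached to a matrix. -/
noncomputable def matrixOp (M : Matrix (Fin 3) (Fin 3) 𝕜) :
    Module.End 𝕜 (Fin 3 → SmoothFun 𝕜) :=
  LinearMap.pi fun j => ∑ i, M j i • (ddxInt ((i : ℕ) - (j : ℕ)) ∘ₗ LinearMap.proj i)

lemma matrixOp_apply (M : Matrix (Fin 3) (Fin 3) 𝕜) (a : Fin 3 → SmoothFun 𝕜) (j : Fin 3) :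
    matrixOp M a j = ∑ i, M j i • ddxInt ((i : ℕ) - (j : ℕ)) (a i) := by
  simp [matrixOp, LinearMap.sum_apply]

/-- Away from the exceptional weights, symmetries are given by matrices. -/
lemma exists_eq_matrixOp (hT : T ∈ coeffSymmetryAlgebra lam δ) (h0 : δ ≠ 0)
    (h1 : lam ≠ 0 ∨ δ ≠ 1) : ∃ M, T = matrixOp M := by
  have hrow : ∀ j, ∃ c : Fin 3 → 𝕜, ∀ a, T a j = ∑ i, c i • ddxInt ((i : ℕ) - (j : ℕ)) (a i) := by
    intro j
    refine exists_row_eq_sum hT j fun b hb => ?_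
    fin_cases j
    · exact hb.apply_zero_eq_zero_of_weight (k := 0) (by simpa using h0)
    · rcases h1 with h1 | h1
      · exact hb.apply_one_zero h1
      · exact hb.apply_zero_eq_zero_of_weight (k := 1) (by simpa using h1)
    · exact hb.apply_two_zero
  choose c hc using hrow
  refine ⟨Matrix.of c, ?_⟩
  refine LinearMap.ext fun a => funext fun j => ?_
  rw [hc, matrixOp_apply]
  rfl

end structureTheorem

/-! ### The exceptional weights -/

/-- A nonzero constant has no periodic primitive. -/
lemma eq_const_of_ddx_eq_const {φ : SmoothFun 𝕜} {c : 𝕜} (h : ddx φ = c • (1 : SmoothFun 𝕜)) :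
    c = 0 ∧ φ = (φ : ℝ → 𝕜) 0 • (1 : SmoothFun 𝕜) := by
  have hd : ∀ x, HasDerivAt (fun x : ℝ => (φ : ℝ → 𝕜) x - x • c) 0 x := by
    intro x
    have h1 := (differentiable_smoothFun φ x).hasDerivAt
    rw [show deriv (φ : ℝ → 𝕜) x = c * 1 from congrFun (congrArg Subtype.val h) x] at h1
    convert! h1.sub ((hasDerivAt_id x).smul_const c) using 1
    simp
  have hc := is_const_of_deriv_eq_zero (fun x => (hd x).differentiableAt) fun x => (hd x).deriv
  have h0 : c = 0 := by
    have h1 := hc 1 0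
    have h2 := φ.2.2 0
    rw [zero_add] at h2
    simpa [h2] using h1
  refine ⟨h0, ?_⟩
  ext x
  have h1 := hc x 0
  simpa [h0] using h1

lemma ddxInt_succ_apply (n : ℤ) (hn : 0 ≤ n) (φ : SmoothFun 𝕜) :
    ddxInt (n + 1) φ = ddx (ddxInt n φ) := by
  lift n to ℕ using hn
  rw [ddxInt_natCast, ← Module.End.mul_apply, ← pow_succ', ← ddxInt_natCast]
  rfl

lemma ddxInt_eventuallyEq_zero (n : ℤ) {φ : SmoothFun 𝕜} {x : ℝ} (h : (φ : ℝ → 𝕜) =ᶠ[𝓝 x] 0) :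
    (ddxInt n φ : ℝ → 𝕜) =ᶠ[𝓝 x] 0 := by
  rcases lt_or_ge n 0 with hn | hn
  · rw [ddxInt_of_neg hn]; rfl
  · lift n to ℕ using hn
    rw [ddxInt_natCast]
    induction n with
    | zero => exact h
    | succ n ih =>
      rw [pow_succ', Module.End.mul_apply]
      have := ddx_eventuallyEq ih
      rwa [show deriv (0 : ℝ → 𝕜) = 0 from funext fun x => deriv_const x 0] at this

lemma matrixOp_apply_eq_zero (M : Matrix (Fin 3) (Fin 3) 𝕜) {a : Fin 3 → SmoothFun 𝕜} {x : ℝ}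
    (h : ∀ k, (a k : ℝ → 𝕜) =ᶠ[𝓝 x] 0) (j : Fin 3) : (matrixOp M a j : ℝ → 𝕜) x = 0 := by
  rw [matrixOp_apply, ← evalAt_apply, map_sum]
  refine Finset.sum_eq_zero fun i _ => ?_
  rw [map_smul, evalAt_apply, (ddxInt_eventuallyEq_zero _ (h i)).self_of_nhds]
  simp

section

variable {lam δ : 𝕜} {T : Module.End 𝕜 (Fin 3 → SmoothFun 𝕜)}

/-- The rank-one operator `a ↦ k(a) e_j`. -/
noncomputable def rankOne (k : (Fin 3 → SmoothFun 𝕜) →ₗ[𝕜] 𝕜) (j : Fin 3) :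
    Module.End 𝕜 (Fin 3 → SmoothFun 𝕜) :=
  k.smulRight (Pi.single j 1)

lemma rankOne_apply (k : (Fin 3 → SmoothFun 𝕜) →ₗ[𝕜] 𝕜) (j : Fin 3) (a : Fin 3 → SmoothFun 𝕜) :
    rankOne k j a = k a • Pi.single j 1 := rfl

/-- When row j₀ is known only after differentiation, its deviation from the matrix is a constant
function, and the value of that constant is a linear functional of a. -/
lemma exists_eq_matrixOp_add_rankOne (j₀ : Fin 3)
    (hrow : ∀ j, j ≠ j₀ → ∃ c : Fin 3 → 𝕜, ∀ a, T a j = ∑ i, c i • ddxInt ((i : ℕ) - (j : ℕ)) (a i))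
    (hrow₀ : ∃ c : Fin 3 → 𝕜, ∀ a,
      ddx (T a j₀) = ddx (∑ i, c i • ddxInt ((i : ℕ) - (j₀ : ℕ)) (a i))) :
    ∃ M k, T = matrixOp M + rankOne k j₀ := by
  obtain ⟨c₀, hc₀⟩ := hrow₀
  choose! c hc using hrow
  let M : Matrix (Fin 3) (Fin 3) 𝕜 := Matrix.of fun j => if j = j₀ then c₀ else c j
  have hM : ∀ a, ddx (T a j₀ - matrixOp M a j₀) = 0 := by
    intro a
    rw [map_sub, hc₀, matrixOp_apply]
    simp [M]
  refine ⟨M, evalAt 0 ∘ₗ LinearMap.proj j₀ ∘ₗ (T - matrixOp M), ?_⟩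
  refine LinearMap.ext fun a => funext fun j => ?_
  rw [LinearMap.add_apply, Pi.add_apply, rankOne_apply, Pi.smul_apply]
  by_cases hj : j = j₀
  · subst hj
    rw [Pi.single_eq_same]
    have := (eq_const_of_ddx_eq_const (c := 0) ((hM a).trans (zero_smul _ _).symm)).2
    exact sub_eq_iff_eq_add'.1 this
  · rw [Pi.single_eq_of_ne hj, smul_zero, add_zero, hc j hj, matrixOp_apply]
    simp [M, hj]

lemma exists_eq_of_weight_zero (hT : T ∈ coeffSymmetryAlgebra lam 0) :
    ∃ M k, T = matrixOp M + rankOne k 0 := by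
  refine exists_eq_matrixOp_add_rankOne 0 (fun j hj => exists_row_eq_sum hT j fun b hb =>
    hb.apply_zero_eq_zero_of_weight (k := j) ?_) ?_
  · exact_mod_cast fun h : (0 : ℕ) = j => hj (Fin.ext h.symm)
  · obtain ⟨c, hc⟩ := exists_ddx_row_eq_sum hT 0 fun b hb => hb.ddx_apply_zero (k := 0) (by simp)
    refine ⟨c, fun a => (hc a).trans ?_⟩
    rw [map_sum]
    refine Finset.sum_congr rfl fun i _ => ?_
    rw [map_smul, ddxInt_succ_apply _ (by simp)]

lemma exists_eq_of_weight_one (hT : T ∈ coeffSymmetryAlgebra lam 1) :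
    ∃ M k, T = matrixOp M + rankOne k 1 := by
  refine exists_eq_matrixOp_add_rankOne 1 (fun j hj => exists_row_eq_sum hT j fun b hb =>
    hb.apply_zero_eq_zero_of_weight (k := j) ?_) ?_
  · exact_mod_cast fun h : (1 : ℕ) = j => hj (Fin.ext h.symm)
  · obtain ⟨c, hc⟩ := exists_ddx_row_eq_sum hT 1 fun b hb => hb.ddx_apply_zero (k := 1) (by simp)
    -- The term c₀ a₀ has order 0 and need not be a derivative. At a₀ = 1 it would make the constant
    -- c₀ the derivative of a periodic function.
    have h0 : c 0 = 0 := by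
      have h1 := hc (Pi.single 0 1)
      rw [Fin.sum_univ_three, Pi.single_eq_same, Pi.single_eq_of_ne (by decide),
        Pi.single_eq_of_ne (by decide)] at h1
      refine (eq_const_of_ddx_eq_const (h1.trans ?_)).1
      simp [ddxInt]
    refine ⟨c, fun a => (hc a).trans ?_⟩
    rw [map_sum]
    refine Finset.sum_congr rfl fun i _ => ?_
    rw [map_smul]
    fin_cases i
    · simp [h0]
    · rw [ddxInt_succ_apply _ (by simp)]
    · rw [ddxInt_succ_apply _ (by simp)]

lemma eventuallyEq_mul_zero_left {χ φ : SmoothFun 𝕜} {x : ℝ} (h : (χ : ℝ → 𝕜) =ᶠ[𝓝 x] 0) :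
    ((χ * φ : SmoothFun 𝕜) : ℝ → 𝕜) =ᶠ[𝓝 x] 0 := by
  filter_upwards [h] with y hy
  simp [hy]

/-- The functional in a rank-one part is invariant. -/
lemma functional_coeffPullback_eq {M : Matrix (Fin 3) (Fin 3) 𝕜}
    {k : (Fin 3 → SmoothFun 𝕜) →ₗ[𝕜] 𝕜} {j : Fin 3}
    (hinv : ∀ f, coeffPullback lam δ f (Pi.single j 1) = Pi.single j 1)
    (hT : matrixOp M + rankOne k j ∈ coeffSymmetryAlgebra lam δ) (f : LiftDiff)
    (a : Fin 3 → SmoothFun 𝕜) : k (coeffPullback lam δ f a) = k a := by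
  -- Component j of the commutation relation is evaluated at x: the matrix parts vanish there, and
  -- only the constants k remain.
  have key : ∀ (a : Fin 3 → SmoothFun 𝕜) (x : ℝ),
      (∀ i, (a i : ℝ → 𝕜) =ᶠ[𝓝 ((f : Equiv.Perm ℝ) x)] 0) →
      k (coeffPullback lam δ f a) = k a := by
    intro a x ha
    have h1 := mem_coeffSymmetryAlgebra.1 hT f a
    rw [LinearMap.add_apply, LinearMap.add_apply, map_add, rankOne_apply, rankOne_apply, map_smul,
      hinv] at h1
    have h2 := congrFun (congrArg Subtype.val (congrFun h1 j)) x
    have h3 := matrixOp_apply_eq_zero M (coeffPullback_eventuallyEq_zero lam δ f ha) j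
    have h4 : ∀ i, (matrixOp M a i : ℝ → 𝕜) =ᶠ[𝓝 ((f : Equiv.Perm ℝ) x)] 0 := fun i => by
      filter_upwards [(eventually_all.2 fun i => (ha i).eventuallyEq_nhds)] with y hy
        using matrixOp_apply_eq_zero M hy i
    have h5 := (coeffPullback_eventuallyEq_zero lam δ f h4 j).self_of_nhds
    change (coeffPullback lam δ f (matrixOp M a) j : ℝ → 𝕜) x +
      k a * ((Pi.single j (1 : SmoothFun 𝕜) : Fin 3 → SmoothFun 𝕜) j : ℝ → 𝕜) x =
      (matrixOp M (coeffPullback lam δ f a) j : ℝ → 𝕜) x + k (coeffPullback lam δ f a) *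
      ((Pi.single j (1 : SmoothFun 𝕜) : Fin 3 → SmoothFun 𝕜) j : ℝ → 𝕜) x at h2
    rw [h3, h5, Pi.single_eq_same] at h2
    simpa using h2.symm
  -- Each triple is a sum of one vanishing near 1/2 and one vanishing near 0, so `key` covers
  -- everything by linearity.
  let χ : SmoothFun 𝕜 := ofRealFun 𝕜 (cosBump 0 (-1 / 2)) (contDiff_cosBump _ _)
    (cosBump_periodic _ _)
  have hχ0 : ((1 - χ : SmoothFun 𝕜) : ℝ → 𝕜) =ᶠ[𝓝 0] 0 := by
    filter_upwards [eventually_cosBump_eq_one (A := 0) (B := -1 / 2) (by norm_num)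
      (by norm_num)] with x hx
    change (1 : 𝕜) - ((cosBump 0 (-1 / 2) x : ℝ) : 𝕜) = 0
    rw [hx]
    simp
  have hχ1 : (χ : ℝ → 𝕜) =ᶠ[𝓝 (1 / 2)] 0 := by
    have : Real.cos (2 * Real.pi * (1 / 2)) < -1 / 2 := by
      rw [show 2 * Real.pi * (1 / 2) = Real.pi by ring, Real.cos_pi]; norm_num
    filter_upwards [continuous_cos_two_pi.continuousAt.eventually (gt_mem_nhds this)] with x hx
    change ((cosBump 0 (-1 / 2) x : ℝ) : 𝕜) = 0
    rw [cosBump_eq_zero (by norm_num) (le_of_lt hx)]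
    simp
  have ha : a = (fun i => χ * a i) + fun i => (1 - χ) * a i := by
    ext1 i
    simp only [Pi.add_apply]
    ring
  rw [ha, map_add, map_add, map_add]
  congr 1
  · refine key _ ((f : Equiv.Perm ℝ).symm (1 / 2)) fun i => ?_
    rw [Equiv.apply_symm_apply]
    exact eventuallyEq_mul_zero_left hχ1
  · refine key _ ((f : Equiv.Perm ℝ).symm 0) fun i => ?_
    rw [Equiv.apply_symm_apply]
    exact eventuallyEq_mul_zero_left hχ0

end

/-! ### Invariant functionals on densities -/

lemma functional_ext_of_real {k k' : SmoothFun 𝕜 →ₗ[𝕜] 𝕜}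
    (h : ∀ (g : ℝ → ℝ) (hg : ContDiff ℝ ∞ g) (hp : Function.Periodic g 1),
      k (ofRealFun 𝕜 g hg hp) = k' (ofRealFun 𝕜 g hg hp)) : k = k' := by
  ext φ
  have hre : ContDiff ℝ ∞ fun x => RCLike.re ((φ : ℝ → 𝕜) x) :=
    (RCLike.reCLM (K := 𝕜)).contDiff.comp φ.2.1
  have him : ContDiff ℝ ∞ fun x => RCLike.im ((φ : ℝ → 𝕜) x) :=
    (RCLike.imCLM (K := 𝕜)).contDiff.comp φ.2.1
  have hrep : Function.Periodic (fun x => RCLike.re ((φ : ℝ → 𝕜) x)) 1 := fun x => by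
    simp only [φ.2.2 x]
  have himp : Function.Periodic (fun x => RCLike.im ((φ : ℝ → 𝕜) x)) 1 := fun x => by
    simp only [φ.2.2 x]
  have e : φ = ofRealFun 𝕜 _ hre hrep + (RCLike.I : 𝕜) • ofRealFun 𝕜 _ him himp := by
    ext x
    change (φ : ℝ → 𝕜) x = (RCLike.re ((φ : ℝ → 𝕜) x) : 𝕜) +
      RCLike.I * (RCLike.im ((φ : ℝ → 𝕜) x) : 𝕜)
    rw [mul_comm, RCLike.re_add_im]
  rw [e]
  rw [map_add, map_add, map_smul, map_smul, h, h]

/-- Adding a large constant makes a real periodic function positive, so positive functions span. -/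
lemma functional_ext_of_pos {k k' : SmoothFun 𝕜 →ₗ[𝕜] 𝕜}
    (h : ∀ (g : ℝ → ℝ) (hg : ContDiff ℝ ∞ g) (hp : Function.Periodic g 1), (∀ x, 0 < g x) →
      k (ofRealFun 𝕜 g hg hp) = k' (ofRealFun 𝕜 g hg hp)) : k = k' := by
  refine functional_ext_of_real fun g hg hp => ?_
  obtain ⟨C, hC, hb⟩ := exists_bound_of_periodic hg.continuous hp
  have hgC : Function.Periodic (fun x => g x + 2 * C) 1 := fun x => by simp only [hp x]
  have hC' : Function.Periodic (fun _ : ℝ => 2 * C) 1 := fun _ => rfl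
  have e : ofRealFun 𝕜 g hg hp = ofRealFun 𝕜 (fun x => g x + 2 * C) (hg.add contDiff_const) hgC -
        ofRealFun 𝕜 (fun _ => 2 * C) contDiff_const hC' := by
    ext x
    change ((g x : ℝ) : 𝕜) = ((g x + 2 * C : ℝ) : 𝕜) - ((2 * C : ℝ) : 𝕜)
    rw [← RCLike.ofReal_sub]
    ring_nf
  rw [e, map_sub, map_sub, h _ _ hgC fun x => ?_, h _ _ hC' fun x => ?_]
  · positivity
  · have := abs_le.1 (hb x)
    linarith

/-- An invariant functional on `σ`-densities is determined on positive functions. -/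
lemma functional_apply_of_pos {k : SmoothFun 𝕜 →ₗ[𝕜] 𝕜} {σ : ℝ} (hσ : σ ≠ 0)
    (hk : ∀ f φ, k (pullback (σ : 𝕜) f φ) = k φ) {v : ℝ → ℝ} (hv : ContDiff ℝ ∞ v)
    (hp : Function.Periodic v 1) (hpos : ∀ x, 0 < v x) :
    k (ofRealFun 𝕜 v hv hp) = (((∫ x in (0 : ℝ)..1, v x ^ (1 / σ)) ^ σ : ℝ) : 𝕜) * k 1 := by
  set w : ℝ → ℝ := fun x => v x ^ (1 / σ) with hw
  have hwc : ContDiff ℝ ∞ w := hv.rpow_const_of_ne fun x => (hpos x).ne'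
  have hwp : Function.Periodic w 1 := fun x => by simp only [hw, hp x]
  have hwpos : ∀ x, 0 < w x := fun x => Real.rpow_pos_of_pos (hpos x) _
  set m := ∫ x in (0 : ℝ)..1, w x with hm
  have hmpos : 0 < m := intervalIntegral.intervalIntegral_pos_of_pos
    (hwc.continuous.intervalIntegrable _ _) hwpos zero_lt_one
  have hd : ∀ x, HasDerivAt (fun x => (∫ t in (0 : ℝ)..x, w t) / m) (w x / m) x := fun x =>
    (intervalIntegral.integral_hasDerivAt_right (hwc.continuous.intervalIntegrable _ _)
      (hwc.continuous.stronglyMeasurableAtFilter _ _) hwc.continuous.continuousAt).div_const m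
  have hdf : deriv (fun x => (∫ t in (0 : ℝ)..x, w t) / m) = fun x => w x / m :=
    funext fun x => (hd x).deriv
  -- The normalized primitive of v^(1/σ) has degree one, and it pulls the constant density 1 back to
  -- v / m^σ.
  obtain ⟨f, hf⟩ := exists_liftDiff_of_deriv_pos (f := fun x => (∫ t in (0 : ℝ)..x, w t) / m)
    (by
      rw [contDiff_infty_iff_deriv, hdf]
      exact ⟨fun x => (hd x).differentiableAt, hwc.div_const m⟩)
    (fun x => by rw [hdf]; exact div_pos (hwpos x) hmpos)
    (fun x => by
      have h1 := hwp.intervalIntegral_add_eq x 0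
      rw [zero_add, ← hm] at h1
      have h2 := intervalIntegral.integral_add_adjacent_intervals
        (hwc.continuous.intervalIntegrable (μ := MeasureTheory.volume) 0 x)
        (hwc.continuous.intervalIntegrable x (x + 1))
      rw [← h2, h1, add_div, div_self hmpos.ne'])
  have e : pullback (σ : 𝕜) f 1 = ((m ^ σ : ℝ) : 𝕜)⁻¹ • ofRealFun 𝕜 v hv hp := by
    ext x
    have h3 : deriv (f : Equiv.Perm ℝ) x = w x / m := by rw [hf, hdf]
    rw [pullback_apply, h3, posPow_ofReal (div_pos (hwpos x) hmpos),
      Real.div_rpow (hwpos x).le hmpos.le, hw]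
    change _ * (1 : 𝕜) = ((m ^ σ : ℝ) : 𝕜)⁻¹ * ((v x : ℝ) : 𝕜)
    rw [← Real.rpow_mul (hpos x).le, one_div_mul_cancel hσ, Real.rpow_one]
    push_cast
    rw [mul_one, div_eq_inv_mul]
  have h4 := hk f 1
  have h5 : ((m ^ σ : ℝ) : 𝕜) ≠ 0 := RCLike.ofReal_ne_zero.2 (Real.rpow_pos_of_pos hmpos σ).ne'
  rw [e, map_smul, smul_eq_mul, inv_mul_eq_iff_eq_mul₀ h5] at h4
  exact h4

lemma integral_cos_two_pi : ∫ x in (0 : ℝ)..1, Real.cos (2 * Real.pi * x) = 0 := by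
  rw [intervalIntegral.integral_comp_mul_left _ (by positivity)]
  simp

/-- For p < 0 one has v^p ≥ 1 + p log v ≥ 1 + p (v - 1), and the last function has integral 1
because v has mean 1. The inequality is strict at x = 0, where v ≠ 1. -/
lemma one_lt_integral_rpow {p : ℝ} (hp : p < 0) :
    1 < ∫ x in (0 : ℝ)..1, (1 + 1 / 2 * Real.cos (2 * Real.pi * x)) ^ p := by
  set v : ℝ → ℝ := fun x => 1 + 1 / 2 * Real.cos (2 * Real.pi * x) with hv
  have hvc : Continuous v := by fun_prop
  have hpos : ∀ x, 0 < v x := fun x => by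
    have := Real.neg_one_le_cos (2 * Real.pi * x)
    simp only [hv]
    linarith
  have hle : ∀ x, 1 + p * Real.log (v x) ≤ v x ^ p := fun x => by
    rw [Real.rpow_def_of_pos (hpos x), mul_comm p, add_comm]
    exact Real.add_one_le_exp _
  have hint : ∫ x in (0 : ℝ)..1, (v x ^ p - (1 + p * (v x - 1))) =
      (∫ x in (0 : ℝ)..1, v x ^ p) - 1 := by
    have hc1 : Continuous fun x => v x ^ p := hvc.rpow_const fun x => Or.inl (hpos x).ne'
    have e : (fun x => v x ^ p - (1 + p * (v x - 1))) =
        fun x => v x ^ p - (1 + p / 2 * Real.cos (2 * Real.pi * x)) := by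
      ext x
      simp only [hv]
      ring
    rw [e, intervalIntegral.integral_sub (hc1.intervalIntegrable _ _)
      (Continuous.intervalIntegrable (by fun_prop) _ _),
      intervalIntegral.integral_add (Continuous.intervalIntegrable (by fun_prop) _ _)
      (Continuous.intervalIntegrable (by fun_prop) _ _), intervalIntegral.integral_const_mul,
      integral_cos_two_pi]
    simp
  have h := intervalIntegral.integral_pos (f := fun x => v x ^ p - (1 + p * (v x - 1)))
    (zero_lt_one' ℝ)
    (((hvc.rpow_const fun x => Or.inl (hpos x).ne').sub (by fun_prop)).continuousOn)
    (fun x _ => by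
      have h1 := hle x
      have h2 := Real.log_le_sub_one_of_pos (hpos x)
      nlinarith)
    ⟨0, by simp, by
      have h1 := hle 0
      have h2 := Real.log_lt_sub_one_of_pos (hpos 0) (by simp [hv])
      nlinarith⟩
  rw [hint] at h
  linarith

lemma cos_two_pi_periodic : Function.Periodic (fun x : ℝ => Real.cos (2 * Real.pi * x)) 1 :=
  cos_two_pi_add_one

/-- Linearity conflicts with `functional_apply_of_pos` at v = 1 + ½ cos (2πx). The half-turn changes
the sign of the cosine, so k(v) = k(1), whereas (∫ v^(1/σ))^σ < 1. Hence k(1) = 0, and then k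
vanishes on all positive functions. -/
lemma functional_eq_zero_of_neg {k : SmoothFun 𝕜 →ₗ[𝕜] 𝕜} {σ : ℝ} (hσ : σ < 0)
    (hk : ∀ f φ, k (pullback (σ : 𝕜) f φ) = k φ) : k = 0 := by
  have hcc : ContDiff ℝ ∞ fun x => Real.cos (2 * Real.pi * x) :=
    Real.contDiff_cos.comp (contDiff_const.mul contDiff_id)
  have hcos : k (ofRealFun 𝕜 _ hcc cos_two_pi_periodic) = 0 := by
    have h1 := hk (translation (1 / 2)) (ofRealFun 𝕜 _ hcc cos_two_pi_periodic)
    have h2 : pullback (σ : 𝕜) (translation (1 / 2)) (ofRealFun 𝕜 _ hcc cos_two_pi_periodic) =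
        -ofRealFun 𝕜 _ hcc cos_two_pi_periodic := by
      ext x
      rw [pullback_translation, ofRealFun_apply, mul_add,
        show 2 * Real.pi * (1 / 2) = Real.pi by ring, Real.cos_add_pi, RCLike.ofReal_neg]
      rfl
    rw [h2, map_neg] at h1
    linear_combination (-1 / 2 : 𝕜) * h1
  have hvc : ContDiff ℝ ∞ fun x => 1 + 1 / 2 * Real.cos (2 * Real.pi * x) :=
    contDiff_const.add (contDiff_const.mul hcc)
  have hvp : Function.Periodic (fun x => 1 + 1 / 2 * Real.cos (2 * Real.pi * x)) 1 := fun x => by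
    simp only [cos_two_pi_add_one x]
  have h1 := functional_apply_of_pos hσ.ne hk hvc hvp fun x => by
    linarith [Real.neg_one_le_cos (2 * Real.pi * x)]
  have h2 : ofRealFun 𝕜 _ hvc hvp =
      1 + (1 / 2 : 𝕜) • ofRealFun 𝕜 _ hcc cos_two_pi_periodic := by
    ext x
    change ((1 + 1 / 2 * Real.cos (2 * Real.pi * x) : ℝ) : 𝕜) =
      1 + (1 / 2 : 𝕜) * ((Real.cos (2 * Real.pi * x) : ℝ) : 𝕜)
    push_cast
    ring
  rw [h2, map_add, map_smul, hcos, smul_zero, add_zero] at h1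
  have h3 := Real.rpow_lt_one_of_one_lt_of_neg
    (one_lt_integral_rpow (one_div_neg.2 hσ)) hσ
  have hk1 : k 1 = 0 := by
    by_contra hne
    have h4 := mul_right_cancel₀ hne ((one_mul (k 1)).trans h1)
    rw [← RCLike.ofReal_one, RCLike.ofReal_inj] at h4
    exact h3.ne h4.symm
  refine functional_ext_of_pos fun v hv hp hpos => ?_
  rw [functional_apply_of_pos hσ.ne hk hv hp hpos, hk1, mul_zero]
  rfl

/-- Integration over the circle. -/
noncomputable def circleIntegral : SmoothFun 𝕜 →ₗ[𝕜] 𝕜 where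
  toFun φ := ∫ x in (0 : ℝ)..1, (φ : ℝ → 𝕜) x
  map_add' φ ψ := intervalIntegral.integral_add (φ.2.1.continuous.intervalIntegrable _ _)
    (ψ.2.1.continuous.intervalIntegrable _ _)
  map_smul' c _ := intervalIntegral.integral_const_mul c _

lemma circleIntegral_apply (φ : SmoothFun 𝕜) :
    circleIntegral φ = ∫ x in (0 : ℝ)..1, (φ : ℝ → 𝕜) x := rfl

lemma circleIntegral_one : circleIntegral (1 : SmoothFun 𝕜) = 1 := by
  rw [circleIntegral_apply]
  change ∫ x in (0 : ℝ)..1, (1 : 𝕜) = 1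
  simp

lemma circleIntegral_ddx (φ : SmoothFun 𝕜) : circleIntegral (ddx φ) = 0 := by
  rw [circleIntegral_apply]
  have h := intervalIntegral.integral_eq_sub_of_hasDerivAt (a := 0) (b := 1)
    (fun x _ => (differentiable_smoothFun φ x).hasDerivAt)
    ((ddx φ).2.1.continuous.intervalIntegrable _ _)
  refine h.trans ?_
  have := φ.2.2 0
  rw [zero_add] at this
  rw [this, sub_self]

lemma circleIntegral_pullback (f : LiftDiff) (φ : SmoothFun 𝕜) :
    circleIntegral (pullback 1 f φ) = circleIntegral φ := by
  have h1 : ∀ x, (pullback 1 f φ : ℝ → 𝕜) x =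
      deriv (f : Equiv.Perm ℝ) x • ((φ : ℝ → 𝕜) ∘ (f : Equiv.Perm ℝ)) x := fun x => by
    rw [pullback_apply, posPow_one_right (LiftDiff.deriv_pos f x), RCLike.real_smul_eq_coe_mul]
    rfl
  rw [circleIntegral_apply, circleIntegral_apply]
  simp_rw [h1]
  rw [intervalIntegral.integral_deriv_smul_comp
    (fun x _ => (LiftDiff.differentiable f x).hasDerivAt)
    (LiftDiff.contDiff_deriv f).continuous.continuousOn φ.2.1.continuous]
  have h2 := LiftDiff.apply_add_one f 0
  rw [zero_add] at h2
  have h3 := φ.2.2.intervalIntegral_add_eq ((f : Equiv.Perm ℝ) 0) 0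
  rw [h2, h3, zero_add]

/-- For σ = 1 the formula of `functional_apply_of_pos` is itself linear in v. -/
lemma functional_eq_smul_circleIntegral {k : SmoothFun 𝕜 →ₗ[𝕜] 𝕜}
    (hk : ∀ f φ, k (pullback 1 f φ) = k φ) : k = k 1 • circleIntegral := by
  refine functional_ext_of_pos fun v hv hp hpos => ?_
  rw [functional_apply_of_pos one_ne_zero (by simpa using hk) hv hp hpos, LinearMap.smul_apply,
    circleIntegral_apply, smul_eq_mul, mul_comm]
  congr 1
  simp only [div_one, Real.rpow_one]
  rw [intervalIntegral.integral_of_le zero_le_one, intervalIntegral.integral_of_le zero_le_one]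
  exact integral_ofReal.symm

/-- For f = x + τ g the coordinate function c satisfies c ∘ f - c = τ g, because g is supported
where c is x minus an integer; an invariant functional kills the left side. -/
lemma functional_apply_eq_zero_of_support {k : SmoothFun 𝕜 →ₗ[𝕜] 𝕜}
    (hk : ∀ f φ, k (pullback 0 f φ) = k φ) {g : ℝ → ℝ} (hg : ContDiff ℝ ∞ g)
    (hp : Function.Periodic g 1) (hsupp : ∀ x, Real.cos (2 * Real.pi * x) ≤ -1 / 4 → g x = 0) :
    k (ofRealFun 𝕜 g hg hp) = 0 := by
  obtain ⟨C, hC, hb⟩ := exists_bound_of_periodic hg.continuous hp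
  obtain ⟨C', hC', hb'⟩ := exists_bound_of_periodic (hg.continuous_deriv (by simp))
    (periodic_deriv hp)
  -- This bounds both |τ g'| and |τ g| by 1/4: f is a diffeomorphism, and since 1/3 + 1/3 + 1/4 < 1
  -- the points x and f x have the same nearest integer.
  set τ : ℝ := 1 / (4 * (C + C')) with hτ
  have hτ0 : 0 < τ := by positivity
  have hτe : τ * (C + C') = 1 / 4 := by rw [hτ]; field_simp
  obtain ⟨f, hf⟩ := exists_liftDiff_add (h := fun x => τ * g x) (contDiff_const.mul hg)
    (fun x => by simp only [hp x]) (fun x => by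
      rw [deriv_const_mul _ (hg.differentiable (by simp) x), abs_mul, abs_of_pos hτ0]
      have h1 : |deriv g x| ≤ C' := hb' x
      nlinarith)
  have hcos : Real.cos (2 * Real.pi * (1 / 3)) < -1 / 4 := by
    rw [show 2 * Real.pi * (1 / 3) = Real.pi - Real.pi / 3 by ring, Real.cos_pi_sub,
      Real.cos_pi_div_three]
    norm_num
  have hnear : ∀ x, g x ≠ 0 → ∃ m : ℤ, |x - m| < 1 / 3 := fun x hx => by
    refine exists_int_abs_sub_lt (by norm_num) (hcos.trans ?_)
    by_contra! hc
    exact hx (hsupp x hc)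
  have key : ∀ x, circleCoord ((f : Equiv.Perm ℝ) x) - circleCoord x = τ * g x := by
    intro x
    by_cases hx : g x = 0
    · rw [hf, hx]; simp
    -- A zero of g is a fixed point of f, so by injectivity f maps no other point to it.
    · have hfx : g ((f : Equiv.Perm ℝ) x) ≠ 0 := by
        intro h0
        have h1 := hf ((f : Equiv.Perm ℝ) x)
        rw [h0, mul_zero, add_zero] at h1
        have h2 := hf x
        rw [(f : Equiv.Perm ℝ).injective h1] at h2
        have : τ * g x = 0 := by linarith
        exact hx ((mul_eq_zero.1 this).resolve_left hτ0.ne')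
      obtain ⟨m, hm⟩ := hnear _ hx
      obtain ⟨m', hm'⟩ := hnear _ hfx
      have hsmall : |τ * g x| ≤ 1 / 4 := by
        rw [abs_mul, abs_of_pos hτ0]
        have h1 : |g x| ≤ C := hb x
        nlinarith
      have hmm : m' = m := by
        have h1 := abs_lt.1 hm
        have h2 := abs_lt.1 hm'
        have h3 := abs_le.1 hsmall
        rw [hf] at h2
        have h4 : ((m' - m : ℤ) : ℝ) < 1 := by push_cast; linarith [h1.1, h1.2, h2.1, h2.2]
        have h5 : (-1 : ℝ) < ((m' - m : ℤ) : ℝ) := by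
          push_cast; linarith [h1.1, h1.2, h2.1, h2.2]
        have h6 : m' - m < 1 := by exact_mod_cast h4
        have h7 : -1 < m' - m := by exact_mod_cast h5
        omega
      rw [circleCoord_eq_sub hm'.le, circleCoord_eq_sub hm.le, hmm, hf]
      ring
  let c : SmoothFun 𝕜 := ofRealFun 𝕜 circleCoord contDiff_circleCoord circleCoord_periodic
  have e : pullback 0 f c - c = (τ : 𝕜) • ofRealFun 𝕜 g hg hp := by
    ext x
    change posPow _ 0 * ((circleCoord _ : ℝ) : 𝕜) - ((circleCoord x : ℝ) : 𝕜) =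
      (τ : 𝕜) * ((g x : ℝ) : 𝕜)
    rw [posPow_zero_right, one_mul, ← RCLike.ofReal_sub, key, RCLike.ofReal_mul]
  have h1 := congrArg k e
  rw [map_sub, hk, sub_self, map_smul, smul_eq_mul] at h1
  exact (mul_eq_zero.1 h1.symm).resolve_left (RCLike.ofReal_ne_zero.2 hτ0.ne')

lemma functional_eq_zero_of_weight_zero {k : SmoothFun 𝕜 →ₗ[𝕜] 𝕜}
    (hk : ∀ f φ, k (pullback 0 f φ) = k φ) : k = 0 := by
  refine functional_ext_of_real fun g hg hp => ?_
  rw [LinearMap.zero_apply]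
  -- The part χ g is already supported in the coordinate chart around 0, and (1 - χ) g is brought
  -- there by the half-turn.
  let χ := cosBump (1 / 4) (-1 / 4)
  have hχ : ContDiff ℝ ∞ χ := contDiff_cosBump _ _
  have hχp : Function.Periodic χ 1 := cosBump_periodic _ _
  have hp₁ : Function.Periodic (fun x => χ x * g x) 1 := fun x => by simp only [hχp x, hp x]
  have hp₂ : Function.Periodic (fun x => (1 - χ (x + 1 / 2)) * g (x + 1 / 2)) 1 := fun x => by
    simp only [show x + 1 + 1 / 2 = x + 1 / 2 + 1 by ring, hχp (x + 1 / 2), hp (x + 1 / 2)]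
  have hg₂ : ContDiff ℝ ∞ fun x => (1 - χ (x + 1 / 2)) * g (x + 1 / 2) :=
    (contDiff_const.sub (hχ.comp (contDiff_id.add contDiff_const))).mul
      (hg.comp (contDiff_id.add contDiff_const))
  have h1 := functional_apply_eq_zero_of_support hk (hχ.mul hg) hp₁
    (fun x hx => by simp only [χ]; rw [cosBump_eq_zero (by norm_num) hx, zero_mul])
  have h2 := functional_apply_eq_zero_of_support hk hg₂ hp₂
    (fun x hx => by
      simp only [χ]
      rw [cosBump_eq_one (by norm_num), sub_self, zero_mul]
      rw [mul_add, show 2 * Real.pi * (1 / 2) = Real.pi by ring, Real.cos_add_pi]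
      linarith)
  rw [← hk (translation (1 / 2))] at h2
  have e : ofRealFun 𝕜 g hg hp = ofRealFun 𝕜 _ (hχ.mul hg) hp₁ +
      pullback 0 (translation (1 / 2)) (ofRealFun 𝕜 _ hg₂ hp₂) := by
    ext x
    change ((g x : ℝ) : 𝕜) = ((χ x * g x : ℝ) : 𝕜) + _
    rw [pullback_translation, ofRealFun_apply, show x + 1 / 2 + 1 / 2 = x + 1 by ring, hχp, hp]
    push_cast
    ring
  rw [e, map_add, h1, h2, add_zero]

/-! ### Symmetries and matrices -/

section

variable (lam δ : 𝕜) (f : LiftDiff) (φ : SmoothFun 𝕜)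

lemma coeffPullback_single_zero : coeffPullback lam δ f (Pi.single 0 φ) =
    Pi.single 0 (pullback δ f φ) := by
  ext i : 1
  fin_cases i
  · simp [coeffPullback_zero]
  · simp [coeffPullback_one]
  · simp [coeffPullback_two]

lemma coeffPullback_single_one : coeffPullback lam δ f (Pi.single 1 φ) =
    Pi.single 1 (pullback (δ - 1) f φ) +
      Pi.single 0 (-(lam • (logDerivFun 𝕜 f * pullback (δ - 1) f φ))) := by
  ext i : 1
  fin_cases i
  · simp [coeffPullback_zero]
  · simp [coeffPullback_one]
  · simp [coeffPullback_two]

lemma exists_coeffPullback_single_two : ∃ φ₁ φ₀ : SmoothFun 𝕜,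
    coeffPullback lam δ f (Pi.single 2 φ) =
      Pi.single 2 (pullback (δ - 2) f φ) + Pi.single 1 φ₁ + Pi.single 0 φ₀ := by
  refine ⟨coeffPullback lam δ f (Pi.single 2 φ) 1, coeffPullback lam δ f (Pi.single 2 φ) 0, ?_⟩
  ext i : 1
  fin_cases i
  · simp
  · simp
  · simp [coeffPullback_two]

lemma pullback_zero_one : pullback 0 f (1 : SmoothFun 𝕜) = 1 := by
  ext x
  rw [pullback_apply, posPow_zero_right, one_mul]
  rfl

/-- The exterior derivative from functions to 1-densities is natural; this is the invariant operator
behind `integralOp`. -/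
lemma coeffPullback_one_single : coeffPullback 0 1 f (Pi.single 1 (1 : SmoothFun 𝕜)) =
    Pi.single 1 1 := by
  rw [coeffPullback_single_one, sub_self, pullback_zero_one]
  simp

end

lemma functional_ext_single {k k' : (Fin 3 → SmoothFun 𝕜) →ₗ[𝕜] 𝕜}
    (h : ∀ i φ, k (Pi.single i φ) = k' (Pi.single i φ)) : k = k' := by
  ext i φ
  exact h i φ

/-- The components have weights 0, -1, -2, and none of these carries an invariant functional. As the
action is triangular, k is shown to vanish on a₀, then on a₁, then on a₂. -/
lemma eq_matrixOp_of_weight_zero {lam : 𝕜} {T : Module.End 𝕜 (Fin 3 → SmoothFun 𝕜)}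
    (hT : T ∈ coeffSymmetryAlgebra lam 0) : ∃ M, T = matrixOp M := by
  obtain ⟨M, k, rfl⟩ := exists_eq_of_weight_zero hT
  have hk := functional_coeffPullback_eq (fun f => by
    rw [coeffPullback_single_zero, pullback_zero_one]) hT
  have h0 : ∀ φ, k (Pi.single 0 φ) = 0 := fun φ =>
    LinearMap.congr_fun (functional_eq_zero_of_weight_zero
      (k := k ∘ₗ LinearMap.single 𝕜 (fun _ => SmoothFun 𝕜) 0) fun f φ => by
        have := hk f (Pi.single 0 φ)
        rwa [coeffPullback_single_zero] at this) φ
  have h1 : ∀ φ, k (Pi.single 1 φ) = 0 := fun φ =>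
    LinearMap.congr_fun (functional_eq_zero_of_neg (σ := -1) (by norm_num)
      (k := k ∘ₗ LinearMap.single 𝕜 (fun _ => SmoothFun 𝕜) 1) fun f φ => by
        have := hk f (Pi.single 1 φ)
        rw [coeffPullback_single_one, map_add, h0, add_zero, zero_sub] at this
        rw [RCLike.ofReal_neg, RCLike.ofReal_one]
        exact this) φ
  have h2 : ∀ φ, k (Pi.single 2 φ) = 0 := fun φ =>
    LinearMap.congr_fun (functional_eq_zero_of_neg (σ := -2) (by norm_num)
      (k := k ∘ₗ LinearMap.single 𝕜 (fun _ => SmoothFun 𝕜) 2) fun f φ => by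
        have := hk f (Pi.single 2 φ)
        obtain ⟨φ₁, φ₀, h⟩ := exists_coeffPullback_single_two lam 0 f φ
        rw [h, map_add, map_add, h0, h1, add_zero, add_zero, zero_sub] at this
        rw [RCLike.ofReal_neg, RCLike.ofReal_ofNat]
        exact this) φ
  have hk0 : k = 0 := functional_ext_single fun i φ => by
    fin_cases i
    exacts [h0 φ, h1 φ, h2 φ]
  refine ⟨M, LinearMap.ext fun a => ?_⟩
  simp [hk0, rankOne_apply]

/-- The symmetry `A ↦ (∫ a₀) d/dx` of the operators `𝓕_0 → 𝓕_1`. -/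
noncomputable def integralOp (𝕜 : Type*) [RCLike 𝕜] : Module.End 𝕜 (Fin 3 → SmoothFun 𝕜) :=
  rankOne (circleIntegral ∘ₗ LinearMap.proj 0) 1

lemma integralOp_apply (a : Fin 3 → SmoothFun 𝕜) :
    integralOp 𝕜 a = circleIntegral (a 0) • Pi.single 1 1 := rfl

lemma integralOp_mem : integralOp 𝕜 ∈ coeffSymmetryAlgebra (0 : 𝕜) 1 := by
  rw [mem_coeffSymmetryAlgebra]
  intro f a
  rw [integralOp_apply, integralOp_apply, map_smul, coeffPullback_one_single, coeffPullback_zero,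
    zero_smul, zero_smul, sub_zero, sub_zero, circleIntegral_pullback]

/-- The weights are now 1, 0, -1, and only the component a₀ of weight 1 carries an invariant
functional, the integral. -/
lemma exists_eq_matrixOp_add_integralOp {T : Module.End 𝕜 (Fin 3 → SmoothFun 𝕜)}
    (hT : T ∈ coeffSymmetryAlgebra (0 : 𝕜) 1) :
    ∃ M, ∃ c : 𝕜, T = matrixOp M + c • integralOp 𝕜 := by
  obtain ⟨M, k, rfl⟩ := exists_eq_of_weight_one hT
  have hk := functional_coeffPullback_eq (fun f => coeffPullback_one_single f) hT
  have h0 : ∀ φ, k (Pi.single 0 φ) = k (Pi.single 0 1) * circleIntegral φ := fun φ =>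
    LinearMap.congr_fun (functional_eq_smul_circleIntegral
      (k := k ∘ₗ LinearMap.single 𝕜 (fun _ => SmoothFun 𝕜) 0) fun f φ => by
        have := hk f (Pi.single 0 φ)
        rwa [coeffPullback_single_zero] at this) φ
  have h1 : ∀ φ, k (Pi.single 1 φ) = 0 := fun φ =>
    LinearMap.congr_fun (functional_eq_zero_of_weight_zero
      (k := k ∘ₗ LinearMap.single 𝕜 (fun _ => SmoothFun 𝕜) 1) fun f φ => by
        have := hk f (Pi.single 1 φ)
        rwa [coeffPullback_single_one, zero_smul, neg_zero, Pi.single_zero, add_zero,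
          sub_self] at this) φ
  have h2 : ∀ φ, k (Pi.single 2 φ) = 0 := fun φ =>
    LinearMap.congr_fun (functional_eq_zero_of_neg (σ := -1) (by norm_num)
      (k := k ∘ₗ LinearMap.single 𝕜 (fun _ => SmoothFun 𝕜) 2) fun f φ => by
        have := hk f (Pi.single 2 φ)
        have h : coeffPullback 0 1 f (Pi.single 2 φ) = Pi.single 2 (pullback (1 - 2) f φ) +
            Pi.single 1 (coeffPullback 0 1 f (Pi.single 2 φ) 1) := by
          ext i : 1
          fin_cases i
          · simp [coeffPullback_zero]
          · simp
          · simp [coeffPullback_two]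
        rw [h, map_add, h1, add_zero, show (1 - 2 : 𝕜) = -1 by norm_num] at this
        rw [RCLike.ofReal_neg, RCLike.ofReal_one]
        exact this) φ
  have hk0 : k = k (Pi.single 0 1) • (circleIntegral ∘ₗ LinearMap.proj 0) :=
    functional_ext_single fun i φ => by
      rw [LinearMap.smul_apply, LinearMap.comp_apply, LinearMap.proj_apply, smul_eq_mul]
      fin_cases i
      · exact h0 φ
      · refine (h1 φ).trans ?_
        simp
      · refine (h2 φ).trans ?_
        simp
  refine ⟨M, k (Pi.single 0 1), LinearMap.ext fun a => ?_⟩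
  rw [LinearMap.add_apply, LinearMap.add_apply, rankOne_apply, LinearMap.smul_apply,
    integralOp_apply, smul_smul]
  nth_rewrite 1 [hk0]
  rfl

lemma exists_smoothFun_jet (u v w : 𝕜) : ∃ φ : SmoothFun 𝕜, (φ : ℝ → 𝕜) 0 = u ∧
    (ddx φ : ℝ → 𝕜) 0 = v ∧ (ddx (ddx φ) : ℝ → 𝕜) 0 = w := by
  have hx : ContDiff ℝ ∞ fun x : ℝ => u + v * (x : 𝕜) + w / 2 * ((x : 𝕜) * (x : 𝕜)) :=
    (contDiff_const.add (contDiff_const.mul contDiff_ofReal)).add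
      (contDiff_const.mul (contDiff_ofReal.mul contDiff_ofReal))
  have hd : ∀ x : ℝ, HasDerivAt (fun x : ℝ => (x : 𝕜)) 1 x := fun x => by
    have := (RCLike.ofRealCLM (K := 𝕜)).hasFDerivAt.comp_hasDerivAt x (hasDerivAt_id x)
    rwa [RCLike.ofRealCLM_apply, RCLike.ofReal_one] at this
  have h1 : deriv (fun x : ℝ => u + v * (x : 𝕜) + w / 2 * ((x : 𝕜) * (x : 𝕜))) =
      fun x : ℝ => v + w * (x : 𝕜) := by
    ext x
    refine ((((hd x).const_mul v).const_add u).add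
      (((hd x).mul (hd x)).const_mul (w / 2))).deriv.trans ?_
    ring
  have h2 : deriv (fun x : ℝ => v + w * (x : 𝕜)) = fun _ => w := by
    ext x
    refine (((hd x).const_mul w).const_add v).deriv.trans ?_
    ring
  obtain ⟨φ, hφ⟩ := exists_smoothFun_eventuallyEq hx
  have e1 := ddx_eventuallyEq hφ
  rw [h1] at e1
  have e2 := ddx_eventuallyEq e1
  rw [h2] at e2
  refine ⟨φ, ?_, ?_, e2.self_of_nhds⟩
  · rw [hφ.self_of_nhds]; simp
  · rw [e1.self_of_nhds]; simp

section

variable (M : Matrix (Fin 3) (Fin 3) 𝕜) (a : Fin 3 → SmoothFun 𝕜)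

lemma matrixOp_apply_zero : matrixOp M a 0 =
    M 0 0 • a 0 + M 0 1 • ddx (a 1) + M 0 2 • ddx (ddx (a 2)) := by
  rw [matrixOp_apply, Fin.sum_univ_three]
  simp [ddxInt, pow_two]

lemma matrixOp_apply_one : matrixOp M a 1 = M 1 1 • a 1 + M 1 2 • ddx (a 2) := by
  rw [matrixOp_apply, Fin.sum_univ_three]
  simp [ddxInt]

lemma matrixOp_apply_two : matrixOp M a 2 = M 2 2 • a 2 := by
  rw [matrixOp_apply, Fin.sum_univ_three]
  simp [ddxInt]

end

lemma coeffEnd_ext {S T : Module.End 𝕜 (Fin 3 → SmoothFun 𝕜)} (h0 : ∀ a, S a 0 = T a 0)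
    (h1 : ∀ a, S a 1 = T a 1) (h2 : ∀ a, S a 2 = T a 2) : S = T := by
  refine LinearMap.ext fun a => funext fun j => ?_
  fin_cases j
  exacts [h0 a, h1 a, h2 a]

/-- Upper triangular `3 × 3` matrices with the given entries. -/
def upperMatrix (p q s α β γ : 𝕜) : Matrix (Fin 3) (Fin 3) 𝕜 := !![s, β, γ; 0, q, α; 0, 0, p]

/-- Entries below the diagonal multiply derivatives of negative order, which `ddxInt` sets to 0. -/
lemma matrixOp_eq_upperMatrix (M : Matrix (Fin 3) (Fin 3) 𝕜) : matrixOp M =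
    matrixOp (upperMatrix (M 2 2) (M 1 1) (M 0 0) (M 1 2) (M 0 1) (M 0 2)) := by
  refine coeffEnd_ext (fun a => ?_) (fun a => ?_) fun a => ?_
  · rw [matrixOp_apply_zero, matrixOp_apply_zero]; rfl
  · rw [matrixOp_apply_one, matrixOp_apply_one]; rfl
  · rw [matrixOp_apply_two, matrixOp_apply_two]; rfl

lemma matrixOp_upperMatrix_mul (p q s α β γ p' q' s' α' β' γ' : 𝕜) :
    matrixOp (upperMatrix p q s α β γ) * matrixOp (upperMatrix p' q' s' α' β' γ') =
      matrixOp (upperMatrix (p * p') (q * q') (s * s') (q * α' + α * p') (s * β' + β * q')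
        (s * γ' + β * α' + γ * p')) := by
  refine coeffEnd_ext (fun a => ?_) (fun a => ?_) fun a => ?_
  · rw [Module.End.mul_apply, matrixOp_apply_zero, matrixOp_apply_zero, matrixOp_apply_zero,
      matrixOp_apply_one, matrixOp_apply_two]
    simp only [upperMatrix, Matrix.of_apply, Matrix.cons_val, map_add, map_smul]
    module
  · rw [Module.End.mul_apply, matrixOp_apply_one, matrixOp_apply_one, matrixOp_apply_one,
      matrixOp_apply_two]
    simp only [upperMatrix, Matrix.of_apply, Matrix.cons_val, map_smul]
    module
  · rw [Module.End.mul_apply, matrixOp_apply_two, matrixOp_apply_two, matrixOp_apply_two]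
    simp only [upperMatrix, Matrix.of_apply, Matrix.cons_val]
    module

lemma matrixOp_add (M N : Matrix (Fin 3) (Fin 3) 𝕜) : matrixOp (M + N) =
    matrixOp M + matrixOp N := by
  refine LinearMap.ext fun a => funext fun j => ?_
  rw [LinearMap.add_apply, Pi.add_apply, matrixOp_apply, matrixOp_apply, matrixOp_apply,
    ← Finset.sum_add_distrib]
  exact Finset.sum_congr rfl fun i _ => by rw [Matrix.add_apply, add_smul]

lemma matrixOp_scalar (c : 𝕜) : matrixOp (upperMatrix c c c 0 0 0) =
    algebraMap 𝕜 (Module.End 𝕜 (Fin 3 → SmoothFun 𝕜)) c := by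
  refine coeffEnd_ext (fun a => ?_) (fun a => ?_) fun a => ?_
  · rw [matrixOp_apply_zero, Module.algebraMap_end_apply]
    simp [upperMatrix]
  · rw [matrixOp_apply_one, Module.algebraMap_end_apply]
    simp [upperMatrix]
  · rw [matrixOp_apply_two, Module.algebraMap_end_apply]
    simp [upperMatrix]

lemma eq_zero_of_smul_one_eq_zero {c : 𝕜} (h : c • (1 : SmoothFun 𝕜) = 0) : c = 0 := by
  have := congrFun (congrArg Subtype.val h) 0
  simpa using this

/-- The entries of a matrix on and above the diagonal, and the coefficient of the integral
operator, are determined by the operator. -/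
lemma eq_zero_of_matrixOp_add_eq_zero {p q s α β γ c : 𝕜}
    (h : matrixOp (upperMatrix p q s α β γ) + c • integralOp 𝕜 = 0) :
    p = 0 ∧ q = 0 ∧ s = 0 ∧ α = 0 ∧ β = 0 ∧ γ = 0 ∧ c = 0 := by
  have h0 : ∀ a : Fin 3 → SmoothFun 𝕜,
      s • a 0 + β • ddx (a 1) + γ • ddx (ddx (a 2)) = 0 := fun a => by
    have := congrFun (LinearMap.congr_fun h a) 0
    rw [LinearMap.add_apply, Pi.add_apply, matrixOp_apply_zero, LinearMap.smul_apply,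
      integralOp_apply] at this
    simpa [upperMatrix] using this
  have h1 : ∀ a : Fin 3 → SmoothFun 𝕜,
      q • a 1 + α • ddx (a 2) + (c * circleIntegral (a 0)) • 1 = 0 := fun a => by
    have := congrFun (LinearMap.congr_fun h a) 1
    rw [LinearMap.add_apply, Pi.add_apply, matrixOp_apply_one, LinearMap.smul_apply,
      integralOp_apply, smul_smul, Pi.smul_apply, Pi.single_eq_same] at this
    simpa [upperMatrix] using this
  have h2 : ∀ a : Fin 3 → SmoothFun 𝕜, p • a 2 = 0 := fun a => by
    have := congrFun (LinearMap.congr_fun h a) 2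
    rw [LinearMap.add_apply, Pi.add_apply, matrixOp_apply_two, LinearMap.smul_apply,
      integralOp_apply] at this
    simpa [upperMatrix] using this
  obtain ⟨φ, hφ0, hφ1, hφ2⟩ := exists_smoothFun_jet (𝕜 := 𝕜) 0 1 0
  obtain ⟨ψ, hψ0, hψ1, hψ2⟩ := exists_smoothFun_jet (𝕜 := 𝕜) 0 0 1
  refine ⟨eq_zero_of_smul_one_eq_zero (h2 ![0, 0, 1]), ?_, ?_, ?_, ?_, ?_, ?_⟩
  · have := h1 ![0, 1, 0]
    exact eq_zero_of_smul_one_eq_zero (by simpa using this)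
  · have := h0 ![1, 0, 0]
    exact eq_zero_of_smul_one_eq_zero (by simpa using this)
  · have := congrArg (evalAt 0) (h1 ![0, 0, φ])
    simpa [evalAt_apply, hφ1] using this
  · have := congrArg (evalAt 0) (h0 ![0, φ, 0])
    simpa [evalAt_apply, hφ1] using this
  · have := congrArg (evalAt 0) (h0 ![0, 0, ψ])
    simpa [evalAt_apply, hψ2] using this
  · have := h1 ![1, 0, 0]
    refine eq_zero_of_smul_one_eq_zero ?_
    simpa [circleIntegral_one] using this

/-! ### The defect of commutation between a matrix and the action -/

section commutation

variable (lam δ p q s α β γ : 𝕜) (f : LiftDiff) (a : Fin 3 → SmoothFun 𝕜)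

lemma coeffPullback_matrixOp_one :
    coeffPullback lam δ f (matrixOp (upperMatrix p q s α β γ) a) 1 =
      matrixOp (upperMatrix p q s α β γ) (coeffPullback lam δ f a) 1 -
        ((2 * lam + 1) * (p - q) + (δ - 2) * α) •
          (logDerivFun 𝕜 f * pullback (δ - 2) f (a 2)) := by
  rw [coeffPullback_one, matrixOp_apply_one, matrixOp_apply_one, matrixOp_apply_two,
    coeffPullback_one, coeffPullback_two, ddx_pullback, show δ - 2 + 1 = δ - 1 by ring]
  simp only [upperMatrix, Matrix.of_apply, Matrix.cons_val, map_add, map_smul]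
  simp only [Algebra.smul_def, map_add, map_sub, map_mul]
  ring

lemma coeffPullback_matrixOp_zero :
    coeffPullback lam δ f (matrixOp (upperMatrix p q s α β γ) a) 0 =
      matrixOp (upperMatrix p q s α β γ) (coeffPullback lam δ f a) 0 -
        (lam * (q - s) + (δ - 1) * β) • (logDerivFun 𝕜 f * pullback (δ - 1) f (a 1)) -
        (-(2 * lam + 1) * β + (2 * δ - 3) * γ + lam * α) •
          (logDerivFun 𝕜 f * pullback (δ - 1) f (ddx (a 2))) -
        (lam * (p - s) - (2 * lam + 1) * β + (δ - 2) * γ) •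
          (ddx (logDerivFun 𝕜 f) * pullback (δ - 2) f (a 2)) -
        (lam * (lam + 1) * (s - p) - (2 * lam + 1) * (δ - 2) * β + (δ - 2) ^ 2 * γ) •
          (logDerivFun 𝕜 f * logDerivFun 𝕜 f * pullback (δ - 2) f (a 2)) := by
  rw [coeffPullback_zero, matrixOp_apply_zero, matrixOp_apply_zero, matrixOp_apply_one,
    matrixOp_apply_two, coeffPullback_zero, coeffPullback_one, coeffPullback_two]
  simp only [upperMatrix, Matrix.of_apply, Matrix.cons_val, map_add, map_sub, map_smul, ddx_mul,
    ddx_pullback, show δ - 2 + 1 = δ - 1 by ring, show δ - 1 + 1 = δ by ring]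
  simp only [Algebra.smul_def, map_add, map_sub, map_mul, map_neg, map_one, map_ofNat, map_pow]
  ring

end commutation

/-- The linear equations that describe the matrices of symmetries. -/
def IsSymmetryEntries (lam δ p q s α β γ : 𝕜) : Prop :=
  (2 * lam + 1) * (p - q) + (δ - 2) * α = 0 ∧
  lam * (q - s) + (δ - 1) * β = 0 ∧
  -(2 * lam + 1) * β + (2 * δ - 3) * γ + lam * α = 0 ∧
  lam * (p - s) - (2 * lam + 1) * β + (δ - 2) * γ = 0

/-- The combination eliminates q, α, β, γ. With lam + δ = mu it forces p = s unless lam = 0 or mu =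
1. -/
lemma IsSymmetryEntries.mul_sub_eq_zero {lam δ p q s α β γ : 𝕜}
    (h : IsSymmetryEntries lam δ p q s α β γ) : lam * (lam + δ - 1) * (p - s) = 0 := by
  obtain ⟨h1, h2, h3, h4⟩ := h
  linear_combination (1 / 2) * ((2 * lam + 1) * h2 + lam * h1 - (δ - 2) * h3 + (2 * δ - 3) * h4)

lemma exists_liftDiff_ne_zero (n : ℕ) : ∃ τ : ℝ, τ ≠ 0 ∧ ∃ f : LiftDiff,
    (f : Equiv.Perm ℝ) =ᶠ[𝓝 0] fun x => x + τ * x ^ n := by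
  obtain ⟨t, ht, h⟩ := exists_liftDiff_local (B := 0) one_pos n
  obtain ⟨f, hf, -⟩ := h (t / 2) (by rw [abs_of_pos (by positivity)]; linarith)
  exact ⟨t / 2, by positivity, f, hf⟩

/-- Each equation is isolated at 0 by a test triple and a jet. A quadratic jet with a₂ = 1 and with
a₁ = 1 gives the first two, and with a₂ of value 0 and derivative 1 the third. A cubic jet, where
ℓ(0) = 0 but ℓ'(0) ≠ 0, with a₂ = 1 gives the fourth. -/
lemma isSymmetryEntries_of_mem {lam δ p q s α β γ : 𝕜}
    (h : matrixOp (upperMatrix p q s α β γ) ∈ coeffSymmetryAlgebra lam δ) :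
    IsSymmetryEntries lam δ p q s α β γ := by
  rw [mem_coeffSymmetryAlgebra] at h
  obtain ⟨τ, hτ, f, hf⟩ := exists_liftDiff_ne_zero 2
  obtain ⟨σ, hσ, g, hg⟩ := exists_liftDiff_ne_zero 3
  obtain ⟨φ, hφ0, hφ1, -⟩ := exists_smoothFun_jet (𝕜 := 𝕜) 0 1 0
  have hτ' : (2 * (τ : 𝕜)) ≠ 0 := by simp [hτ]
  have hσ' : (6 * (σ : 𝕜)) ≠ 0 := by simp [hσ]
  have hone : ((1 : SmoothFun 𝕜) : ℝ → 𝕜) 0 = 1 := rfl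
  refine ⟨?_, ?_, ?_, ?_⟩
  · have h1 := coeffPullback_matrixOp_one lam δ p q s α β γ f ![0, 0, 1]
    rw [h, eq_comm, sub_eq_self] at h1
    have h2 := congrFun (congrArg Subtype.val h1) 0
    change _ * ((logDerivFun 𝕜 f : ℝ → 𝕜) 0 * (pullback (δ - 2) f 1 : ℝ → 𝕜) 0) = 0 at h2
    rw [pullback_apply_zero_of_eventuallyEq le_rfl hf, logDerivFun_zero_of_quadratic hf, hone,
      mul_one] at h2
    exact (mul_eq_zero.1 h2).resolve_right hτ'
  · have h1 := coeffPullback_matrixOp_zero lam δ p q s α β γ f ![0, 1, 0]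
    rw [h] at h1
    simp only [Matrix.cons_val, map_zero, mul_zero, smul_zero, sub_zero] at h1
    rw [eq_comm, sub_eq_self] at h1
    have h2 := congrFun (congrArg Subtype.val h1) 0
    change _ * ((logDerivFun 𝕜 f : ℝ → 𝕜) 0 * (pullback (δ - 1) f 1 : ℝ → 𝕜) 0) = 0 at h2
    rw [pullback_apply_zero_of_eventuallyEq le_rfl hf, logDerivFun_zero_of_quadratic hf, hone,
      mul_one] at h2
    exact (mul_eq_zero.1 h2).resolve_right hτ'
  · have h1 := coeffPullback_matrixOp_zero lam δ p q s α β γ f ![0, 0, φ]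
    rw [h] at h1
    simp only [Matrix.cons_val, map_zero, mul_zero, smul_zero, sub_zero] at h1
    have h2 := congrArg (evalAt 0) h1
    simp only [map_sub, map_smul, smul_eq_mul] at h2
    have h3 : evalAt 0 (logDerivFun 𝕜 f * pullback (δ - 1) f (ddx φ)) = 2 * (τ : 𝕜) := by
      change (logDerivFun 𝕜 f : ℝ → 𝕜) 0 * (pullback (δ - 1) f (ddx φ) : ℝ → 𝕜) 0 = _
      rw [pullback_apply_zero_of_eventuallyEq le_rfl hf, logDerivFun_zero_of_quadratic hf, hφ1,
        mul_one]
    have h4 : ∀ χ : SmoothFun 𝕜, evalAt 0 (χ * pullback (δ - 2) f φ) = 0 := fun χ => by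
      change (χ : ℝ → 𝕜) 0 * (pullback (δ - 2) f φ : ℝ → 𝕜) 0 = _
      rw [pullback_apply_zero_of_eventuallyEq le_rfl hf, hφ0, mul_zero]
    rw [h3, h4, h4, mul_zero, mul_zero, sub_zero, sub_zero, eq_comm, sub_eq_self] at h2
    exact (mul_eq_zero.1 h2).resolve_right hτ'
  · have h1 := coeffPullback_matrixOp_zero lam δ p q s α β γ g ![0, 0, 1]
    rw [h] at h1
    simp only [Matrix.cons_val, map_zero, mul_zero, smul_zero, sub_zero] at h1
    have h2 := congrArg (evalAt 0) h1
    simp only [map_sub, map_smul, smul_eq_mul] at h2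
    have h3 : ∀ χ : SmoothFun 𝕜, evalAt 0 (logDerivFun 𝕜 g * χ) = 0 := fun χ => by
      change (logDerivFun 𝕜 g : ℝ → 𝕜) 0 * (χ : ℝ → 𝕜) 0 = 0
      rw [logDerivFun_zero_of_cubic hg, zero_mul]
    have h4 : evalAt 0 (ddx (logDerivFun 𝕜 g) * pullback (δ - 2) g 1) = 6 * (σ : 𝕜) := by
      change (ddx (logDerivFun 𝕜 g) : ℝ → 𝕜) 0 * (pullback (δ - 2) g 1 : ℝ → 𝕜) 0 = _
      rw [pullback_apply_zero_of_eventuallyEq (by norm_num) hg, ddx_logDerivFun_zero_of_cubic hg,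
        hone, mul_one]
    rw [mul_assoc (logDerivFun 𝕜 g), h3, h3, h4, mul_zero, mul_zero, sub_zero, sub_zero, eq_comm,
      sub_eq_self] at h2
    exact (mul_eq_zero.1 h2).resolve_right hσ'

lemma IsSymmetryEntries.matrixOp_mem {lam δ p q s α β γ : 𝕜}
    (hE : IsSymmetryEntries lam δ p q s α β γ) :
    matrixOp (upperMatrix p q s α β γ) ∈ coeffSymmetryAlgebra lam δ := by
  have h5 := hE.mul_sub_eq_zero
  obtain ⟨h1, h2, h3, h4⟩ := hE
  -- The coefficient of ℓ² imposes no new condition.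
  have h6 : lam * (lam + 1) * (s - p) - (2 * lam + 1) * (δ - 2) * β + (δ - 2) ^ 2 * γ = 0 := by
    linear_combination (δ - 2) * h4 - h5
  have hcomm : ∀ f, coeffPullback lam δ f * matrixOp (upperMatrix p q s α β γ) =
      matrixOp (upperMatrix p q s α β γ) * coeffPullback lam δ f := fun f => by
    refine coeffEnd_ext (fun a => ?_) (fun a => ?_) fun a => ?_
    · rw [Module.End.mul_apply, Module.End.mul_apply, coeffPullback_matrixOp_zero, h2, h3, h4, h6,
        zero_smul, zero_smul, zero_smul, zero_smul, sub_zero, sub_zero, sub_zero, sub_zero]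
    · rw [Module.End.mul_apply, Module.End.mul_apply, coeffPullback_matrixOp_one, h1, zero_smul,
        sub_zero]
    · rw [Module.End.mul_apply, Module.End.mul_apply, coeffPullback_two, matrixOp_apply_two,
        matrixOp_apply_two, map_smul, coeffPullback_two]
  exact mem_coeffSymmetryAlgebra.2 fun f a => LinearMap.congr_fun (hcomm f) a

/-! ### The algebras of symmetries -/

/-- The third equation minus twice the fourth has γ with coefficient (2δ - 3) - 2(δ - 2) = 1, so γ
is determined for all weights without division. -/
lemma isSymmetryEntries_iff {lam δ p q s α β γ : 𝕜} : IsSymmetryEntries lam δ p q s α β γ ↔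
    ((2 * lam + 1) * (p - q) + (δ - 2) * α = 0 ∧ lam * (q - s) + (δ - 1) * β = 0 ∧
      lam * (lam + δ - 1) * (p - s) = 0) ∧
    γ = -(2 * lam + 1) * β - lam * α + 2 * lam * (p - s) := by
  constructor
  · intro h
    have h5 := h.mul_sub_eq_zero
    obtain ⟨h1, h2, h3, h4⟩ := h
    exact ⟨⟨h1, h2, h5⟩, by linear_combination h3 - 2 * h4⟩
  · rintro ⟨⟨h1, h2, h3⟩, rfl⟩
    refine ⟨h1, h2, ?_, ?_⟩
    · linear_combination (-2 * lam) * h1 - 2 * (2 * lam + 1) * h2 + 4 * h3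
    · linear_combination (-lam) * h1 - (2 * lam + 1) * h2 + 2 * h3

lemma upperMatrix_add (p q s α β γ p' q' s' α' β' γ' : 𝕜) :
    upperMatrix p q s α β γ + upperMatrix p' q' s' α' β' γ' =
      upperMatrix (p + p') (q + q') (s + s') (α + α') (β + β') (γ + γ') := by
  ext i j
  fin_cases i <;> fin_cases j <;> simp [upperMatrix]

lemma matrixOp_upperMatrix_smul (c p q s α β γ : 𝕜) :
    matrixOp (upperMatrix (c * p) (c * q) (c * s) (c * α) (c * β) (c * γ)) =
      c • matrixOp (upperMatrix p q s α β γ) := by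
  refine coeffEnd_ext (fun a => ?_) (fun a => ?_) fun a => ?_
  · rw [LinearMap.smul_apply, Pi.smul_apply, matrixOp_apply_zero, matrixOp_apply_zero]
    simp only [upperMatrix, Matrix.of_apply, Matrix.cons_val]
    module
  · rw [LinearMap.smul_apply, Pi.smul_apply, matrixOp_apply_one, matrixOp_apply_one]
    simp only [upperMatrix, Matrix.of_apply, Matrix.cons_val]
    module
  · rw [LinearMap.smul_apply, Pi.smul_apply, matrixOp_apply_two, matrixOp_apply_two]
    simp only [upperMatrix, Matrix.of_apply, Matrix.cons_val]
    module

lemma matrixOp_mul_integralOp (p q s α β γ : 𝕜) :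
    matrixOp (upperMatrix p q s α β γ) * integralOp 𝕜 = q • integralOp 𝕜 := by
  refine coeffEnd_ext (fun a => ?_) (fun a => ?_) fun a => ?_
  · rw [Module.End.mul_apply, matrixOp_apply_zero, LinearMap.smul_apply, integralOp_apply]
    simp [ddx_one]
  · rw [Module.End.mul_apply, matrixOp_apply_one, LinearMap.smul_apply, integralOp_apply]
    simp [upperMatrix]
  · rw [Module.End.mul_apply, matrixOp_apply_two, LinearMap.smul_apply, integralOp_apply]
    simp

/-- Integrals of derivatives vanish, so the integral sees only the diagonal entry acting on a₀. -/
lemma integralOp_mul_matrixOp (p q s α β γ : 𝕜) :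
    integralOp 𝕜 * matrixOp (upperMatrix p q s α β γ) = s • integralOp 𝕜 := by
  refine LinearMap.ext fun a => ?_
  rw [Module.End.mul_apply, integralOp_apply, matrixOp_apply_zero, LinearMap.smul_apply,
    integralOp_apply, map_add, map_add, map_smul, map_smul, map_smul, circleIntegral_ddx,
    circleIntegral_ddx, smul_zero, smul_zero, add_zero, add_zero, smul_smul]
  rfl

lemma integralOp_mul_self : integralOp 𝕜 * integralOp 𝕜 = 0 := by
  refine LinearMap.ext fun a => ?_
  rw [Module.End.mul_apply, integralOp_apply, integralOp_apply]
  simp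

/-- The symmetry of coefficients with the given diagonal, first superdiagonal and integral part. -/
noncomputable def entriesOp (lam p q s α β κ : 𝕜) : Module.End 𝕜 (Fin 3 → SmoothFun 𝕜) :=
  matrixOp (upperMatrix p q s α β (-(2 * lam + 1) * β - lam * α + 2 * lam * (p - s))) +
    κ • integralOp 𝕜

/-- The equations satisfied by the entries of a symmetry. -/
def EntryEquations (lam mu p q s α β : 𝕜) : Prop :=
  (2 * lam + 1) * (p - q) + (mu - lam - 2) * α = 0 ∧
  lam * (q - s) + (mu - lam - 1) * β = 0 ∧
  lam * (mu - 1) * (p - s) = 0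

lemma entryEquations_iff {lam mu p q s α β γ : 𝕜} :
    IsSymmetryEntries lam (mu - lam) p q s α β γ ↔ EntryEquations lam mu p q s α β ∧
      γ = -(2 * lam + 1) * β - lam * α + 2 * lam * (p - s) := by
  rw [isSymmetryEntries_iff, EntryEquations, add_sub_cancel]

/-- Symmetries are exactly the operators whose entries solve the linear equations. -/
lemma mem_coeffSymmetryAlgebra_iff {lam mu : 𝕜} {T : Module.End 𝕜 (Fin 3 → SmoothFun 𝕜)} :
    T ∈ coeffSymmetryAlgebra lam (mu - lam) ↔ ∃ p q s α β κ : 𝕜,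
      EntryEquations lam mu p q s α β ∧ (κ = 0 ∨ lam = 0 ∧ mu = 1) ∧
      T = entriesOp lam p q s α β κ := by
  have hκmem : ∀ κ : 𝕜, (κ = 0 ∨ lam = 0 ∧ mu = 1) →
      κ • integralOp 𝕜 ∈ coeffSymmetryAlgebra lam (mu - lam) := by
    rintro κ (rfl | ⟨rfl, rfl⟩)
    · rw [zero_smul]; exact Subalgebra.zero_mem _
    · rw [sub_zero]; exact Subalgebra.smul_mem _ integralOp_mem κ
  constructor
  · intro hT
    obtain ⟨M, κ, hκ, rfl⟩ : ∃ M, ∃ κ : 𝕜, (κ = 0 ∨ lam = 0 ∧ mu = 1) ∧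
        T = matrixOp M + κ • integralOp 𝕜 := by
      by_cases h0 : mu - lam = 0
      · rw [h0] at hT
        obtain ⟨M, rfl⟩ := eq_matrixOp_of_weight_zero hT
        exact ⟨M, 0, Or.inl rfl, by rw [zero_smul, add_zero]⟩
      · by_cases h1 : lam = 0 ∧ mu = 1
        · obtain ⟨rfl, rfl⟩ := h1
          rw [sub_zero] at hT
          obtain ⟨M, c, rfl⟩ := exists_eq_matrixOp_add_integralOp hT
          exact ⟨M, c, Or.inr ⟨rfl, rfl⟩, rfl⟩
        · obtain ⟨M, rfl⟩ := exists_eq_matrixOp hT h0 (by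
            by_contra! h
            exact h1 ⟨h.1, by linear_combination h.2 + h.1⟩)
          exact ⟨M, 0, Or.inl rfl, by rw [zero_smul, add_zero]⟩
    -- Removing the integral part, itself a symmetry, leaves a matrix that is a symmetry on its own.
    have hM := (coeffSymmetryAlgebra lam (mu - lam)).add_mem hT
      (hκmem (-κ) (hκ.imp_left fun h => by rw [h, neg_zero]))
    rw [add_assoc, ← add_smul, add_neg_cancel, zero_smul, add_zero, matrixOp_eq_upperMatrix] at hM
    obtain ⟨h1, h2⟩ := entryEquations_iff.1 (isSymmetryEntries_of_mem hM)
    refine ⟨_, _, _, _, _, κ, h1, hκ, ?_⟩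
    rw [matrixOp_eq_upperMatrix, entriesOp, h2]
  · rintro ⟨p, q, s, α, β, κ, h, hκ, rfl⟩
    exact Subalgebra.add_mem _ (entryEquations_iff.2 ⟨h, rfl⟩).matrixOp_mem (hκmem κ hκ)

lemma entriesOp_mul {lam mu p q s α β κ p' q' s' α' β' κ' : 𝕜}
    (h : EntryEquations lam mu p q s α β) (h' : EntryEquations lam mu p' q' s' α' β') :
    entriesOp lam p q s α β κ * entriesOp lam p' q' s' α' β' κ' =
      entriesOp lam (p * p') (q * q') (s * s') (q * α' + α * p') (s * β' + β * q')
        (q * κ' + κ * s') := by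
  -- The corner entry of the product need not be compared by hand: the product is a symmetry, so its
  -- corner is forced by the other entries.
  have h1 := Subalgebra.mul_mem _ (entryEquations_iff.2 ⟨h, rfl⟩).matrixOp_mem
    (entryEquations_iff.2 ⟨h', rfl⟩).matrixOp_mem
  rw [matrixOp_upperMatrix_mul] at h1
  have h2 := (entryEquations_iff.1 (isSymmetryEntries_of_mem h1)).2
  rw [entriesOp, entriesOp, entriesOp, add_mul, mul_add, mul_add, matrixOp_upperMatrix_mul, h2,
    mul_smul_comm, matrixOp_mul_integralOp, smul_mul_assoc, integralOp_mul_matrixOp,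
    smul_mul_smul_comm, integralOp_mul_self, smul_zero, add_zero, smul_smul, smul_smul, add_assoc,
    ← add_smul, mul_comm κ' q]

lemma entriesOp_add (lam p q s α β κ p' q' s' α' β' κ' : 𝕜) :
    entriesOp lam (p + p') (q + q') (s + s') (α + α') (β + β') (κ + κ') =
      entriesOp lam p q s α β κ + entriesOp lam p' q' s' α' β' κ' := by
  rw [entriesOp, entriesOp, entriesOp, add_add_add_comm, ← matrixOp_add, upperMatrix_add, add_smul]
  ring_nf

lemma entriesOp_smul (lam c p q s α β κ : 𝕜) :
    entriesOp lam (c * p) (c * q) (c * s) (c * α) (c * β) (c * κ) =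
      c • entriesOp lam p q s α β κ := by
  rw [entriesOp, entriesOp, smul_add, ← matrixOp_upperMatrix_smul, smul_smul]
  ring_nf

lemma entriesOp_one (lam : 𝕜) : entriesOp lam 1 1 1 0 0 0 = 1 := by
  rw [entriesOp, zero_smul, add_zero,
    ← (algebraMap 𝕜 (Module.End 𝕜 (Fin 3 → SmoothFun 𝕜))).map_one, ← matrixOp_scalar]
  simp

lemma entriesOp_eq_zero {lam p q s α β κ : 𝕜} (h : entriesOp lam p q s α β κ = 0) :
    p = 0 ∧ q = 0 ∧ s = 0 ∧ α = 0 ∧ β = 0 ∧ κ = 0 := by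
  obtain ⟨h1, h2, h3, h4, h5, -, h6⟩ := eq_zero_of_matrixOp_add_eq_zero h
  exact ⟨h1, h2, h3, h4, h5, h6⟩

/-- An algebra whose elements parametrize the solutions of the entry equations, compatibly with
products, is isomorphic to the algebra of symmetries. -/
lemma nonempty_algEquiv_of_entries {lam mu : 𝕜} {B : Type*} [Ring B] [Algebra 𝕜 B]
    (p q s α β κ : B →ₗ[𝕜] 𝕜)
    (hone : p 1 = 1 ∧ q 1 = 1 ∧ s 1 = 1 ∧ α 1 = 0 ∧ β 1 = 0 ∧ κ 1 = 0)
    (hmul : ∀ x y, p (x * y) = p x * p y ∧ q (x * y) = q x * q y ∧ s (x * y) = s x * s y ∧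
      α (x * y) = q x * α y + α x * p y ∧ β (x * y) = s x * β y + β x * q y ∧
      κ (x * y) = q x * κ y + κ x * s y)
    (hsym : ∀ x, EntryEquations lam mu (p x) (q x) (s x) (α x) (β x))
    (hκ : ∀ x, κ x = 0 ∨ lam = 0 ∧ mu = 1)
    (hinj : ∀ x, p x = 0 → q x = 0 → s x = 0 → α x = 0 → β x = 0 → κ x = 0 → x = 0)
    (hsurj : ∀ p' q' s' α' β' κ', EntryEquations lam mu p' q' s' α' β' →
      (κ' = 0 ∨ lam = 0 ∧ mu = 1) →
      ∃ x, p x = p' ∧ q x = q' ∧ s x = s' ∧ α x = α' ∧ β x = β' ∧ κ x = κ') :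
    Nonempty (symmetryAlgebra 2 lam mu ≃ₐ[𝕜] B) := by
  let F : B →ₗ[𝕜] coeffSymmetryAlgebra lam (mu - lam) :=
    { toFun := fun x => ⟨entriesOp lam (p x) (q x) (s x) (α x) (β x) (κ x),
        mem_coeffSymmetryAlgebra_iff.2 ⟨_, _, _, _, _, _, hsym x, hκ x, rfl⟩⟩
      map_add' := fun x y => Subtype.ext (by
        simp only [map_add]
        exact entriesOp_add ..)
      map_smul' := fun c x => Subtype.ext (by
        simp only [map_smul, smul_eq_mul]
        exact entriesOp_smul ..) }
  have hF : ∀ x, (F x : Module.End 𝕜 (Fin 3 → SmoothFun 𝕜)) =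
      entriesOp lam (p x) (q x) (s x) (α x) (β x) (κ x) := fun x => rfl
  have hF1 : F 1 = 1 := by
    obtain ⟨h1, h2, h3, h4, h5, h6⟩ := hone
    apply Subtype.ext
    rw [hF, h1, h2, h3, h4, h5, h6]
    exact entriesOp_one lam
  have hFmul : ∀ x y, F (x * y) = F x * F y := fun x y => by
    obtain ⟨h1, h2, h3, h4, h5, h6⟩ := hmul x y
    apply Subtype.ext
    rw [hF, h1, h2, h3, h4, h5, h6]
    exact (entriesOp_mul (hsym x) (hsym y)).symm
  let Φ : B →ₐ[𝕜] coeffSymmetryAlgebra lam (mu - lam) := AlgHom.ofLinearMap F hF1 hFmul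
  have hΦ : ∀ x, (Φ x : Module.End 𝕜 (Fin 3 → SmoothFun 𝕜)) =
      entriesOp lam (p x) (q x) (s x) (α x) (β x) (κ x) := hF
  have hbij : Function.Bijective Φ := by
    constructor
    · rw [injective_iff_map_eq_zero]
      intro x hx
      obtain ⟨h1, h2, h3, h4, h5, h6⟩ := entriesOp_eq_zero
        ((hΦ x).symm.trans (congrArg Subtype.val hx))
      exact hinj x h1 h2 h3 h4 h5 h6
    · rintro ⟨T, hT⟩
      obtain ⟨p', q', s', α', β', κ', h, hκ', rfl⟩ := mem_coeffSymmetryAlgebra_iff.1 hT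
      obtain ⟨x, rfl, rfl, rfl, rfl, rfl, rfl⟩ := hsurj p' q' s' α' β' κ' h hκ'
      exact ⟨x, rfl⟩
  exact ⟨((AlgEquiv.ofBijective Φ hbij).trans (symmetryAlgebraEquiv lam mu)).symm⟩

/-! ### Coordinates on the matrix algebras -/

/-- A matrix entry as a linear functional on a subalgebra. -/
noncomputable def entryMap {n : ℕ} (S : Subalgebra 𝕜 (Matrix (Fin n) (Fin n) 𝕜)) (i j : Fin n) :
    S →ₗ[𝕜] 𝕜 where
  toFun M := (M : Matrix (Fin n) (Fin n) 𝕜) i j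
  map_add' _ _ := rfl
  map_smul' _ _ := rfl

lemma entryMap_apply {n : ℕ} (S : Subalgebra 𝕜 (Matrix (Fin n) (Fin n) 𝕜)) (i j : Fin n) (M : S) :
    entryMap S i j M = (M : Matrix (Fin n) (Fin n) 𝕜) i j := rfl

lemma entryMap_one {n : ℕ} (S : Subalgebra 𝕜 (Matrix (Fin n) (Fin n) 𝕜)) (i j : Fin n) :
    entryMap S i j 1 = if i = j then 1 else 0 := by
  change (1 : Matrix (Fin n) (Fin n) 𝕜) i j = _
  rw [Matrix.one_apply]

lemma entryMap_mul {n : ℕ} (S : Subalgebra 𝕜 (Matrix (Fin n) (Fin n) 𝕜)) (i j : Fin n) (M N : S) :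
    entryMap S i j (M * N) = ∑ l, entryMap S i l M * entryMap S l j N := by
  change ((M : Matrix (Fin n) (Fin n) 𝕜) * (N : Matrix (Fin n) (Fin n) 𝕜)) i j = _
  rw [Matrix.mul_apply]
  rfl

lemma entryMap_injective {n : ℕ} (S : Subalgebra 𝕜 (Matrix (Fin n) (Fin n) 𝕜)) {M : S}
    (h : ∀ i j, entryMap S i j M = 0) : M = 0 :=
  Subtype.ext (Matrix.ext h)

lemma algA_entries (M : algA 𝕜) :
    entryMap (algA 𝕜) 0 1 M = 0 ∧ entryMap (algA 𝕜) 1 1 M = entryMap (algA 𝕜) 0 0 M := by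
  obtain ⟨_, a, b, rfl⟩ := M
  simp [entryMap_apply]

lemma exists_algA_entries (a b : 𝕜) : ∃ M : algA 𝕜, entryMap (algA 𝕜) 0 0 M = a ∧
    entryMap (algA 𝕜) 1 0 M = b :=
  ⟨⟨!![a, 0; b, a], a, b, rfl⟩, rfl, rfl⟩

lemma algA_eq_zero {M : algA 𝕜} (h : entryMap (algA 𝕜) 0 0 M = 0)
    (h' : entryMap (algA 𝕜) 1 0 M = 0) : M = 0 := by
  obtain ⟨h1, h2⟩ := algA_entries M
  refine entryMap_injective _ fun i j => ?_
  fin_cases i <;> fin_cases j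
  exacts [h, h1, h', h2.trans h]

lemma algA_mul_zero_zero (M N : algA 𝕜) : entryMap (algA 𝕜) 0 0 (M * N) =
    entryMap (algA 𝕜) 0 0 M * entryMap (algA 𝕜) 0 0 N := by
  rw [entryMap_mul, Fin.sum_univ_two, (algA_entries M).1, zero_mul, add_zero]

lemma algA_mul_one_zero (M N : algA 𝕜) : entryMap (algA 𝕜) 1 0 (M * N) =
    entryMap (algA 𝕜) 0 0 M * entryMap (algA 𝕜) 1 0 N +
      entryMap (algA 𝕜) 1 0 M * entryMap (algA 𝕜) 0 0 N := by
  rw [entryMap_mul, Fin.sum_univ_two, (algA_entries M).2, add_comm]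

lemma exists_algB_entries (a b c d : 𝕜) : ∃ M : algB 𝕜, entryMap (algB 𝕜) 0 0 M = a ∧
    entryMap (algB 𝕜) 2 2 M = b ∧ entryMap (algB 𝕜) 2 1 M = c ∧ entryMap (algB 𝕜) 0 3 M = d :=
  ⟨⟨!![a, 0, 0, d; 0, a, 0, 0; 0, c, b, 0; 0, 0, 0, b], a, b, c, d, rfl⟩, rfl, rfl, rfl, rfl⟩

lemma algB_eq_zero {M : algB 𝕜} (ha : entryMap (algB 𝕜) 0 0 M = 0)
    (hb : entryMap (algB 𝕜) 2 2 M = 0) (hc : entryMap (algB 𝕜) 2 1 M = 0)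
    (hd : entryMap (algB 𝕜) 0 3 M = 0) : M = 0 := by
  obtain ⟨_, a, b, c, d, rfl⟩ := M
  obtain rfl : a = 0 := ha
  obtain rfl : b = 0 := hb
  obtain rfl : c = 0 := hc
  obtain rfl : d = 0 := hd
  apply Subtype.ext
  ext i j
  fin_cases i <;> fin_cases j <;> rfl

lemma algB_mul (M N : algB 𝕜) :
    entryMap (algB 𝕜) 0 0 (M * N) = entryMap (algB 𝕜) 0 0 M * entryMap (algB 𝕜) 0 0 N ∧
    entryMap (algB 𝕜) 2 2 (M * N) = entryMap (algB 𝕜) 2 2 M * entryMap (algB 𝕜) 2 2 N ∧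
    entryMap (algB 𝕜) 2 1 (M * N) = entryMap (algB 𝕜) 2 2 M * entryMap (algB 𝕜) 2 1 N +
      entryMap (algB 𝕜) 2 1 M * entryMap (algB 𝕜) 0 0 N ∧
    entryMap (algB 𝕜) 0 3 (M * N) = entryMap (algB 𝕜) 0 0 M * entryMap (algB 𝕜) 0 3 N +
      entryMap (algB 𝕜) 0 3 M * entryMap (algB 𝕜) 2 2 N := by
  obtain ⟨_, a, b, c, d, rfl⟩ := M
  obtain ⟨_, a', b', c', d', rfl⟩ := N
  refine ⟨?_, ?_, ?_, ?_⟩ <;>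
    · rw [entryMap_mul]
      simp [entryMap_apply, Fin.sum_univ_four, add_comm]

/-! ### Solving the entry equations for each kind of weight -/

lemma nonempty_algEquiv_pi_two {lam mu : 𝕜} (h1 : mu - lam ≠ 1) (h2 : mu - lam ≠ 2)
    (hlam : lam ≠ 0) (hmu : mu ≠ 1) : Nonempty (symmetryAlgebra 2 lam mu ≃ₐ[𝕜] (Fin 2 → 𝕜)) := by
  have h1' : mu - lam - 1 ≠ 0 := sub_ne_zero.2 h1
  have h2' : mu - lam - 2 ≠ 0 := sub_ne_zero.2 h2
  let P : (Fin 2 → 𝕜) →ₗ[𝕜] 𝕜 := LinearMap.proj 0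
  let Q : (Fin 2 → 𝕜) →ₗ[𝕜] 𝕜 := LinearMap.proj 1
  refine nonempty_algEquiv_of_entries P Q P (-((2 * lam + 1) / (mu - lam - 2)) • (P - Q))
    (-(lam / (mu - lam - 1)) • (Q - P)) 0 ?_ ?_ ?_ ?_ ?_ ?_
  · simp [P, Q]
  · intro x y
    have hP : P (x * y) = P x * P y := rfl
    have hQ : Q (x * y) = Q x * Q y := rfl
    refine ⟨rfl, rfl, rfl, ?_, ?_, ?_⟩ <;>
      simp only [LinearMap.smul_apply, LinearMap.sub_apply, LinearMap.zero_apply, smul_eq_mul,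
        hP, hQ] <;> ring
  · intro x
    simp only [LinearMap.smul_apply, LinearMap.sub_apply, smul_eq_mul]
    refine ⟨?_, ?_, ?_⟩
    · field_simp
      ring
    · field_simp
      ring
    · ring
  · exact fun x => Or.inl rfl
  · intro x hp hq _ _ _ _
    ext i
    fin_cases i
    exacts [hp, hq]
  · rintro p q s α β κ ⟨e1, e2, e3⟩ (rfl | h)
    · have hs : s = p := by
        have := (mul_eq_zero.1 e3).resolve_left (mul_ne_zero hlam (sub_ne_zero.2 hmu))
        linear_combination -this
      subst hs
      refine ⟨![s, q], rfl, rfl, rfl, ?_, ?_, rfl⟩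
      · simp only [LinearMap.smul_apply, LinearMap.sub_apply, smul_eq_mul]
        change -((2 * lam + 1) / (mu - lam - 2)) * (s - q) = α
        field_simp
        linear_combination -e1
      · simp only [LinearMap.smul_apply, LinearMap.sub_apply, smul_eq_mul]
        change -(lam / (mu - lam - 1)) * (q - s) = β
        field_simp
        linear_combination -e2
    · exact absurd h.1 hlam

/-- The equation that ties p to s disappears, so p, q, s are all free. Off the lines mu - lam = 1, 2
they determine α and β. -/
lemma nonempty_algEquiv_pi_three {lam mu : 𝕜} (h1 : mu - lam ≠ 1) (h2 : mu - lam ≠ 2)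
    (h : lam * (mu - 1) = 0) : Nonempty (symmetryAlgebra 2 lam mu ≃ₐ[𝕜] (Fin 3 → 𝕜)) := by
  have h1' : mu - lam - 1 ≠ 0 := sub_ne_zero.2 h1
  have h2' : mu - lam - 2 ≠ 0 := sub_ne_zero.2 h2
  let P : (Fin 3 → 𝕜) →ₗ[𝕜] 𝕜 := LinearMap.proj 0
  let Q : (Fin 3 → 𝕜) →ₗ[𝕜] 𝕜 := LinearMap.proj 1
  let S : (Fin 3 → 𝕜) →ₗ[𝕜] 𝕜 := LinearMap.proj 2
  refine nonempty_algEquiv_of_entries P Q S (-((2 * lam + 1) / (mu - lam - 2)) • (P - Q))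
    (-(lam / (mu - lam - 1)) • (Q - S)) 0 ?_ ?_ ?_ ?_ ?_ ?_
  · simp [P, Q, S]
  · intro x y
    have hP : P (x * y) = P x * P y := rfl
    have hQ : Q (x * y) = Q x * Q y := rfl
    have hS : S (x * y) = S x * S y := rfl
    refine ⟨rfl, rfl, rfl, ?_, ?_, ?_⟩ <;>
      simp only [LinearMap.smul_apply, LinearMap.sub_apply, LinearMap.zero_apply, smul_eq_mul,
        hP, hQ, hS] <;> ring
  · intro x
    simp only [LinearMap.smul_apply, LinearMap.sub_apply, smul_eq_mul]
    refine ⟨?_, ?_, ?_⟩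
    · field_simp
      ring
    · field_simp
      ring
    · rw [h, zero_mul]
  · exact fun x => Or.inl rfl
  · intro x hp hq hs _ _ _
    ext i
    fin_cases i
    exacts [hp, hq, hs]
  · rintro p q s α β κ ⟨e1, e2, -⟩ (rfl | h')
    · refine ⟨![p, q, s], rfl, rfl, rfl, ?_, ?_, rfl⟩
      · simp only [LinearMap.smul_apply, LinearMap.sub_apply, smul_eq_mul]
        change -((2 * lam + 1) / (mu - lam - 2)) * (p - q) = α
        field_simp
        linear_combination -e1
      · simp only [LinearMap.smul_apply, LinearMap.sub_apply, smul_eq_mul]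
        change -(lam / (mu - lam - 1)) * (q - s) = β
        field_simp
        linear_combination -e2
    · exact absurd (by rw [h'.1, h'.2, sub_zero]) h1

/-- The coefficient of β vanishes: β is free, spans the nilpotent part, and the equations force p =
q = s and α = 0. -/
lemma nonempty_algEquiv_algA_of_sub_eq_one {lam mu : 𝕜} (h1 : mu - lam = 1) (hlam : lam ≠ 0) :
    Nonempty (symmetryAlgebra 2 lam mu ≃ₐ[𝕜] algA 𝕜) := by
  obtain rfl : mu = lam + 1 := by linear_combination h1
  refine nonempty_algEquiv_of_entries (entryMap (algA 𝕜) 0 0) (entryMap (algA 𝕜) 0 0)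
    (entryMap (algA 𝕜) 0 0) 0 (entryMap (algA 𝕜) 1 0) 0 ?_ ?_ ?_ ?_ ?_ ?_
  · simp [entryMap_one]
  · intro x y
    simp [algA_mul_zero_zero, algA_mul_one_zero]
  · intro x
    refine ⟨?_, ?_, ?_⟩
    · simp
    · ring
    · ring
  · exact fun x => Or.inl rfl
  · intro x hp _ _ _ hβ _
    exact algA_eq_zero hp hβ
  · rintro p q s α β κ ⟨e1, e2, e3⟩ (rfl | h)
    · obtain ⟨M, rfl, rfl⟩ := exists_algA_entries s β
      have hq : lam * (q - entryMap (algA 𝕜) 0 0 M) = 0 := by linear_combination e2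
      have hq' := sub_eq_zero.1 ((mul_eq_zero.1 hq).resolve_left hlam)
      have hp : lam * lam * (p - entryMap (algA 𝕜) 0 0 M) = 0 := by linear_combination e3
      have hp' := sub_eq_zero.1 ((mul_eq_zero.1 hp).resolve_left (mul_ne_zero hlam hlam))
      refine ⟨M, hp'.symm, hq'.symm, rfl, ?_, rfl, rfl⟩
      rw [hp', hq'] at e1
      rw [LinearMap.zero_apply]
      linear_combination e1
    · exact absurd h.1 hlam

/-- Here α is the free nilpotent entry, and the three excluded values of lam are those at which p =
q = s is no longer forced. -/
lemma nonempty_algEquiv_algA_of_sub_eq_two {lam mu : 𝕜} (h2 : mu - lam = 2) (hlam : lam ≠ 0)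
    (hlam' : lam ≠ -1 / 2) (hlam'' : lam ≠ -1) :
    Nonempty (symmetryAlgebra 2 lam mu ≃ₐ[𝕜] algA 𝕜) := by
  obtain rfl : mu = lam + 2 := by linear_combination h2
  refine nonempty_algEquiv_of_entries (entryMap (algA 𝕜) 0 0) (entryMap (algA 𝕜) 0 0)
    (entryMap (algA 𝕜) 0 0) (entryMap (algA 𝕜) 1 0) 0 0 ?_ ?_ ?_ ?_ ?_ ?_
  · simp [entryMap_one]
  · intro x y
    simp [algA_mul_zero_zero, algA_mul_one_zero]
  · intro x
    refine ⟨?_, ?_, ?_⟩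
    · ring
    · simp
    · ring
  · exact fun x => Or.inl rfl
  · intro x hp _ _ hα _ _
    exact algA_eq_zero hp hα
  · rintro p q s α β κ ⟨e1, e2, e3⟩ (rfl | h)
    · obtain ⟨M, rfl, rfl⟩ := exists_algA_entries p α
      have hq : (2 * lam + 1) * (entryMap (algA 𝕜) 0 0 M - q) = 0 := by linear_combination e1
      have hq' := sub_eq_zero.1 ((mul_eq_zero.1 hq).resolve_left fun h =>
        hlam' (by linear_combination (1 / 2) * h))
      have hs : lam * (lam + 1) * (entryMap (algA 𝕜) 0 0 M - s) = 0 := by linear_combination e3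
      have hs' := sub_eq_zero.1 ((mul_eq_zero.1 hs).resolve_left (mul_ne_zero hlam fun h =>
        hlam'' (by linear_combination h)))
      refine ⟨M, rfl, hq', hs', rfl, ?_, rfl⟩
      rw [← hq', ← hs'] at e2
      rw [LinearMap.zero_apply]
      linear_combination -e2
    · exact absurd h.1 hlam

/-- Both coefficients of the first equation vanish, so q is independent of p = s, and the free entry
α is the off-diagonal entry linking p to q. -/
lemma nonempty_algEquiv_algT :
    Nonempty (symmetryAlgebra 2 (-1 / 2 : 𝕜) (3 / 2) ≃ₐ[𝕜] algT 𝕜 2) := by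
  have hT : ∀ M : algT 𝕜 2, entryMap (algT 𝕜 2) 0 1 M = 0 := fun M => M.2 0 1 (by decide)
  refine nonempty_algEquiv_of_entries (entryMap (algT 𝕜 2) 0 0) (entryMap (algT 𝕜 2) 1 1)
    (entryMap (algT 𝕜 2) 0 0) (entryMap (algT 𝕜 2) 1 0)
    ((1 / 2 : 𝕜) • (entryMap (algT 𝕜 2) 1 1 - entryMap (algT 𝕜 2) 0 0)) 0 ?_ ?_ ?_ ?_ ?_ ?_
  · simp [entryMap_one]
  · intro x y
    simp only [LinearMap.smul_apply, LinearMap.sub_apply, LinearMap.zero_apply, smul_eq_mul,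
      entryMap_mul, Fin.sum_univ_two, hT]
    refine ⟨?_, ?_, ?_, ?_, ?_, ?_⟩ <;> ring
  · intro x
    simp only [LinearMap.smul_apply, LinearMap.sub_apply, smul_eq_mul]
    refine ⟨?_, ?_, ?_⟩ <;> ring
  · exact fun x => Or.inl rfl
  · intro x hp hq _ hα _ _
    refine entryMap_injective _ fun i j => ?_
    fin_cases i <;> fin_cases j
    exacts [hp, hT x, hα, hq]
  · rintro p q s α β κ ⟨-, e2, e3⟩ (rfl | h)
    · have hs : p = s := by linear_combination (-4) * e3
      subst hs
      refine ⟨⟨!![p, 0; α, q], ?_⟩, rfl, rfl, rfl, rfl, ?_, rfl⟩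
      · intro i j hij
        fin_cases i <;> fin_cases j <;> first | rfl | exact absurd hij (by decide)
      · simp only [LinearMap.smul_apply, LinearMap.sub_apply, smul_eq_mul]
        change 1 / 2 * (q - p) = β
        linear_combination -e2
    · exact absurd h.1 (by norm_num)

/-- The free parameters are p = q together with α, forming 𝔞, and the separate diagonal entry s; β =
0. -/
lemma nonempty_algEquiv_zero_two :
    Nonempty (symmetryAlgebra 2 (0 : 𝕜) 2 ≃ₐ[𝕜] (algA 𝕜 × 𝕜)) := by
  let A : algA 𝕜 × 𝕜 →ₗ[𝕜] 𝕜 := entryMap (algA 𝕜) 0 0 ∘ₗ LinearMap.fst 𝕜 _ _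
  let S : algA 𝕜 × 𝕜 →ₗ[𝕜] 𝕜 := LinearMap.snd 𝕜 _ _
  refine nonempty_algEquiv_of_entries A A S (entryMap (algA 𝕜) 1 0 ∘ₗ LinearMap.fst 𝕜 _ _) 0 0
    ?_ ?_ ?_ ?_ ?_ ?_
  · simp [A, S, entryMap_one]
  · intro x y
    simp [A, S, algA_mul_zero_zero, algA_mul_one_zero]
  · intro x
    refine ⟨?_, ?_, ?_⟩
    · ring
    · simp
    · ring
  · exact fun x => Or.inl rfl
  · intro x hp _ hs hα _ _
    exact Prod.ext (algA_eq_zero hp hα) hs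
  · rintro p q s α β κ ⟨e1, e2, -⟩ (rfl | h)
    · obtain ⟨M, hM, hM'⟩ := exists_algA_entries p α
      refine ⟨(M, s), hM, hM.trans ?_, rfl, hM', ?_, rfl⟩
      · linear_combination e1
      · rw [LinearMap.zero_apply]
        linear_combination -e2
    · exact absurd h.2 (by norm_num)

/-- The parameters are the same as for (0, 2), except that β = q - s instead of 0. -/
lemma nonempty_algEquiv_neg_one_one :
    Nonempty (symmetryAlgebra 2 (-1 : 𝕜) 1 ≃ₐ[𝕜] (algA 𝕜 × 𝕜)) := by
  let A : algA 𝕜 × 𝕜 →ₗ[𝕜] 𝕜 := entryMap (algA 𝕜) 0 0 ∘ₗ LinearMap.fst 𝕜 _ _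
  let S : algA 𝕜 × 𝕜 →ₗ[𝕜] 𝕜 := LinearMap.snd 𝕜 _ _
  refine nonempty_algEquiv_of_entries A A S (entryMap (algA 𝕜) 1 0 ∘ₗ LinearMap.fst 𝕜 _ _) (A - S) 0
    ?_ ?_ ?_ ?_ ?_ ?_
  · simp [A, S, entryMap_one]
  · intro x y
    have hA : A (x * y) = A x * A y := algA_mul_zero_zero _ _
    have hS : S (x * y) = S x * S y := rfl
    refine ⟨hA, hA, hS, algA_mul_one_zero _ _, ?_, ?_⟩
    · rw [LinearMap.sub_apply, LinearMap.sub_apply, LinearMap.sub_apply, hA, hS]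
      ring
    · simp
  · intro x
    rw [LinearMap.sub_apply]
    refine ⟨?_, ?_, ?_⟩ <;> ring
  · exact fun x => Or.inl rfl
  · intro x hp _ hs hα _ _
    exact Prod.ext (algA_eq_zero hp hα) hs
  · rintro p q s α β κ ⟨e1, e2, -⟩ (rfl | h)
    · obtain ⟨M, hM, hM'⟩ := exists_algA_entries p α
      have hpq : p = q := by linear_combination -e1
      refine ⟨(M, s), hM, hM.trans hpq, rfl, hM', ?_, rfl⟩
      change entryMap (algA 𝕜) 0 0 M - s = β
      rw [hM]
      linear_combination -e2 + hpq
    · exact absurd h.1 (by norm_num)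

/-- Only α = p - q is constrained. The entries β and κ link q and s in opposite directions with
vanishing products, as a derivative kills constants and the integral kills derivatives; 𝔟 places
them accordingly at (2, 1) and (0, 3), and p is the extra summand. -/
lemma nonempty_algEquiv_zero_one :
    Nonempty (symmetryAlgebra 2 (0 : 𝕜) 1 ≃ₐ[𝕜] (algB 𝕜 × 𝕜)) := by
  let E : Fin 4 → Fin 4 → algB 𝕜 × 𝕜 →ₗ[𝕜] 𝕜 := fun i j =>
    entryMap (algB 𝕜) i j ∘ₗ LinearMap.fst 𝕜 _ _
  let P : algB 𝕜 × 𝕜 →ₗ[𝕜] 𝕜 := LinearMap.snd 𝕜 _ _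
  refine nonempty_algEquiv_of_entries P (E 0 0) (E 2 2) (P - E 0 0) (E 2 1) (E 0 3)
    ?_ ?_ ?_ ?_ ?_ ?_
  · simp [E, P, entryMap_one]
  · intro x y
    obtain ⟨h1, h2, h3, h4⟩ := algB_mul x.1 y.1
    refine ⟨rfl, h1, h2, ?_, h3, h4⟩
    have hP : P (x * y) = P x * P y := rfl
    have hE : E 0 0 (x * y) = E 0 0 x * E 0 0 y := h1
    rw [LinearMap.sub_apply, LinearMap.sub_apply, LinearMap.sub_apply, hP, hE]
    ring
  · intro x
    rw [LinearMap.sub_apply]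
    refine ⟨?_, ?_, ?_⟩ <;> ring
  · exact fun x => Or.inr ⟨rfl, rfl⟩
  · intro x hp hq hs _ hβ hκ
    exact Prod.ext (algB_eq_zero hq hs hβ hκ) hp
  · rintro p q s α β κ ⟨e1, -, -⟩ -
    obtain ⟨M, h1, h2, h3, h4⟩ := exists_algB_entries q s β κ
    refine ⟨(M, p), rfl, h1, h2, ?_, h3, h4⟩
    change p - entryMap (algB 𝕜) 0 0 M = α
    rw [h1]
    linear_combination e1

end CircleDensities

open CircleDensities in
theorem theorem3p5 (𝕜 : Type*) [RCLike 𝕜] :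
    (∀ lam mu : 𝕜, mu - lam ≠ 1 → mu - lam ≠ 2 → lam ≠ 0 → mu ≠ 1 →
      Nonempty (symmetryAlgebra 2 lam mu ≃ₐ[𝕜] (Fin 2 → 𝕜))) ∧
    (∀ lam mu : 𝕜, mu - lam = 1 → lam ≠ 0 →
      Nonempty (symmetryAlgebra 2 lam mu ≃ₐ[𝕜] algA 𝕜)) ∧
    (∀ lam mu : 𝕜, mu - lam = 2 → lam ≠ 0 → lam ≠ -1 / 2 → lam ≠ -1 →
      Nonempty (symmetryAlgebra 2 lam mu ≃ₐ[𝕜] algA 𝕜)) ∧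
    (∀ lam mu : 𝕜, lam = 0 → mu ≠ 2 → mu ≠ 1 →
      Nonempty (symmetryAlgebra 2 lam mu ≃ₐ[𝕜] (Fin 3 → 𝕜))) ∧
    (∀ lam mu : 𝕜, mu = 1 → lam ≠ 0 → lam ≠ -1 →
      Nonempty (symmetryAlgebra 2 lam mu ≃ₐ[𝕜] (Fin 3 → 𝕜))) ∧
    Nonempty (symmetryAlgebra 2 (-1 / 2 : 𝕜) (3 / 2) ≃ₐ[𝕜] algT 𝕜 2) ∧
    Nonempty (symmetryAlgebra 2 (0 : 𝕜) 2 ≃ₐ[𝕜] (algA 𝕜 × 𝕜)) ∧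
    Nonempty (symmetryAlgebra 2 (-1 : 𝕜) 1 ≃ₐ[𝕜] (algA 𝕜 × 𝕜)) ∧
    Nonempty (symmetryAlgebra 2 (0 : 𝕜) 1 ≃ₐ[𝕜] (algB 𝕜 × 𝕜)) := by
  refine ⟨fun _ _ => nonempty_algEquiv_pi_two, fun _ _ => nonempty_algEquiv_algA_of_sub_eq_one,
    fun _ _ => nonempty_algEquiv_algA_of_sub_eq_two, ?_, ?_, nonempty_algEquiv_algT,
    nonempty_algEquiv_zero_two, nonempty_algEquiv_neg_one_one, nonempty_algEquiv_zero_one⟩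
  · rintro _ mu rfl h2 h1
    exact nonempty_algEquiv_pi_three (by rwa [sub_zero]) (by rwa [sub_zero]) (zero_mul _)
  · rintro lam _ rfl h0 h1
    exact nonempty_algEquiv_pi_three (fun h => h0 (by linear_combination -h))
      (fun h => h1 (by linear_combination -h)) (by rw [sub_self, mul_zero])
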